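/- Let $k$ be an algebraically closed field of characteristic $p\ge 5$, let $O=k[X,Y]/(X^p,Y^p)$ with $x,y$ the images of $X,Y$ and divided powers $x^{(i)}=x^i/i!$, $y^{(j)}=y^j/j!$ for $0\le i,j\le p-1$ and $x^{(-1)}=y^{(-1)}=0$, and let $W=\operatorname{Der}_k(O)$. Let $H=H(2;(1,1);\Phi(1))$ be the Lie subalgebra of $W$ spanned by $y^{(j-1)}\partial_x-x^{(p-1)}y^{(j)}\partial_y$ and $x^{(i-1)}y^{(j)}\partial_y-x^{(i)}y^{(j-1)}\partial_x$ $(1\le i\le p-1,\ 0\le j\le p-1)$, and let $\widehat H=H+k(x\partial_x+y\partial_y)$ be its minimal $p$-envelope, with $p$-map $D^{[p]}=D^p$. An $\widehat H$-module is restricted if $D^{[p]}$ acts on it as the $p$-th power of the action of $D$, for all $D\in\widehat H$. For $n\ge 0$ let $\widehat H_{(n)}$ be the set of $D\in\widehat H$ with $D(x),D(y)\in (x,y)^{n+1}$; then $\widehat H_{(0)}/\widehat H_{(1)}\cong\mathfrak{gl}_2$, spanned by the classes acting on $(x,y)/(x,y)^2$ as $x\partial_x,\ y\partial_y,\ x\partial_y,\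 y\partial_x$. For $\lambda=(\lambda_1,\lambda_2)\in\mathbb F_p^2$ let $L_0(\lambda)$ be the simple restricted $\mathfrak{gl}_2$-module of highest weight $\lambda$ (with respect to $x\partial_x,y\partial_y$, the highest weight vector being killed by $x\partial_y$), regarded as an $\widehat H_{(0)}$-module on which $\widehat H_{(1)}$ acts by zero. Let $\mathfrak u(\cdot)$ denote restricted universal enveloping algebras, let $Z(\lambda)=\mathfrak u(\widehat H)\otimes_{\mathfrak u(\widehat H_{(0)})}L_0(\lambda)$, and let $L(\lambda)$ be the quotient of $Z(\lambda)$ by the sum of all its proper submodules. A maximal vector of weight $\mu\in k^2$ in an $\widehat H$-module is a nonzero $v$ with $x\partial_x\cdot v=\mu_1v$, $y\partial_y\cdot v=\mu_2v$ and $D\cdot v=0$ for all $D\in\widehat H_{(1)}\oplus k\,x\partial_y$. **Proposition.** There are exactly two isomorphism classes of $(p^2-1)$-dimensional simple restricted $\widehat H$-modules, represented by $L(-1,-1)$ and $L(0,-1)$. That is: 1. $L(-1,-1)$ and $L(0,-1)$ are simple restricted $\widehat H$-modules of dimension $p^2-1$; 2. every simple restricted $\widehat H$-module of dimension $p^2-1$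 is isomorphic to $L(-1,-1)$ or to $L(0,-1)$; 3. $L(-1,-1)$ has no maximal vector of weight $(0,-1)$, and $L(-1,-1)$ and $L(0,-1)$ are not isomorphic. -/

import Mathlib

namespace HamiltonianLie

noncomputable section

open MvPolynomial

set_option linter.unusedSectionVars false

/-- The ideal `(X ^ p, Y ^ p)` of `k[X, Y]`. -/
def truncIdeal (k : Type*) [Field k] (p : ℕ) : Ideal (MvPolynomial (Fin 2) k) :=
  Ideal.span {X 0 ^ p, X 1 ^ p}

/-- The truncated polynomial ring `O(2; (1,1)) = k[X, Y] / (X ^ p, Y ^ p)`. -/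
def O (k : Type*) [Field k] (p : ℕ) : Type _ := MvPolynomial (Fin 2) k ⧸ truncIdeal k p

instance (k : Type*) [Field k] (p : ℕ) : CommRing (O k p) :=
  inferInstanceAs (CommRing (MvPolynomial (Fin 2) k ⧸ truncIdeal k p))

instance (k : Type*) [Field k] (p : ℕ) : Algebra k (O k p) :=
  inferInstanceAs (Algebra k (MvPolynomial (Fin 2) k ⧸ truncIdeal k p))

/-- The quotient map `k[X, Y] → O(2; (1,1))`. -/
def quotMap (k : Type*) [Field k] (p : ℕ) : MvPolynomial (Fin 2) k →ₐ[k] O k p :=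
  Ideal.Quotient.mkₐ k (truncIdeal k p)

theorem quotMap_surjective (k : Type*) [Field k] (p : ℕ) : Function.Surjective (quotMap k p) :=
  Ideal.Quotient.mkₐ_surjective k _

theorem quotMap_eq_zero_iff {k : Type*} [Field k] {p : ℕ} {f : MvPolynomial (Fin 2) k} :
    quotMap k p f = 0 ↔ f ∈ truncIdeal k p :=
  Ideal.Quotient.eq_zero_iff_mem

/-- `W(2; (1,1))`, the Lie algebra of derivations of `O(2; (1,1))`. -/
abbrev W (k : Type*) [Field k] (p : ℕ) : Type _ := Derivation k (O k p) (O k p)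

section Generators

variable (k : Type*) [Field k] (p : ℕ)

/-- The image `x` of `X`. -/
def x : O k p := quotMap k p (X 0)

/-- The image `y` of `Y`. -/
def y : O k p := quotMap k p (X 1)

theorem x_pow : x k p ^ p = 0 := by
  rw [x, ← map_pow, quotMap_eq_zero_iff]
  exact Ideal.subset_span (by simp)

theorem y_pow : y k p ^ p = 0 := by
  rw [y, ← map_pow, quotMap_eq_zero_iff]
  exact Ideal.subset_span (by simp)

variable {k p}

theorem adjoin_xy : Algebra.adjoin k {x k p, y k p} = ⊤ := by
  have h := MvPolynomial.adjoin_range_X (R := k) (σ := Fin 2)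
  have h2 := congrArg (Subalgebra.map (quotMap k p)) h
  rw [AlgHom.map_adjoin, Algebra.map_top,
    (AlgHom.range_eq_top _).2 (quotMap_surjective k p)] at h2
  rw [← h2]
  congr 1
  ext t
  simp only [Set.mem_insert_iff, Set.mem_singleton_iff, Set.mem_image, Set.mem_range,
    Fin.exists_fin_two, x, y]
  constructor
  · rintro (rfl | rfl)
    exacts [⟨_, Or.inl rfl, rfl⟩, ⟨_, Or.inr rfl, rfl⟩]
  · rintro ⟨_, rfl | rfl, rfl⟩
    exacts [Or.inl rfl, Or.inr rfl]

theorem W_ext {D E : W k p} (hx : D (x k p) = E (x k p)) (hy : D (y k p) = E (y k p)) : D = E :=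
  Derivation.ext_of_adjoin_eq_top _ adjoin_xy (by
    rintro t (rfl | rfl)
    exacts [hx, hy])

/-- Divided powers `t ^ (n) = t ^ n / n!`, understood to be zero for `n < 0`.
They are used for `n < p` only. -/
def divPow (t : O k p) : ℤ → O k p
  | Int.ofNat n => ((n.factorial : k)⁻¹) • t ^ n
  | Int.negSucc _ => 0

theorem divPow_natCast (t : O k p) (n : ℕ) :
    divPow t (n : ℤ) = ((n.factorial : k)⁻¹) • t ^ n := rfl

theorem divPow_zero (t : O k p) : divPow t 0 = 1 := by
  change ((Nat.factorial 0 : k)⁻¹) • t ^ 0 = 1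
  simp

theorem divPow_neg_one (t : O k p) : divPow t (-1) = 0 := rfl

variable [CharP k p]

theorem pderiv_mem_truncIdeal (i : Fin 2) (f : MvPolynomial (Fin 2) k)
    (hf : f ∈ truncIdeal k p) : pderiv i f ∈ truncIdeal k p := by
  have hp : ((p : ℕ) : MvPolynomial (Fin 2) k) = 0 := by
    rw [← map_natCast (C : k →+* MvPolynomial (Fin 2) k), CharP.cast_eq_zero, map_zero]
  rw [truncIdeal, Ideal.mem_span_pair] at hf
  obtain ⟨a, b, rfl⟩ := hf
  rw [truncIdeal]
  rw [map_add, pderiv_mul, pderiv_mul, pderiv_pow, pderiv_pow, hp]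
  refine Ideal.add_mem _ ?_ ?_
  · simpa using Ideal.mul_mem_left _ _ (Ideal.subset_span (by simp))
  · simpa using Ideal.mul_mem_left _ _ (Ideal.subset_span (by simp))

variable (k p)

/-- The derivation of `O(2; (1,1))` induced by the partial derivative in the `i`-th variable. -/
def partialDeriv (i : Fin 2) : W k p :=
  Derivation.liftOfSurjective (f := quotMap k p) (quotMap_surjective k p) (d := pderiv i)
    fun f hf => by
      rw [quotMap_eq_zero_iff] at hf ⊢
      exact pderiv_mem_truncIdeal i f hf

/-- `∂_x` -/
def dx : W k p := partialDeriv k p 0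

/-- `∂_y` -/
def dy : W k p := partialDeriv k p 1

variable {k p}

theorem partialDeriv_mk (i : Fin 2) (f : MvPolynomial (Fin 2) k) :
    partialDeriv k p i (quotMap k p f) = quotMap k p (pderiv i f) :=
  Derivation.liftOfSurjective_apply (f := quotMap k p) (quotMap_surjective k p) (d := pderiv i)
    (fun f hf => by
      rw [quotMap_eq_zero_iff] at hf ⊢
      exact pderiv_mem_truncIdeal i f hf) f

@[simp] theorem dx_x : dx k p (x k p) = 1 := by
  simp [dx, x, partialDeriv_mk]

@[simp] theorem dx_y : dx k p (y k p) = 0 := by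
  simp [dx, y, partialDeriv_mk]

@[simp] theorem dy_x : dy k p (x k p) = 0 := by
  simp [dy, x, partialDeriv_mk]

@[simp] theorem dy_y : dy k p (y k p) = 1 := by
  simp [dy, y, partialDeriv_mk]

/-- Every derivation is `D(x) ∂_x + D(y) ∂_y`. -/
theorem W_eq (D : W k p) : D = D (x k p) • dx k p + D (y k p) • dy k p :=
  W_ext (by simp) (by simp)

theorem W_apply (D : W k p) (f : O k p) :
    D f = D (x k p) * dx k p f + D (y k p) * dy k p f := by
  conv_lhs => rw [W_eq D]
  simp

theorem dx_dy_comm (f : O k p) : dx k p (dy k p f) = dy k p (dx k p f) := by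
  have : ⁅dx k p, dy k p⁆ = 0 := W_ext (by simp [Derivation.commutator_apply])
    (by simp [Derivation.commutator_apply])
  have h := Derivation.congr_fun this f
  rw [Derivation.commutator_apply, Derivation.zero_apply, sub_eq_zero] at h
  exact h

end Generators

section Algebra

variable (k : Type*) [Field k] (p : ℕ) [Fact p.Prime] [Fact (5 ≤ p)] [CharP k p]

/-- The vector fields `y^(j-1) ∂_x - x^(p-1) y^(j) ∂_y` for `0 ≤ j ≤ p - 1` and
`x^(i-1) y^(j) ∂_y - x^(i) y^(j-1) ∂_x` for `1 ≤ i ≤ p - 1`, `0 ≤ j ≤ p - 1`. -/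
def hamBasis : Set (W k p) :=
  {D | ∃ j : ℕ, j ≤ p - 1 ∧
    D = divPow (y k p) (j - 1) • dx k p -
      (divPow (x k p) (p - 1) * divPow (y k p) j) • dy k p} ∪
  {D | ∃ i j : ℕ, 1 ≤ i ∧ i ≤ p - 1 ∧ j ≤ p - 1 ∧
    D = (divPow (x k p) (i - 1) * divPow (y k p) j) • dy k p -
      (divPow (x k p) i * divPow (y k p) (j - 1)) • dx k p}

/-- The element `x ∂_x + y ∂_y`. -/
def euler : W k p := x k p • dx k p + y k p • dy k p

variable {k p}

section
variable (k p)
theorem factorial_ne_zero' {n : ℕ} (hn : n < p) : (n.factorial : k) ≠ 0 := by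
  rw [Ne, CharP.cast_eq_zero_iff k p, (Fact.out : p.Prime).dvd_factorial]
  omega
end

theorem deriv_divPow (D : W k p) (t : O k p) (n : ℕ) (hn : n < p) :
    D (divPow t n) = divPow t (n - 1) * D t := by
  cases n with
  | zero => simp [divPow_zero, divPow_neg_one]
  | succ m =>
    have h : (((m + 1 : ℕ) : ℤ) - 1) = (m : ℤ) := by push_cast; ring
    rw [h, divPow_natCast, divPow_natCast, Derivation.map_smul, Derivation.leibniz_pow]
    have hf := factorial_ne_zero' k p hn
    have hf' := factorial_ne_zero' k p (show m < p by omega)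
    have hm : ((m + 1 : ℕ) : k) ≠ 0 := by
      intro h0
      apply hf
      rw [Nat.factorial_succ, Nat.cast_mul, h0, zero_mul]
    rw [Nat.add_sub_cancel, ← Nat.cast_smul_eq_nsmul k, smul_smul, smul_eq_mul, smul_mul_assoc]
    congr 1
    rw [Nat.factorial_succ, Nat.cast_mul, mul_inv, mul_comm, ← mul_assoc, mul_inv_cancel₀ hm,
      one_mul]

section
variable (k p)
/-- `x^(p-1)` -/
def xtop : O k p := divPow (x k p) (p - 1)
end

theorem xtop_eq : xtop k p = divPow (x k p) ((p - 1 : ℕ) : ℤ) := by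
  have := (Fact.out : p.Prime).one_le
  rw [xtop]; congr 1; omega

@[simp] theorem dy_xtop : dy k p (xtop k p) = 0 := by
  have := (Fact.out : p.Prime).one_le
  rw [xtop_eq, deriv_divPow _ _ _ (by omega)]; simp

theorem x_mul_dx_xtop : x k p * dx k p (xtop k p) = - xtop k p := by
  have := (Fact.out : p.Prime).two_le
  obtain ⟨q, rfl⟩ : ∃ q, p = q + 1 := ⟨p - 1, by omega⟩
  rw [xtop_eq, Nat.add_sub_cancel, divPow_natCast, Derivation.map_smul, Derivation.leibniz_pow,
    dx_x, mul_smul_comm, ← smul_neg]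
  congr 1
  have hq : ((q : ℕ) : O k (q + 1)) = -1 := by
    have h : ((q + 1 : ℕ) : O k (q + 1)) = 0 := by
      rw [← map_natCast (algebraMap k (O k (q + 1))), CharP.cast_eq_zero, map_zero]
    rw [Nat.cast_add, Nat.cast_one] at h
    exact eq_neg_of_add_eq_zero_left h
  rw [nsmul_eq_mul, hq, smul_eq_mul, mul_one]
  obtain ⟨r, rfl⟩ : ∃ r, q = r + 1 := ⟨q - 1, by omega⟩
  rw [Nat.add_sub_cancel, pow_succ]; ring

theorem xtop_mul_divPow (i : ℕ) (hi : 1 ≤ i) : xtop k p * divPow (x k p) i = 0 := by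
  have := (Fact.out : p.Prime).one_le
  rw [xtop_eq, divPow_natCast, divPow_natCast, smul_mul_smul_comm, ← pow_add,
    show p - 1 + i = p + (i - 1) by omega, pow_add, x_pow, zero_mul, smul_zero]

theorem span_divPow : Submodule.span k {f : O k p | ∃ i j : ℕ, i ≤ p - 1 ∧ j ≤ p - 1 ∧
    f = divPow (x k p) i * divPow (y k p) j} = ⊤ := by
  rw [eq_top_iff]
  rintro f -
  obtain ⟨f, rfl⟩ := quotMap_surjective k p f
  induction f using MvPolynomial.induction_on' with
  | add f g hf hg => rw [map_add]; exact Submodule.add_mem _ hf hg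
  | monomial s c =>
    have h : quotMap k p (monomial s c) = c • (x k p ^ s 0 * y k p ^ s 1) := by
      rw [monomial_eq, Finsupp.prod_fintype _ _ (by simp), Fin.prod_univ_two, C_mul', map_smul,
        map_mul, map_pow, map_pow]
      rfl
    rw [h]
    refine Submodule.smul_mem _ _ ?_
    by_cases h0 : p ≤ s 0
    · rw [show s 0 = p + (s 0 - p) by omega, pow_add, x_pow]; simp
    by_cases h1 : p ≤ s 1
    · rw [show s 1 = p + (s 1 - p) by omega, pow_add, y_pow]; simp
    have e : x k p ^ s 0 * y k p ^ s 1 = (((s 0).factorial : k) * ((s 1).factorial : k)) •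
        (divPow (x k p) (s 0) * divPow (y k p) (s 1)) := by
      rw [divPow_natCast, divPow_natCast, smul_mul_smul_comm, smul_smul, ← mul_inv,
        mul_inv_cancel₀ (mul_ne_zero (factorial_ne_zero' k p (by omega))
          (factorial_ne_zero' k p (by omega))), one_smul]
    rw [e]
    exact Submodule.smul_mem _ _ (Submodule.subset_span ⟨_, _, by omega, by omega, rfl⟩)

section
variable (k p)
/-- The linear map `f ↦ (∂_x f + x^(p-1) f) ∂_y - (∂_y f) ∂_x`. -/
def ham : O k p →ₗ[k] W k p where
  toFun f := (dx k p f + xtop k p * f) • dy k p - dy k p f • dx k p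
  map_add' f g := by simp only [map_add, mul_add, add_smul]; abel
  map_smul' c f := by
    rw [Derivation.map_smul, Derivation.map_smul, mul_smul_comm, ← smul_add, smul_assoc,
      smul_assoc, RingHom.id_apply]
    exact (smul_sub c (_ : W k p) (_ : W k p)).symm
end

@[simp] theorem ham_x (f : O k p) : ham k p f (x k p) = - dy k p f := by simp [ham]

@[simp] theorem ham_y (f : O k p) : ham k p f (y k p) = dx k p f + xtop k p * f := by simp [ham]

@[simp] theorem euler_x : euler k p (x k p) = x k p := by simp [euler]

@[simp] theorem euler_y : euler k p (y k p) = y k p := by simp [euler]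

theorem ham_divPow_zero (j : ℕ) (hj : j ≤ p - 1) :
    ham k p (divPow (x k p) (0 : ℕ) * divPow (y k p) j) =
      -(divPow (y k p) (j - 1) • dx k p -
      (divPow (x k p) (p - 1) * divPow (y k p) j) • dy k p) := by
  have := (Fact.out : p.Prime).one_le
  apply W_ext <;>
  simp [deriv_divPow _ _ j (show j < p by omega),
    xtop, divPow_zero]

theorem ham_divPow (i j : ℕ) (h1 : 1 ≤ i) (hi : i ≤ p - 1) (hj : j ≤ p - 1) :
    ham k p (divPow (x k p) i * divPow (y k p) j) =
      (divPow (x k p) (i - 1) * divPow (y k p) j) • dy k p -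
      (divPow (x k p) i * divPow (y k p) (j - 1)) • dx k p := by
  have := (Fact.out : p.Prime).one_le
  have h := xtop_mul_divPow (k := k) (p := p) i h1
  apply W_ext <;>
  simp [Derivation.leibniz, deriv_divPow _ _ j (show j < p by omega),
    deriv_divPow _ _ i (show i < p by omega), ← mul_assoc, h, mul_comm]

theorem span_hamBasis : Submodule.span k (hamBasis k p) = LinearMap.range (ham k p) := by
  apply le_antisymm
  · rw [Submodule.span_le]
    rintro D (⟨j, hj, rfl⟩ | ⟨i, j, h1, hi, hj, rfl⟩)
    · exact ⟨-(divPow (x k p) (0 : ℕ) * divPow (y k p) j), by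
        rw [map_neg, ham_divPow_zero j hj]
        exact neg_neg (_ : W k p)⟩
    · exact ⟨_, ham_divPow i j h1 hi hj⟩
  · rw [LinearMap.range_eq_map, ← span_divPow, Submodule.map_le_iff_le_comap, Submodule.span_le]
    rintro f ⟨i, j, hi, hj, rfl⟩
    rw [SetLike.mem_coe, Submodule.mem_comap]
    rcases Nat.eq_zero_or_pos i with rfl | h1
    · rw [ham_divPow_zero j hj]
      have hm : divPow (y k p) (j - 1) • dx k p -
          (divPow (x k p) (p - 1) * divPow (y k p) j) • dy k p ∈ hamBasis k p :=
        Or.inl ⟨j, hj, rfl⟩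
      exact Submodule.neg_mem _ (Submodule.subset_span hm)
    · rw [ham_divPow i j h1 hi hj]
      exact Submodule.subset_span (s := hamBasis k p)
        (Set.mem_union_right _ ⟨i, j, h1, hi, hj, rfl⟩)

theorem ham_lie (f g : O k p) : ⁅ham k p f, ham k p g⁆ =
    ham k p ((dx k p f + xtop k p * f) * dy k p g - dy k p f * (dx k p g + xtop k p * g)) := by
  apply W_ext
  · rw [Derivation.commutator_apply, ham_x, ham_x, ham_x, W_apply (ham k p f),
      W_apply (ham k p g)]
    simp [dx_dy_comm]
    ring
  · rw [Derivation.commutator_apply, ham_y, ham_y, ham_y, W_apply (ham k p f),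
      W_apply (ham k p g)]
    simp [dx_dy_comm]
    ring

theorem euler_lie_ham (f : O k p) : ⁅euler k p, ham k p f⁆ =
    ham k p (x k p * dx k p f + y k p * dy k p f - (f + f)) := by
  have h := x_mul_dx_xtop (k := k) (p := p)
  apply W_ext
  · rw [Derivation.commutator_apply, ham_x, ham_x, euler_x, ham_x, W_apply (euler k p)]
    simp [dx_dy_comm]
    ring
  · rw [Derivation.commutator_apply, ham_y, ham_y, euler_y, ham_y, W_apply (euler k p)]
    simp [dx_dy_comm]
    linear_combination f * h

variable (k p)

/-- The non-graded Hamiltonian algebra `H(2; (1,1); Φ(1))`. -/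
def H : LieSubalgebra k (W k p) where
  toSubmodule := Submodule.span k (hamBasis k p)
  lie_mem' {D E} hD hE := by
    simp only [AddSubsemigroup.mem_carrier, AddSubmonoid.mem_toSubsemigroup,
      Submodule.mem_toAddSubmonoid, span_hamBasis] at hD hE ⊢
    obtain ⟨f, rfl⟩ := hD
    obtain ⟨g, rfl⟩ := hE
    exact ⟨_, (ham_lie f g).symm⟩

/-- The minimal `p`-envelope of `H(2; (1,1); Φ(1))`, obtained by adding `x ∂_x + y ∂_y`. -/
def Hhat : LieSubalgebra k (W k p) where
  toSubmodule := (H k p).toSubmodule ⊔ Submodule.span k {euler k p}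
  lie_mem' {D E} hD hE := by
    simp only [AddSubsemigroup.mem_carrier, AddSubmonoid.mem_toSubsemigroup,
      Submodule.mem_toAddSubmonoid, H, span_hamBasis, Submodule.mem_sup,
      Submodule.mem_span_singleton, LinearMap.mem_range] at hD hE ⊢
    obtain ⟨_, ⟨f, rfl⟩, _, ⟨c, rfl⟩, rfl⟩ := hD
    obtain ⟨_, ⟨g, rfl⟩, _, ⟨d, rfl⟩, rfl⟩ := hE
    have h : ∃ F, ham k p F = ⁅ham k p f + c • euler k p, ham k p g + d • euler k p⁆ := by
      refine ⟨((dx k p f + xtop k p * f) * dy k p g - dy k p f * (dx k p g + xtop k p * g)) -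
        d • (x k p * dx k p f + y k p * dy k p f - (f + f)) +
        c • (x k p * dx k p g + y k p * dy k p g - (g + g)), ?_⟩
      rw [map_add, map_sub, map_smul, map_smul, ← ham_lie, ← euler_lie_ham, ← euler_lie_ham]
      apply Derivation.ext
      intro t
      simp only [Derivation.add_apply, Derivation.sub_apply, Derivation.smul_apply,
        Derivation.commutator_apply, map_add, Derivation.map_smul]
      module
    obtain ⟨F, hF⟩ := h
    exact ⟨_, ⟨F, rfl⟩, _, ⟨0, rfl⟩, by rw [zero_smul, add_zero, hF]⟩

end Algebra

section PMap

section
variable {k : Type*} [Field k] {p : ℕ} [Fact p.Prime] [CharP k p]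

theorem ad_pow_char {A : Type*} [Ring A] [Algebra k A] (a b : A) :
    (fun c => a * c - c * a)^[p] b = a ^ p * b - b * a ^ p := by
  rcases subsingleton_or_nontrivial A with hA | hA
  · exact Subsingleton.elim _ _
  have : CharP (Module.End k A) p := by
    exact charP_of_injective_algebraMap (algebraMap k (Module.End k A)).injective p
  have h := sub_pow_char_of_commute p (LinearMap.commute_mulLeft_right (R := k) (A := A) a a)
  rw [LinearMap.pow_mulLeft, LinearMap.pow_mulRight] at h
  have h2 := LinearMap.congr_fun h b
  rw [LinearMap.sub_apply, LinearMap.mulLeft_apply, LinearMap.mulRight_apply] at h2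
  rw [← h2, Module.End.pow_apply]
  rfl

/-- The `p`-th power of a derivation is a derivation in characteristic `p`. -/
theorem pow_leibniz {R : Type*} [CommRing R] [Algebra k R] (D : Derivation k R R) (f g : R) :
    D^[p] (f * g) = f * D^[p] g + g * D^[p] f := by
  have h1 : ∀ n : ℕ, (fun c : Module.End k R => (D : Module.End k R) * c - c * (D : Module.End k R))^[n]
      (LinearMap.mulLeft k f) = LinearMap.mulLeft k (D^[n] f) := by
    intro n
    induction n with
    | zero => rfl
    | succ n ih =>
      rw [Function.iterate_succ_apply', ih, Function.iterate_succ_apply']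
      ext t
      simp [Derivation.leibniz]
      ring
  have h2 := h1 p
  rw [ad_pow_char (k := k)] at h2
  have h3 := LinearMap.congr_fun h2 g
  simp only [LinearMap.sub_apply, Module.End.mul_apply, LinearMap.mulLeft_apply, Module.End.pow_apply,
    Derivation.coeFn_coe] at h3
  linear_combination h3
end

variable {k : Type*} [Field k] {p : ℕ} [Fact p.Prime] [Fact (5 ≤ p)] [CharP k p]

/-- The `p`-th power `D ^ p` of a derivation of `O(2; (1,1))`, again a derivation. -/
def powP (D : W k p) : W k p :=
  Derivation.mk' ((D : Module.End k (O k p)) ^ p) fun f g => by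
    simpa [Module.End.pow_apply] using pow_leibniz D f g

theorem powP_apply (D : W k p) (f : O k p) : powP D f = D^[p] f := by
  simp [powP, Module.End.pow_apply]


theorem powP_lie (D G : W k p) : ⁅powP D, G⁆ = (fun F => ⁅D, F⁆)^[p] G := by
  have h1 : ∀ n : ℕ, (((fun F => ⁅D, F⁆)^[n] G : W k p) : Module.End k (O k p)) =
      (fun c => (D : Module.End k (O k p)) * c - c * (D : Module.End k (O k p)))^[n] G := by
    intro n
    induction n with
    | zero => rfl
    | succ n ih =>
      rw [Function.iterate_succ_apply', Function.iterate_succ_apply', ← ih]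
      rfl
  have h2 := h1 p
  rw [ad_pow_char (k := k)] at h2
  apply Derivation.ext
  intro f
  have h3 := LinearMap.congr_fun h2 f
  simp only [LinearMap.sub_apply, Module.End.mul_apply, Module.End.pow_apply,
    Derivation.coeFn_coe] at h3
  rw [h3, Derivation.commutator_apply, powP_apply, powP_apply]

/-- The divergence relative to the form `exp(x^(p)) dx ∧ dy`. -/
def divE (D : W k p) : O k p :=
  dx k p (D (x k p)) + dy k p (D (y k p)) + xtop k p * D (x k p)

theorem divE_ham (f : O k p) : divE (ham k p f) = 0 := by
  simp [divE, dx_dy_comm]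

theorem xtop_mul_x : xtop k p * x k p = 0 := by
  have h := xtop_mul_divPow (k := k) (p := p) 1 le_rfl
  rw [divPow_natCast] at h
  simpa using h

theorem divE_euler : divE (euler k p) = algebraMap k _ 2 := by
  simp only [divE, euler_x, euler_y, dx_x, dy_y, xtop_mul_x, map_ofNat]
  norm_num

theorem divE_lie (D G : W k p) : divE ⁅D, G⁆ = D (divE G) - G (divE D) := by
  have h1 := W_apply D
  have h2 := W_apply G
  simp only [divE, Derivation.commutator_apply]
  rw [h1 (G (x k p)), h1 (G (y k p)), h2 (D (x k p)), h2 (D (y k p)), h1 (_ + _), h2 (_ + _)]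
  simp [dx_dy_comm]
  ring

theorem xytop_mul (f : O k p) : ∃ a : k, xtop k p * divPow (y k p) ((p - 1 : ℕ) : ℤ) * f =
    a • (xtop k p * divPow (y k p) ((p - 1 : ℕ) : ℤ)) := by
  have hp := (Fact.out : p.Prime).one_le
  have hf : f ∈ (⊤ : Submodule k (O k p)) := trivial
  rw [← span_divPow] at hf
  induction hf using Submodule.span_induction with
  | zero => exact ⟨0, by simp⟩
  | add f g _ _ hf hg =>
    obtain ⟨a, ha⟩ := hf
    obtain ⟨b, hb⟩ := hg
    exact ⟨a + b, by rw [mul_add, ha, hb, add_smul]⟩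
  | smul c f _ hf =>
    obtain ⟨a, ha⟩ := hf
    exact ⟨c * a, by rw [mul_smul_comm, ha, smul_smul]⟩
  | mem f hf =>
    obtain ⟨i, j, hi, hj, rfl⟩ := hf
    rcases Nat.eq_zero_or_pos i with rfl | h1
    · rcases Nat.eq_zero_or_pos j with rfl | h2
      · exact ⟨1, by simp [divPow_zero]⟩
      · refine ⟨0, ?_⟩
        have : divPow (y k p) ((p - 1 : ℕ) : ℤ) * divPow (y k p) j = 0 := by
          rw [divPow_natCast, divPow_natCast, smul_mul_smul_comm, ← pow_add,
            show p - 1 + j = p + (j - 1) by omega, pow_add, y_pow, zero_mul, smul_zero]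
        rw [zero_smul]
        linear_combination (xtop k p * divPow (x k p) (0 : ℕ)) * this
    · refine ⟨0, ?_⟩
      have := xtop_mul_divPow (k := k) (p := p) i h1
      rw [zero_smul]
      linear_combination (divPow (y k p) ((p - 1 : ℕ) : ℤ) * divPow (y k p) j) * this

theorem iterate_mul_const (D : W k p) (f g : O k p) (hf : D f = 0) (n : ℕ) :
    D^[n] (g * f) = D^[n] g * f := by
  induction n with
  | zero => rfl
  | succ n ih =>
    rw [Function.iterate_succ_apply', ih, Function.iterate_succ_apply', Derivation.leibniz, hf,
      smul_zero, zero_add, smul_eq_mul, mul_comm]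

theorem iterate_divPow (D : W k p) (t : O k p) (ht : D t = 1) (n m : ℕ) (hm : n + m < p) :
    D^[n] (divPow t ((n + m : ℕ) : ℤ)) = divPow t m := by
  induction n with
  | zero => simp
  | succ n ih =>
    rw [Function.iterate_succ_apply, deriv_divPow _ _ _ hm, ht, mul_one, ← ih (by omega)]
    congr 2
    push_cast
    ring

theorem const_of_deriv_eq_zero (f : O k p) (hx : dx k p f = 0) (hy : dy k p f = 0) :
    ∃ a : k, f = algebraMap k _ a := by
  have hp := (Fact.out : p.Prime).one_le
  obtain ⟨a, ha⟩ := xytop_mul f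
  have key : ∀ g : O k p, dx k p g = 0 → dy k p g = 0 →
      (dx k p)^[p - 1] ((dy k p)^[p - 1]
        (xtop k p * divPow (y k p) ((p - 1 : ℕ) : ℤ) * g)) = g := by
    intro g hx hy
    have e1 : (dy k p)^[p - 1] (divPow (y k p) ((p - 1 : ℕ) : ℤ)) = 1 := by
      have := iterate_divPow (dy k p) (y k p) dy_y (p - 1) 0 (by omega)
      simpa [divPow_zero] using this
    have e2 : (dx k p)^[p - 1] (xtop k p) = 1 := by
      have := iterate_divPow (dx k p) (x k p) dx_x (p - 1) 0 (by omega)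
      rw [xtop_eq]
      simpa [divPow_zero] using this
    rw [iterate_mul_const _ _ _ hy, mul_comm (xtop k p), iterate_mul_const _ _ _ dy_xtop, e1,
      one_mul, iterate_mul_const _ _ _ hx, e2, one_mul]
  refine ⟨a, ?_⟩
  rw [← key f hx hy, ha, ← mul_one (xtop k p * _), ← mul_smul_comm, ← Algebra.algebraMap_eq_smul_one,
    key _ (by simp) (by simp)]

instance finite_O : Module.Finite k (O k p) := by
  rw [Module.finite_def, ← span_divPow]
  refine Submodule.fg_span (((Set.finite_Iic (p - 1)).image2
    (fun i j : ℕ => divPow (x k p) i * divPow (y k p) j) (Set.finite_Iic (p - 1))).subset ?_)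
  rintro f ⟨i, j, hi, hj, rfl⟩
  exact ⟨i, hi, j, hj, rfl⟩

section
variable (k p)
/-- `f ↦ ∂_x f + x^(p-1) f` -/
def dxE : O k p →ₗ[k] O k p := (dx k p : Module.End k (O k p)) + LinearMap.mulLeft k (xtop k p)
end

theorem dxE_apply (f : O k p) : dxE k p f = dx k p f + xtop k p * f := rfl

theorem dxE_surjective : Function.Surjective (dxE k p) := by
  have hp := (Fact.out : p.Prime).one_le
  rw [← LinearMap.range_eq_top, eq_top_iff, ← span_divPow, Submodule.span_le]
  rintro f ⟨i, j, hi, hj, rfl⟩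
  by_cases h : i = p - 1
  · refine ⟨divPow (x k p) (0 : ℕ) * divPow (y k p) j, ?_⟩
    rw [dxE_apply, h, ← xtop_eq]
    simp [divPow_zero, deriv_divPow _ _ j (show j < p by omega)]
  · refine ⟨divPow (x k p) ((i + 1 : ℕ) : ℤ) * divPow (y k p) j, ?_⟩
    have h0 := xtop_mul_divPow (k := k) (p := p) (i + 1) (by omega)
    rw [dxE_apply, ← mul_assoc, h0, Derivation.leibniz,
      deriv_divPow _ _ j (show j < p by omega), deriv_divPow _ _ (i + 1) (show i + 1 < p by omega)]
    simp [mul_comm]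

theorem mem_Hhat_of_divE (D : W k p) (c : k) (h : divE D = algebraMap k _ c) : D ∈ Hhat k p := by
  have h2 : (2 : k) ≠ 0 := by
    have h5 := (Fact.out : 5 ≤ p)
    have := (CharP.cast_eq_zero_iff k p 2).not.2 (fun h => by
      have := Nat.le_of_dvd (by norm_num) h; omega)
    exact_mod_cast this
  have hinj : Function.Injective (dxE k p) :=
    LinearMap.injective_iff_surjective.2 dxE_surjective
  obtain ⟨f, hf⟩ := dxE_surjective ((D - (c / 2) • euler k p) (y k p))
  have hD : divE (D - (c / 2) • euler k p) = 0 := by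
    have e : divE (D - (c / 2) • euler k p) = divE D - (c / 2) • divE (euler k p) := by
      simp only [divE, Derivation.sub_apply, Derivation.smul_apply, map_sub, Derivation.map_smul,
        mul_sub, mul_smul_comm, smul_add]
      abel
    have e3 : (c / 2) • algebraMap k (O k p) 2 = algebraMap k (O k p) c :=
      (Algebra.smul_def (c / 2) (algebraMap k (O k p) 2)).trans
        (by rw [← map_mul, div_mul_cancel₀ c h2])
    rw [e, h, divE_euler, e3, sub_self]
  have e : D - (c / 2) • euler k p = ham k p f := by
    apply W_ext
    · rw [ham_x]
      apply hinj
      rw [divE, ← hf] at hD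
      rw [map_neg, dxE_apply, dxE_apply]
      rw [dxE_apply] at hD
      simp [dx_dy_comm] at hD ⊢
      linear_combination hD
    · rw [ham_y, ← hf, dxE_apply]
  rw [show D = ham k p f + (c / 2) • euler k p by
    rw [← e]; exact (sub_add_cancel (D : W k p) (_ : W k p)).symm]
  exact Submodule.add_mem_sup
    (by
      change _ ∈ Submodule.span k (hamBasis k p)
      rw [span_hamBasis]
      exact ⟨f, rfl⟩)
    (Submodule.smul_mem _ _ (Submodule.mem_span_singleton_self _))

theorem mem_H_iff (D : W k p) : D ∈ H k p ↔ ∃ f, ham k p f = D := by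
  change D ∈ Submodule.span k (hamBasis k p) ↔ _
  rw [span_hamBasis, LinearMap.mem_range]

theorem mem_Hhat_iff (D : W k p) :
    D ∈ Hhat k p ↔ ∃ (f : O k p) (c : k), D = ham k p f + c • euler k p := by
  change D ∈ (H k p).toSubmodule ⊔ Submodule.span k {euler k p} ↔ _
  rw [Submodule.mem_sup]
  constructor
  · rintro ⟨_, hE, _, hF, rfl⟩
    obtain ⟨f, rfl⟩ := (mem_H_iff _).1 hE
    obtain ⟨c, rfl⟩ := Submodule.mem_span_singleton.1 hF
    exact ⟨f, c, rfl⟩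
  · rintro ⟨f, c, rfl⟩
    exact ⟨_, (mem_H_iff _).2 ⟨f, rfl⟩, _, Submodule.mem_span_singleton.2 ⟨c, rfl⟩, rfl⟩

theorem lie_mem_H (D G : W k p) (hD : D ∈ Hhat k p) (hG : G ∈ H k p) : ⁅D, G⁆ ∈ H k p := by
  obtain ⟨f, c, rfl⟩ := (mem_Hhat_iff D).1 hD
  obtain ⟨g, rfl⟩ := (mem_H_iff G).1 hG
  have e : ⁅ham k p f + c • euler k p, ham k p g⁆ =
      ⁅ham k p f, ham k p g⁆ + c • ⁅euler k p, ham k p g⁆ := by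
    apply Derivation.ext
    intro t
    simp only [Derivation.add_apply, Derivation.smul_apply,
      Derivation.commutator_apply, map_add, Derivation.map_smul]
    module
  rw [e, ham_lie, euler_lie_ham, ← map_smul, ← map_add]
  exact (mem_H_iff _).2 ⟨_, rfl⟩

/-- `Hhat` is closed under `p`-th powers. -/
theorem powP_mem_Hhat (D : W k p) (hD : D ∈ Hhat k p) : powP D ∈ Hhat k p := by
  have h1 : ∀ G ∈ H k p, G (divE (powP D)) = 0 := by
    intro G hG
    have h2 : ∀ n : ℕ, (fun F => ⁅D, F⁆)^[n] G ∈ H k p := by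
      intro n
      induction n with
      | zero => exact hG
      | succ n ih => rw [Function.iterate_succ_apply']; exact lie_mem_H _ _ hD ih
    have h3 := h2 p
    rw [← powP_lie] at h3
    obtain ⟨g, rfl⟩ := (mem_H_iff G).1 hG
    obtain ⟨f, hf⟩ := (mem_H_iff _).1 h3
    have h4 := divE_lie (powP D) (ham k p g)
    rw [← hf, divE_ham, divE_ham, map_zero, zero_sub, eq_comm, neg_eq_zero] at h4
    exact h4
  have hy : dy k p (divE (powP D)) = 0 := by
    have := h1 _ ((mem_H_iff _).2 ⟨x k p, rfl⟩)
    rw [W_apply] at this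
    simpa [xtop_mul_x] using this
  have hx : dx k p (divE (powP D)) = 0 := by
    have := h1 _ ((mem_H_iff _).2 ⟨y k p, rfl⟩)
    rw [W_apply] at this
    rw [hy, ham_x, dy_y] at this
    linear_combination -this
  obtain ⟨c, hc⟩ := const_of_deriv_eq_zero _ hx hy
  exact mem_Hhat_of_divE _ c hc

/-- The `p`-map `D ↦ D^[p] = D ^ p` of `Hhat`. -/
def pMap (D : Hhat k p) : Hhat k p := ⟨powP (D : W k p), powP_mem_Hhat _ D.2⟩

end PMap

section Filtration

variable (k : Type*) [Field k] (p : ℕ)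

/-- The ideal `(x, y)` of `O(2; (1,1))`; its `n`-th power is spanned by the monomials of degree
at least `n`. -/
def maxIdeal : Ideal (O k p) := Ideal.span {x k p, y k p}

variable {k p}

theorem deriv_mem_pow (D : W k p) (hx : D (x k p) ∈ maxIdeal k p) (hy : D (y k p) ∈ maxIdeal k p)
    (n : ℕ) (f : O k p) (hf : f ∈ maxIdeal k p ^ n) : D f ∈ maxIdeal k p ^ n := by
  have h1 : ∀ f ∈ maxIdeal k p, D f ∈ maxIdeal k p := by
    intro f hf
    obtain ⟨a, b, rfl⟩ := Ideal.mem_span_pair.1 hf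
    rw [map_add, Derivation.leibniz, Derivation.leibniz]
    have hx' : x k p ∈ maxIdeal k p := Ideal.subset_span (by simp)
    have hy' : y k p ∈ maxIdeal k p := Ideal.subset_span (by simp)
    exact Ideal.add_mem _
      (Ideal.add_mem _ (Ideal.mul_mem_left _ _ hx) (Ideal.mul_mem_right _ _ hx'))
      (Ideal.add_mem _ (Ideal.mul_mem_left _ _ hy) (Ideal.mul_mem_right _ _ hy'))
  induction n generalizing f with
  | zero => simp
  | succ n ih =>
    have e : maxIdeal k p ^ (n + 1) = maxIdeal k p ^ n * maxIdeal k p :=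
      Submodule.pow_succ _
    rw [e] at hf ⊢
    induction hf using Submodule.mul_induction_on' with
    | mem_mul_mem a ha b hb =>
      rw [Derivation.leibniz, smul_eq_mul, smul_eq_mul, mul_comm b]
      exact Ideal.add_mem _ (Ideal.mul_mem_mul ha (h1 b hb)) (Ideal.mul_mem_mul (ih a ha) hb)
    | add a _ b _ ha hb => rw [map_add]; exact Ideal.add_mem _ ha hb

variable (k p)

/-- `W(2; (1,1))_(n)` for `n ≥ 0`, the sum of the components of degree at least `n` in the natural
grading of `W(2; (1,1))`. -/
def WFil (n : ℕ) : LieSubalgebra k (W k p) where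
  carrier := {D | D (x k p) ∈ maxIdeal k p ^ (n + 1) ∧ D (y k p) ∈ maxIdeal k p ^ (n + 1)}
  add_mem' hD hE := ⟨Ideal.add_mem _ hD.1 hE.1, Ideal.add_mem _ hD.2 hE.2⟩
  zero_mem' := ⟨Ideal.zero_mem _, Ideal.zero_mem _⟩
  smul_mem' c D hD := ⟨Submodule.smul_of_tower_mem _ c hD.1, Submodule.smul_of_tower_mem _ c hD.2⟩
  lie_mem' {D E} hD hE := by
    have h : maxIdeal k p ^ (n + 1) ≤ maxIdeal k p := Ideal.pow_le_self (by omega)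
    exact ⟨Ideal.sub_mem _ (deriv_mem_pow D (h hD.1) (h hD.2) _ _ hE.1)
        (deriv_mem_pow E (h hE.1) (h hE.2) _ _ hD.1),
      Ideal.sub_mem _ (deriv_mem_pow D (h hD.1) (h hD.2) _ _ hE.2)
        (deriv_mem_pow E (h hE.1) (h hE.2) _ _ hD.2)⟩

/-- The constant term of an element of `O(2; (1,1))`. -/
def constTerm [Fact p.Prime] : O k p →ₐ[k] k :=
  Ideal.Quotient.liftₐ (truncIdeal k p) (aeval 0) (by
    intro f hf
    have hp := (Fact.out : p.Prime).ne_zero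
    obtain ⟨a, b, rfl⟩ := Ideal.mem_span_pair.1 hf
    simp [hp])

variable {k p}

@[simp] theorem constTerm_x [Fact p.Prime] : constTerm k p (x k p) = 0 := by
  change aeval 0 (X 0 : MvPolynomial (Fin 2) k) = (0 : k)
  simp

@[simp] theorem constTerm_y [Fact p.Prime] : constTerm k p (y k p) = 0 := by
  change aeval 0 (X 1 : MvPolynomial (Fin 2) k) = (0 : k)
  simp

theorem constTerm_of_mem [Fact p.Prime] (f : O k p) (hf : f ∈ maxIdeal k p) :
    constTerm k p f = 0 := by
  obtain ⟨a, b, rfl⟩ := Ideal.mem_span_pair.1 hf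
  simp

end Filtration

variable (k : Type*) [Field k] (p : ℕ) [Fact p.Prime] [Fact (5 ≤ p)] [CharP k p]

section Elements

/-- The filtration `Hhat_(n) = Hhat ∩ W(2; (1,1))_(n)`. -/
def HhatFil (n : ℕ) : LieSubalgebra k (Hhat k p) := (WFil k p n).comap (Hhat k p).incl

/-- `x ∂_x` as an element of `Hhat` -/
def xdx : Hhat k p := ⟨x k p • dx k p, mem_Hhat_of_divE _ 1 (by simp [divE, xtop_mul_x])⟩

/-- `y ∂_y` as an element of `Hhat` -/
def ydy : Hhat k p := ⟨y k p • dy k p, mem_Hhat_of_divE _ 1 (by simp [divE])⟩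

/-- `x ∂_y` as an element of `Hhat` -/
def xdy : Hhat k p := ⟨x k p • dy k p, mem_Hhat_of_divE _ 0 (by simp [divE])⟩

/-- The subspace `N = Hhat_(1) ⊕ k x ∂_y`. -/
def nilpotentPart : Submodule k (Hhat k p) :=
  (HhatFil k p 1).toSubmodule ⊔ Submodule.span k {xdy k p}

end Elements

section Modules

variable (M : Type*) [AddCommGroup M] [Module k M] [LieRingModule (Hhat k p) M]
  [LieModule k (Hhat k p) M]

/-- Restricted `Hhat`-modules: `D^[p]` acts as the `p`-th power of `D`. -/
def IsRestricted : Prop :=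
  ∀ D : Hhat k p, LieModule.toEnd k (Hhat k p) M (pMap D) = LieModule.toEnd k (Hhat k p) M D ^ p

variable {M}

/-- Maximal vectors of weight `l`. -/
def IsMaximalVector (l : k × k) (v : M) : Prop :=
  v ≠ 0 ∧ ⁅xdx k p, v⁆ = l.1 • v ∧ ⁅ydy k p, v⁆ = l.2 • v ∧
    ∀ D ∈ nilpotentPart k p, ⁅D, v⁆ = 0

end Modules

section L0

/-- The space of the module `L_0(l)`, with basis `m_0, …, m_n`, where `n` is the residue of
`l.1 - l.2` in `{0, …, p - 1}`. -/
def L0 (l : ZMod p × ZMod p) : Type _ := Fin ((l.1 - l.2).val + 1) → k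

variable {k p}
variable {l : ZMod p × ZMod p}

instance : AddCommGroup (L0 k p l) := inferInstanceAs (AddCommGroup (Fin _ → k))
instance : Module k (L0 k p l) := inferInstanceAs (Module k (Fin _ → k))

namespace L0

/-- The coordinate of `v` at `m_j`, understood to be zero for `j > n`. -/
def coord (v : L0 k p l) (j : ℕ) : k := if h : j < (l.1 - l.2).val + 1 then v ⟨j, h⟩ else 0

@[ext] theorem ext {v w : L0 k p l} (h : ∀ j, coord v j = coord w j) : v = w := by
  funext i
  simpa [coord, i.2] using h i

/-- The vector with coordinates `f 0, …, f n`. -/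
def ofSeq (f : ℕ → k) : L0 k p l := fun i => f i

theorem coord_ofSeq (f : ℕ → k) (j : ℕ) :
    coord (ofSeq f : L0 k p l) j = if j < (l.1 - l.2).val + 1 then f j else 0 := by
  by_cases h : j < (l.1 - l.2).val + 1 <;> simp [coord, ofSeq, h]

theorem coord_of_le (v : L0 k p l) (j : ℕ) (h : (l.1 - l.2).val + 1 ≤ j) : coord v j = 0 := by
  simp [coord, not_lt.2 h]

@[simp] theorem coord_add (v w : L0 k p l) (j : ℕ) : coord (v + w) j = coord v j + coord w j := by
  by_cases h : j < (l.1 - l.2).val + 1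
  · simp only [coord, h, dif_pos]; rfl
  · simp [coord, h]

@[simp] theorem coord_smul (c : k) (v : L0 k p l) (j : ℕ) : coord (c • v) j = c * coord v j := by
  by_cases h : j < (l.1 - l.2).val + 1
  · simp only [coord, h, dif_pos]; rfl
  · simp [coord, h]

@[simp] theorem coord_neg (v : L0 k p l) (j : ℕ) : coord (-v) j = -coord v j := by
  rw [← neg_one_smul k, coord_smul, neg_one_mul]

@[simp] theorem coord_sub (v w : L0 k p l) (j : ℕ) : coord (v - w) j = coord v j - coord w j := by
  rw [sub_eq_add_neg, coord_add, coord_neg, sub_eq_add_neg]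

/-- The action of `x ∂_x`: `m_i ↦ (l.2 + i) m_i`. -/
def opA : L0 k p l →ₗ[k] L0 k p l where
  toFun v := ofSeq fun j => (l.2.cast + j) * coord v j
  map_add' v w := by ext j; simp only [coord_ofSeq, coord_add]; split_ifs <;> ring
  map_smul' c v := by
    ext j; simp only [coord_ofSeq, coord_smul, RingHom.id_apply]; split_ifs <;> ring

/-- The action of `y ∂_y`: `m_i ↦ (l.1 - i) m_i`. -/
def opB : L0 k p l →ₗ[k] L0 k p l where
  toFun v := ofSeq fun j => (l.1.cast - j) * coord v j
  map_add' v w := by ext j; simp only [coord_ofSeq, coord_add]; split_ifs <;> ring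
  map_smul' c v := by
    ext j; simp only [coord_ofSeq, coord_smul, RingHom.id_apply]; split_ifs <;> ring

/-- The action of `x ∂_y`: `m_i ↦ m_{i+1}`, where `m_{n+1} = 0`. -/
def opX : L0 k p l →ₗ[k] L0 k p l where
  toFun v := ofSeq fun j => if j = 0 then 0 else coord v (j - 1)
  map_add' v w := by ext j; simp only [coord_ofSeq, coord_add]; split_ifs <;> ring
  map_smul' c v := by
    ext j; simp only [coord_ofSeq, coord_smul, RingHom.id_apply]; split_ifs <;> ring

/-- The action of `y ∂_x`: `m_i ↦ i (n - i + 1) m_{i-1}`. -/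
def opY : L0 k p l →ₗ[k] L0 k p l where
  toFun v := ofSeq fun j => (j + 1) * ((l.1 - l.2).val - j) * coord v (j + 1)
  map_add' v w := by ext j; simp only [coord_ofSeq, coord_add]; split_ifs <;> ring
  map_smul' c v := by
    ext j; simp only [coord_ofSeq, coord_smul, RingHom.id_apply]; split_ifs <;> ring

theorem coord_opA (v : L0 k p l) (j : ℕ) : coord (opA v) j = (l.2.cast + j) * coord v j := by
  simp only [opA, LinearMap.coe_mk, AddHom.coe_mk, coord_ofSeq]
  split_ifs with h
  · rfl
  · rw [coord_of_le v j (not_lt.1 h), mul_zero]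

theorem coord_opB (v : L0 k p l) (j : ℕ) : coord (opB v) j = (l.1.cast - j) * coord v j := by
  simp only [opB, LinearMap.coe_mk, AddHom.coe_mk, coord_ofSeq]
  split_ifs with h
  · rfl
  · rw [coord_of_le v j (not_lt.1 h), mul_zero]

theorem coord_opX_zero (v : L0 k p l) : coord (opX v) 0 = 0 := by
  simp only [opX, LinearMap.coe_mk, AddHom.coe_mk, coord_ofSeq]
  simp

theorem coord_opX_succ (v : L0 k p l) (j : ℕ) :
    coord (opX v) (j + 1) = if j < (l.1 - l.2).val then coord v j else 0 := by
  simp only [opX, LinearMap.coe_mk, AddHom.coe_mk, coord_ofSeq]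
  simp

theorem coord_opY (v : L0 k p l) (j : ℕ) :
    coord (opY v) j = (j + 1) * ((l.1 - l.2).val - j) * coord v (j + 1) := by
  simp only [opY, LinearMap.coe_mk, AddHom.coe_mk, coord_ofSeq]
  split_ifs with h
  · rfl
  · rw [coord_of_le v (j + 1) (by omega), mul_zero]

theorem opA_opX (v : L0 k p l) : opA (opX v) = opX (opA v) + opX v := by
  ext (_ | j)
  · simp [coord_opA, coord_opX_zero]
  · simp only [coord_opA, coord_opX_succ, coord_add]
    split_ifs <;> push_cast <;> ring

theorem opB_opX (v : L0 k p l) : opB (opX v) = opX (opB v) - opX v := by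
  ext (_ | j)
  · simp [coord_opB, coord_opX_zero]
  · simp only [coord_opB, coord_opX_succ, coord_sub]
    split_ifs <;> push_cast <;> ring

theorem opA_opY (v : L0 k p l) : opA (opY v) = opY (opA v) - opY v := by
  ext j
  simp only [coord_opA, coord_opY, coord_sub]
  push_cast; ring

theorem opB_opY (v : L0 k p l) : opB (opY v) = opY (opB v) + opY v := by
  ext j
  simp only [coord_opB, coord_opY, coord_add]
  push_cast; ring

theorem opB_opA (v : L0 k p l) : opB (opA v) = opA (opB v) := by
  ext j
  simp only [coord_opB, coord_opA]
  ring

theorem opX_opY (v : L0 k p l) : opX (opY v) = opY (opX v) + opA v - opB v := by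
  have hn : (((l.1 - l.2).val : ℕ) : k) = l.1.cast - l.2.cast := by
    rw [← ZMod.cast_sub (dvd_refl p) l.1 l.2, ZMod.natCast_val]
  ext (_ | j)
  · simp only [coord_add, coord_sub, coord_opX_zero, coord_opY, coord_opX_succ, coord_opA,
      coord_opB]
    split_ifs with h
    · rw [hn]; push_cast; ring
    · have h0 : (l.1 - l.2).val = 0 := by omega
      rw [h0, Nat.cast_zero] at hn
      linear_combination (-coord v 0) * hn
  · simp only [coord_add, coord_sub, coord_opX_succ, coord_opY, coord_opA, coord_opB]
    split_ifs with h h1 h1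
    · rw [hn]; push_cast; ring
    · have h0 : (((l.1 - l.2).val : ℕ) : k) = j + 1 := by
        rw [show (l.1 - l.2).val = j + 1 by omega]; push_cast; ring
      rw [h0] at hn ⊢
      push_cast
      linear_combination (-coord v (j + 1)) * hn
    · omega
    · rw [coord_of_le v (j + 1) (by omega)]; ring

end L0

variable (k p) in
/-- `linCoeff i j D` is the coefficient of the `j`-th variable in the image under `D` of the `i`-th
variable; these four scalars determine the image of `D ∈ Hhat_(0)` in
`Hhat_(0) / Hhat_(1) = gl_2`. -/
def linCoeff (i j : Fin 2) : W k p →ₗ[k] k where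
  toFun D := constTerm k p (![dx k p, dy k p] j (D (![x k p, y k p] i)))
  map_add' D E := by simp
  map_smul' c D := by simp

theorem constTerm_deriv (E : W k p) (hx : E (x k p) ∈ maxIdeal k p)
    (hy : E (y k p) ∈ maxIdeal k p) (j : Fin 2) (f : O k p) :
    constTerm k p (![dx k p, dy k p] j (E f)) =
      linCoeff k p 0 j E * constTerm k p (dx k p f) +
        linCoeff k p 1 j E * constTerm k p (dy k p f) := by
  rw [W_apply E f, map_add, Derivation.leibniz, Derivation.leibniz]
  simp [linCoeff, constTerm_of_mem _ hx, constTerm_of_mem _ hy]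
  ring

theorem linCoeff_lie (i j : Fin 2) (D E : W k p) (hD : D ∈ WFil k p 0) (hE : E ∈ WFil k p 0) :
    linCoeff k p i j ⁅D, E⁆ =
      linCoeff k p 0 j D * linCoeff k p i 0 E + linCoeff k p 1 j D * linCoeff k p i 1 E -
      (linCoeff k p 0 j E * linCoeff k p i 0 D + linCoeff k p 1 j E * linCoeff k p i 1 D) := by
  have hD1 := hD.1
  have hD2 := hD.2
  have hE1 := hE.1
  have hE2 := hE.2
  have e : maxIdeal k p ^ (0 + 1) = maxIdeal k p := Submodule.pow_one _
  rw [e] at hD1 hD2 hE1 hE2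
  have h : linCoeff k p i j ⁅D, E⁆ =
      constTerm k p (![dx k p, dy k p] j (D (E (![x k p, y k p] i)))) -
      constTerm k p (![dx k p, dy k p] j (E (D (![x k p, y k p] i)))) := by
    simp [linCoeff, Derivation.commutator_apply]
  rw [h, constTerm_deriv D hD1 hD2, constTerm_deriv E hE1 hE2]
  rfl

/-- The simple restricted `gl_2`-module `L_0(l)` of highest weight `l`, inflated to
`Hhat_(0)`: the elements `x ∂_x, y ∂_y, x ∂_y, y ∂_x` of `Hhat_(0) / Hhat_(1) = gl_2` act by
`opA, opB, opX, opY`. -/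
def L0.act (D : Hhat k p) : L0 k p l →ₗ[k] L0 k p l :=
  linCoeff k p 0 0 D • L0.opA + linCoeff k p 1 1 D • L0.opB +
    linCoeff k p 1 0 D • L0.opX + linCoeff k p 0 1 D • L0.opY

instance : LieRingModule (HhatFil k p 0) (L0 k p l) where
  bracket D v := L0.act (D : Hhat k p) v
  add_lie D E v := by
    simp [L0.act]
    module
  lie_add D v w := map_add _ _ _
  leibniz_lie D E v := by
    have h := fun i j => linCoeff_lie i j (((D : Hhat k p)) : W k p) ((E : Hhat k p) : W k p)
      D.2 E.2
    simp only [L0.act, LieSubalgebra.coe_bracket, h, LinearMap.add_apply, LinearMap.smul_apply,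
      map_add, map_smul, L0.opA_opX, L0.opA_opY, L0.opB_opX, L0.opB_opY, L0.opB_opA, L0.opX_opY]
    module

instance : LieModule k (HhatFil k p 0) (L0 k p l) where
  smul_lie c D v := by
    change L0.act _ _ = c • L0.act _ _
    simp [L0.act]
    module
  lie_smul c D v := map_smul _ _ _

end L0

section Induced

/-- The relations `D ^ p = D^[p]` for `D ∈ Hhat`. -/
inductive URel : UniversalEnvelopingAlgebra k (Hhat k p) →
    UniversalEnvelopingAlgebra k (Hhat k p) → Prop
  | pow (D : Hhat k p) : URel (UniversalEnvelopingAlgebra.ι k D ^ p)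
      (UniversalEnvelopingAlgebra.ι k (pMap D))

/-- The restricted universal enveloping algebra `u(Hhat)`. -/
def U : Type _ := RingQuot (URel k p)

instance : Ring (U k p) := inferInstanceAs (Ring (RingQuot (URel k p)))
instance : Algebra k (U k p) := inferInstanceAs (Algebra k (RingQuot (URel k p)))

section CanonicalMap

attribute [local instance] LieRing.ofAssociativeRing

/-- The canonical map `Hhat → u(Hhat)`. -/
def uι : Hhat k p →ₗ[k] U k p where
  toFun D := RingQuot.mkAlgHom k (URel k p) (UniversalEnvelopingAlgebra.ι k D)
  map_add' D E := by rw [map_add, map_add]; rfl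
  map_smul' c D := by rw [map_smul, map_smul, RingHom.id_apply]; rfl

theorem uι_lie (D E : Hhat k p) : uι k p ⁅D, E⁆ = uι k p D * uι k p E - uι k p E * uι k p D := by
  change RingQuot.mkAlgHom k (URel k p) (UniversalEnvelopingAlgebra.ι k ⁅D, E⁆) =
    RingQuot.mkAlgHom k (URel k p) (UniversalEnvelopingAlgebra.ι k D) *
      RingQuot.mkAlgHom k (URel k p) (UniversalEnvelopingAlgebra.ι k E) -
    RingQuot.mkAlgHom k (URel k p) (UniversalEnvelopingAlgebra.ι k E) *
      RingQuot.mkAlgHom k (URel k p) (UniversalEnvelopingAlgebra.ι k D)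
  rw [LieHom.map_lie, LieRing.of_associative_ring_bracket, map_sub, map_mul, map_mul]

end CanonicalMap

/-- Every `u(Hhat)`-module is an `Hhat`-module. -/
@[reducible] def lieRingModuleOfModule (V : Type*) [AddCommGroup V] [Module (U k p) V] :
    LieRingModule (Hhat k p) V where
  bracket D v := uι k p D • v
  add_lie D E v := by rw [map_add, add_smul]
  lie_add D v w := smul_add _ _ _
  leibniz_lie D E v := by rw [uι_lie, sub_smul, mul_smul, mul_smul, sub_add_cancel]

variable (S : Type*) [AddCommGroup S] [Module k S] [LieRingModule (HhatFil k p 0) S]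
  [LieModule k (HhatFil k p 0) S]

open scoped TensorProduct

/-- The relations `a D ⊗ s = a ⊗ D s` for `a ∈ u(Hhat)` and `D ∈ Hhat_(0)`. -/
def indRel : Submodule (U k p) (U k p ⊗[k] S) :=
  Submodule.span (U k p) {t | ∃ (a : U k p) (D : HhatFil k p 0) (s : S),
    t = (a * uι k p (D : Hhat k p)) ⊗ₜ[k] s - a ⊗ₜ[k] ⁅D, s⁆}

/-- The induced module `u(Hhat) ⊗_{u(Hhat_(0))} S` of a restricted `Hhat_(0)`-module `S`. As the
algebra `u(Hhat_(0))` is generated by `Hhat_(0)`, this is the quotient of `u(Hhat) ⊗_k S` by the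
relations `a D ⊗ s = a ⊗ D s` for `D ∈ Hhat_(0)`. -/
def Ind : Type _ := (U k p ⊗[k] S) ⧸ indRel k p S

instance : AddCommGroup (Ind k p S) := inferInstanceAs (AddCommGroup (_ ⧸ indRel k p S))
instance : Module (U k p) (Ind k p S) := inferInstanceAs (Module (U k p) (_ ⧸ indRel k p S))
instance : Module k (Ind k p S) := inferInstanceAs (Module k (_ ⧸ indRel k p S))
instance : IsScalarTower k (U k p) (Ind k p S) :=
  inferInstanceAs (IsScalarTower k (U k p) (_ ⧸ indRel k p S))

variable (l : ZMod p × ZMod p)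

/-- `Z(l) = Z(L_0(l))` -/
abbrev Z : Type _ := Ind k p (L0 k p l)

/-- The sum of all proper submodules of `Z(l)`. It is the unique maximal submodule of `Z(l)` as
soon as it is proper. -/
def maxSub : Submodule (U k p) (Z k p l) := sSup {N | N ≠ ⊤}

/-- `L(l)`, the simple quotient of `Z(l)` by its unique maximal submodule. -/
def L : Type _ := Z k p l ⧸ maxSub k p l

instance : AddCommGroup (L k p l) := inferInstanceAs (AddCommGroup (_ ⧸ maxSub k p l))
instance : Module (U k p) (L k p l) := inferInstanceAs (Module (U k p) (_ ⧸ maxSub k p l))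
instance : Module k (L k p l) := inferInstanceAs (Module k (_ ⧸ maxSub k p l))
instance : IsScalarTower k (U k p) (L k p l) :=
  inferInstanceAs (IsScalarTower k (U k p) (_ ⧸ maxSub k p l))

instance : LieRingModule (Hhat k p) (L k p l) := lieRingModuleOfModule k p _

instance : LieModule k (Hhat k p) (L k p l) where
  smul_lie c D v := by
    change uι k p (c • D) • v = c • (uι k p D • v)
    rw [map_smul, smul_assoc]
  lie_smul c D v := by
    change uι k p D • (c • v) = c • (uι k p D • v)
    rw [← algebraMap_smul (U k p) c v, ← algebraMap_smul (U k p) c (_ : L k p l), smul_smul, smul_smul,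
      Algebra.commutes]

end Induced

end

end HamiltonianLie

namespace HamiltonianLie

noncomputable section

open MvPolynomial

set_option linter.unusedSectionVars false

/-! ### Monomial basis and Taylor coefficients in the truncated polynomial ring. -/

section TruncatedPolynomials

variable {k : Type*} [Field k] {p : ℕ} [Fact p.Prime] [Fact (5 ≤ p)] [CharP k p]

/-! The modules `Z(l)` are realised as tensor fields. Let `n` be the residue of `l.1 - l.2` in `[0,
p)` and `b` that of `l.2 + 1`. Let `W` act on `O[ξ, η]` by the derivations that commute with the
differential (`ξ = dx`, `η = dy`), plus `b` times multiplication by the divergence. In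
characteristic `p` this is a restricted representation (`actR_pow`). Constant-coefficient forms of
degree `n` times the socle element `x^(p-1) y^(p-1)` give a copy of `L_0(l)`, whence a map `zMap`
from `Z(l)`. Its image contains every `O`-linear combination of the monomials of degree `n` in `ξ,
η`, a space of dimension `p² (n + 1)`. A PBW-type spanning set bounds `dim Z(l)` above by the same
number (`finrank_ind_le`), so `Z(l)` is this space of tensor fields (`exists_equiv`).

Every irreducible restricted module `M` of the given dimension is an image of some `Z(l)`:
`Hhat_(1)` acts nilpotently, Engel's theorem yields vectors it kills, and on these `gl_2` acts
restrictedly, so a string of vectors spans an image of `L_0(l)` (`exists_hom_Z`). It remains to find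
the quotients of dimension `p² - 1` of the tensor modules.

For `n ≥ 2` the module is simple of dimension at least `3p²` (`finrank_and_simple_of_two_le`). The
difference `(A∂_y)(B∂_y) - (AB∂_y)∂_y` acts as `A'B' (ξ∂_η)²`. Commutators with `Hhat` then give `f
(ξ∂_η)²` for every function `f`, so a nonzero submodule contains a nonzero `O`-submodule, and that
is everything.

For `n = 0` the module is functions with twist `b`. A quotient of dimension `p² - 1` has a stable
line as kernel, and this exists only for `b = 0`, where it consists of the constants
(`stable_line`). The quotient is `L(-1, -1)`.

For `n = 1` the module is one-forms with twist `b`. On `Hhat` the ordinary divergence of `D` equals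
a constant minus `x^(p-1) D(x)`, which gives an equivariant twisted de Rham complex: functions with
twist `b`, one-forms with twist `b`, functions with twist `b + 1`. If `b = 0`, every submodule
containing a nonclosed form is everything (`oneForms_stable_eq_top`), so `L(0, -1)` is one-forms
modulo closed forms, that is, the functions of integral zero, of dimension `p² - 1`. If `b ≠ 0` the
complex is exact, and a quotient of dimension `p² - 1` must kill the exact forms. It is then a
quotient of functions with twist `b + 1` by a line, so `b = -1` and `L(-1, -1)` appears again.

The two modules differ because the highest weight vector of `L_0(0, -1)` survives in `L(0, -1)` as a
maximal vector of weight `(0, -1)`, while a short computation in `O / k` (`exists_eq_algebraMap`)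
excludes such a vector in `L(-1, -1)`. -/

theorem five_le (p : ℕ) [h : Fact (5 ≤ p)] : 5 ≤ p := h.out

variable (k) in
theorem natCast_ne_zero_of_lt {n : ℕ} (h0 : n ≠ 0) (hn : n < p) : (n : k) ≠ 0 := by
  rw [Ne, CharP.cast_eq_zero_iff k p]
  exact fun h => absurd (Nat.le_of_dvd (Nat.pos_of_ne_zero h0) h) (not_le.2 hn)

variable (k) in
theorem descFactorial_ne_zero {n i : ℕ} (hn : n < p) (hi : i ≤ n) :
    (n.descFactorial i : k) ≠ 0 := by
  intro h
  refine factorial_ne_zero' k p hn ?_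
  rw [← Nat.factorial_mul_descFactorial hi, Nat.cast_mul, h, mul_zero]

/-- A `k`-subspace of `O` containing the monomials `x ^ i * y ^ j` with `i, j < p` is everything. -/
theorem mem_of_monomials (S : Submodule k (O k p))
    (h : ∀ i j : ℕ, i < p → j < p → x k p ^ i * y k p ^ j ∈ S) (f : O k p) : f ∈ S := by
  have hp := five_le p
  have hf : f ∈ (⊤ : Submodule k (O k p)) := trivial
  rw [← span_divPow] at hf
  refine Submodule.span_le.2 ?_ hf
  rintro _ ⟨i, j, hi, hj, rfl⟩
  rw [divPow_natCast, divPow_natCast, smul_mul_smul_comm]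
  exact S.smul_mem _ (h i j (by omega) (by omega))

theorem linearMap_ext {V : Type*} [AddCommGroup V] [Module k V] {φ ψ : O k p →ₗ[k] V}
    (h : ∀ i j : ℕ, i < p → j < p → φ (x k p ^ i * y k p ^ j) = ψ (x k p ^ i * y k p ^ j)) :
    φ = ψ :=
  LinearMap.ext (mem_of_monomials (LinearMap.eqLocus φ ψ) h)

theorem iterate_dx_monomial (n i j : ℕ) :
    (dx k p)^[n] (x k p ^ i * y k p ^ j) =
      (i.descFactorial n : k) • (x k p ^ (i - n) * y k p ^ j) := by
  induction n with
  | zero => simp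
  | succ n ih =>
    rw [Function.iterate_succ_apply', ih, Derivation.map_smul, Derivation.leibniz,
      Derivation.leibniz_pow, Derivation.leibniz_pow, Nat.descFactorial_succ, Nat.cast_mul,
      mul_comm ((i - n : ℕ) : k), mul_smul]
    simp [← Nat.cast_smul_eq_nsmul k, Nat.sub_sub, mul_comm]

theorem iterate_map_smul_W (D : W k p) (n : ℕ) (c : k) (f : O k p) :
    D^[n] (c • f) = c • D^[n] f := by
  induction n with
  | zero => rfl
  | succ n ih => rw [Function.iterate_succ_apply', Function.iterate_succ_apply', ih,
      Derivation.map_smul]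

theorem iterate_dy_monomial (n i j : ℕ) :
    (dy k p)^[n] (x k p ^ i * y k p ^ j) =
      (j.descFactorial n : k) • (x k p ^ i * y k p ^ (j - n)) := by
  induction n with
  | zero => simp
  | succ n ih =>
    rw [Function.iterate_succ_apply', ih, Derivation.map_smul, Derivation.leibniz,
      Derivation.leibniz_pow, Derivation.leibniz_pow, Nat.descFactorial_succ, Nat.cast_mul,
      mul_comm ((j - n : ℕ) : k), mul_smul]
    simp [← Nat.cast_smul_eq_nsmul k, Nat.sub_sub]

variable (k p) in
/-- The functional `f ↦ (∂_x ^ i ∂_y ^ j f)(0)`. -/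
def taylor (i j : ℕ) : O k p →ₗ[k] k :=
  (constTerm k p).toLinearMap ∘ₗ ((dx k p : Module.End k (O k p)) ^ i) ∘ₗ
    ((dy k p : Module.End k (O k p)) ^ j)

theorem taylor_apply (i j : ℕ) (f : O k p) :
    taylor k p i j f = constTerm k p ((dx k p)^[i] ((dy k p)^[j] f)) := by
  simp [taylor, Module.End.pow_apply]

theorem taylor_monomial (i j a b : ℕ) :
    taylor k p i j (x k p ^ a * y k p ^ b) =
      if i = a ∧ j = b then (i.factorial : k) * j.factorial else 0 := by
  rw [taylor_apply, iterate_dy_monomial, iterate_map_smul_W, iterate_dx_monomial, map_smul, map_smul, map_mul,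
    map_pow, map_pow, constTerm_x, constTerm_y]
  rcases lt_trichotomy i a with h | rfl | h
  · simp [h.ne, zero_pow (Nat.sub_pos_of_lt h).ne']
  · rcases lt_trichotomy j b with h | rfl | h
    · simp [h.ne, zero_pow (Nat.sub_pos_of_lt h).ne']
    · simp [Nat.descFactorial_self, mul_comm]
    · simp [h.ne', Nat.descFactorial_of_lt h]
  · simp [h.ne', Nat.descFactorial_of_lt h]

theorem linearIndependent_monomial :
    LinearIndependent k fun s : Fin p × Fin p => x k p ^ (s.1 : ℕ) * y k p ^ (s.2 : ℕ) := by
  rw [Fintype.linearIndependent_iff]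
  intro g hg s
  have h := congrArg (taylor k p s.1 s.2) hg
  rw [map_sum, map_zero, Finset.sum_eq_single s] at h
  · rw [map_smul, taylor_monomial, if_pos ⟨rfl, rfl⟩, smul_eq_mul] at h
    exact (mul_eq_zero.1 h).resolve_right (mul_ne_zero (factorial_ne_zero' k p s.1.2)
      (factorial_ne_zero' k p s.2.2))
  · intro t _ ht
    rw [map_smul, taylor_monomial, if_neg, smul_zero]
    rintro ⟨h1, h2⟩
    exact ht (Prod.ext (Fin.ext h1.symm) (Fin.ext h2.symm))
  · simp

variable (k p) in
/-- The basis of the monomials `x ^ i * y ^ j`. -/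
def monomialBasis : Module.Basis (Fin p × Fin p) k (O k p) :=
  Module.Basis.mk linearIndependent_monomial (by
    intro f _
    refine mem_of_monomials _ (fun i j hi hj => Submodule.subset_span ?_) f
    exact ⟨(⟨i, hi⟩, ⟨j, hj⟩), rfl⟩)

variable (k p) in
theorem finrank_O : Module.finrank k (O k p) = p ^ 2 := by
  rw [Module.finrank_eq_card_basis (monomialBasis k p)]
  simp [sq]

theorem eq_zero_of_taylor (f : O k p) (h : ∀ i j, i < p → j < p → taylor k p i j f = 0) :
    f = 0 := by
  rw [← (monomialBasis k p).sum_repr f]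
  refine Finset.sum_eq_zero fun s _ => ?_
  have h1 := h s.1 s.2 s.1.2 s.2.2
  rw [← (monomialBasis k p).sum_repr f, map_sum, Finset.sum_eq_single s] at h1
  · rw [map_smul, monomialBasis, Module.Basis.mk_apply, taylor_monomial, if_pos ⟨rfl, rfl⟩,
      smul_eq_mul] at h1
    rw [monomialBasis, (mul_eq_zero.1 h1).resolve_right (mul_ne_zero
      (factorial_ne_zero' k p s.1.2) (factorial_ne_zero' k p s.2.2)), zero_smul]
  · intro t _ ht
    rw [map_smul, monomialBasis, Module.Basis.mk_apply, taylor_monomial, if_neg, smul_zero]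
    rintro ⟨h1, h2⟩
    exact ht (Prod.ext (Fin.ext h1.symm) (Fin.ext h2.symm))
  · simp

instance : Nontrivial (O k p) :=
  Module.nontrivial_of_finrank_pos (R := k) (by
    rw [finrank_O]; exact pow_pos (Fact.out : p.Prime).pos 2)

theorem iterate_dx_eq_zero (f : O k p) : (dx k p)^[p] f = 0 := by
  have : (dx k p : Module.End k (O k p)) ^ p = 0 := linearMap_ext fun i j hi _ => by
    simp [Module.End.pow_apply, iterate_dx_monomial, Nat.descFactorial_of_lt hi]
  simpa [Module.End.pow_apply] using LinearMap.congr_fun this f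

theorem iterate_dy_eq_zero (f : O k p) : (dy k p)^[p] f = 0 := by
  have : (dy k p : Module.End k (O k p)) ^ p = 0 := linearMap_ext fun i j _ hj => by
    simp [Module.End.pow_apply, iterate_dy_monomial, Nat.descFactorial_of_lt hj]
  simpa [Module.End.pow_apply] using LinearMap.congr_fun this f

theorem algebraMap_constTerm_of_const (f : O k p) (hx : dx k p f = 0) (hy : dy k p f = 0) :
    f = algebraMap k _ (constTerm k p f) := by
  obtain ⟨a, rfl⟩ := const_of_deriv_eq_zero f hx hy
  simp

variable (k p) in
/-- `x ^ (p - 1)` is a nonzero multiple of the divided power. -/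
theorem xtop_eq_smul : xtop k p = ((p - 1).factorial : k)⁻¹ • x k p ^ (p - 1) := by
  rw [xtop_eq, divPow_natCast]

theorem dx_x_pow (n : ℕ) : dx k p (x k p ^ n) = (n : k) • x k p ^ (n - 1) := by
  simp [Derivation.leibniz_pow, ← Nat.cast_smul_eq_nsmul k]

theorem dy_y_pow (n : ℕ) : dy k p (y k p ^ n) = (n : k) • y k p ^ (n - 1) := by
  simp [Derivation.leibniz_pow, ← Nat.cast_smul_eq_nsmul k]

@[simp] theorem dy_x_pow (n : ℕ) : dy k p (x k p ^ n) = 0 := by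
  simp [Derivation.leibniz_pow]

@[simp] theorem dx_y_pow (n : ℕ) : dx k p (y k p ^ n) = 0 := by
  simp [Derivation.leibniz_pow]

/-- A multiple of `x ^ (p - 1)` by a scalar is a derivative `∂_x g` only if it is zero. -/
theorem eq_zero_of_dx_eq_smul_xtop {g : O k p} {c : k} (h : dx k p g = c • xtop k p) : c = 0 := by
  have hp := five_le p
  have h1 := iterate_dx_eq_zero g
  have e := iterate_dx_monomial (k := k) (p := p) (p - 1) (p - 1) 0
  rw [pow_zero, mul_one, Nat.sub_self, pow_zero, Nat.descFactorial_self] at e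
  -- `∂_x ^ (p-1)` takes the divided power `x^(p-1)` to `1`, so `∂_x ^ p g = c`, whereas `∂_x ^ p =
  -- 0` on `O`.
  have h2 : (dx k p)^[p - 1 + 1] g = c • (1 : O k p) := by
    rw [Function.iterate_succ_apply, h, xtop_eq_smul, smul_smul, iterate_map_smul_W, e, smul_smul,
      mul_assoc, inv_mul_cancel₀ (factorial_ne_zero' k p (by omega)), mul_one, mul_one]
  rw [show p - 1 + 1 = p by omega] at h2
  rw [h1] at h2
  simpa using congrArg (constTerm k p) h2.symm

/-- If `f` preserves `S` and a power of `f` takes `v ∉ S` into `S`, then some iterate of `v`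
is outside `S` but is mapped into `S` by `f`. -/
theorem exists_iterate_not_mem {α : Type*} (f : α → α) (S : Set α) (n : ℕ) (v : α) (hv : v ∉ S)
    (hn : f^[n] v ∈ S) : ∃ i, f^[i] v ∉ S ∧ f (f^[i] v) ∈ S := by
  induction n with
  | zero => exact absurd hn hv
  | succ n ih =>
    by_cases h : f^[n] v ∈ S
    · exact ih h
    · exact ⟨n, h, by rwa [← Function.iterate_succ_apply' f]⟩

/-! ### The filtration by powers of the maximal ideal. -/

section MaximalIdeal

theorem x_mem_maxIdeal : x k p ∈ maxIdeal k p := Ideal.subset_span (by simp)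

theorem y_mem_maxIdeal : y k p ∈ maxIdeal k p := Ideal.subset_span (by simp)

theorem monomial_mem_maxIdeal_pow (i j : ℕ) : x k p ^ i * y k p ^ j ∈ maxIdeal k p ^ (i + j) := by
  have e : maxIdeal k p ^ (i + j) = maxIdeal k p ^ i * maxIdeal k p ^ j := pow_add _ _ _
  rw [e]
  exact Ideal.mul_mem_mul (Ideal.pow_mem_pow x_mem_maxIdeal i) (Ideal.pow_mem_pow y_mem_maxIdeal j)

theorem deriv_mem_maxIdeal_pow (D : W k p) (n : ℕ) (f : O k p) (hf : f ∈ maxIdeal k p ^ (n + 1)) :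
    D f ∈ maxIdeal k p ^ n := by
  induction n generalizing f with
  | zero => simp
  | succ n ih =>
    have e : maxIdeal k p ^ (n + 1 + 1) = maxIdeal k p ^ (n + 1) * maxIdeal k p := pow_succ _ _
    have e' : maxIdeal k p ^ (n + 1) = maxIdeal k p ^ n * maxIdeal k p := pow_succ _ _
    rw [e] at hf
    induction hf using Submodule.mul_induction_on' with
    | mem_mul_mem a ha b hb =>
      rw [Derivation.leibniz, smul_eq_mul, smul_eq_mul, mul_comm b]
      refine Ideal.add_mem _ (Ideal.mul_mem_right _ _ ha) ?_
      rw [e']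
      exact Ideal.mul_mem_mul (ih a ha) hb
    | add a _ b _ ha hb => rw [map_add]; exact Ideal.add_mem _ ha hb

/-- A derivation lowers the order by at most one, so all Taylor coefficients with `i, j < p` vanish.
The exponent `2 * p` is not sharp but is enough for nilpotency. -/
theorem eq_zero_of_mem_maxIdeal_pow (f : O k p) (hf : f ∈ maxIdeal k p ^ (2 * p)) : f = 0 := by
  have h : ∀ (D : W k p) (n m : ℕ) (g : O k p), g ∈ maxIdeal k p ^ (m + n) →
      D^[n] g ∈ maxIdeal k p ^ m := by
    intro D n
    induction n with
    | zero => intro m g hg; exact hg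
    | succ n ih =>
      intro m g hg
      rw [Function.iterate_succ_apply]
      exact ih m _ (deriv_mem_maxIdeal_pow D (m + n) g hg)
  refine eq_zero_of_taylor f fun i j hi hj => ?_
  rw [taylor_apply]
  refine constTerm_of_mem _ ?_
  have h1 := h (dx k p) i 1 _ (h (dy k p) j (1 + i) f
    (Ideal.pow_le_pow_right (by omega) hf))
  have e : maxIdeal k p ^ 1 = maxIdeal k p := Submodule.pow_one _
  rwa [e] at h1

theorem deriv_mem_of_mem_WFil_one (D : W k p) (hD : D ∈ WFil k p 1) (n : ℕ) (f : O k p)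
    (hf : f ∈ maxIdeal k p ^ n) : D f ∈ maxIdeal k p ^ (n + 1) := by
  have h2 : D f ∈ maxIdeal k p ^ (1 + 1) := by
    rw [W_apply]
    exact Ideal.add_mem _ (Ideal.mul_mem_right _ _ hD.1) (Ideal.mul_mem_right _ _ hD.2)
  cases n with
  | zero => exact Ideal.pow_le_pow_right (by omega) h2
  | succ n =>
    have e : maxIdeal k p ^ (n + 1 + 1) = maxIdeal k p ^ (1 + 1) * maxIdeal k p ^ n := by
      have : maxIdeal k p ^ (1 + 1 + n) = maxIdeal k p ^ (1 + 1) * maxIdeal k p ^ n := pow_add _ _ _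
      rw [← this]
      congr 1
      omega
    rw [W_apply, e]
    exact Ideal.add_mem _ (Ideal.mul_mem_mul hD.1 (deriv_mem_maxIdeal_pow _ _ _ hf))
      (Ideal.mul_mem_mul hD.2 (deriv_mem_maxIdeal_pow _ _ _ hf))

theorem iterate_eq_zero_of_mem_WFil_one (D : W k p) (hD : D ∈ WFil k p 1) (n : ℕ) (hn : 2 * p ≤ n)
    (f : O k p) : D^[n] f = 0 := by
  have h : ∀ m, D^[m] f ∈ maxIdeal k p ^ m := by
    intro m
    induction m with
    | zero => simp
    | succ m ih =>
      rw [Function.iterate_succ_apply']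
      exact deriv_mem_of_mem_WFil_one D hD m _ ih
  exact eq_zero_of_mem_maxIdeal_pow _ (Ideal.pow_le_pow_right hn (h n))

/-- `D` raises the order by at least one, hence `D ^ (p²)` by at least `2p`. This is what makes
`Hhat_(1)` act nilpotently on every restricted module. -/
theorem powP_powP_eq_zero (D : W k p) (hD : D ∈ WFil k p 1) : powP (powP D) = 0 := by
  have h : ∀ f, powP (powP D) f = 0 := by
    intro f
    have e : ⇑(powP D) = (D : O k p → O k p)^[p] := funext fun g => powP_apply D g
    rw [powP_apply, e, ← Function.iterate_mul]
    exact iterate_eq_zero_of_mem_WFil_one D hD _ (Nat.mul_le_mul_right _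
      (Fact.out : p.Prime).two_le) f
  exact Derivation.ext h

theorem mem_maxIdeal_of_constTerm (f : O k p) (h : constTerm k p f = 0) : f ∈ maxIdeal k p := by
  let φ : O k p →ₗ[k] O k p :=
    LinearMap.id - (Algebra.linearMap k (O k p)) ∘ₗ (constTerm k p).toLinearMap
  have h1 := mem_of_monomials (((maxIdeal k p).restrictScalars k).comap φ) (fun i j hi hj => by
    rw [Submodule.mem_comap, Submodule.restrictScalars_mem]
    simp only [φ, LinearMap.sub_apply, LinearMap.id_apply, LinearMap.comp_apply,
      AlgHom.toLinearMap_apply, Algebra.linearMap_apply]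
    by_cases h0 : i = 0 ∧ j = 0
    · obtain ⟨rfl, rfl⟩ := h0
      simp
    · have hm : x k p ^ i * y k p ^ j ∈ maxIdeal k p :=
        Ideal.pow_le_self (by omega) (monomial_mem_maxIdeal_pow i j)
      rw [constTerm_of_mem _ hm, map_zero, sub_zero]
      exact hm) f
  rw [Submodule.mem_comap, Submodule.restrictScalars_mem] at h1
  simpa [φ, h] using h1

theorem mem_maxIdeal_sq_of_constTerm (f : O k p) (h : constTerm k p f = 0)
    (hx : constTerm k p (dx k p f) = 0) (hy : constTerm k p (dy k p f) = 0) :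
    f ∈ maxIdeal k p ^ 2 := by
  obtain ⟨a, b, rfl⟩ := Ideal.mem_span_pair.1 (mem_maxIdeal_of_constTerm f h)
  simp only [map_add, Derivation.leibniz, dx_x, dx_y, dy_x, dy_y, smul_eq_mul, map_mul,
    constTerm_x, constTerm_y, mul_zero, zero_mul, mul_one, add_zero,
    zero_add] at hx hy
  have e : maxIdeal k p ^ 2 = maxIdeal k p * maxIdeal k p := pow_two _
  rw [e]
  exact Ideal.add_mem _ (Ideal.mul_mem_mul (mem_maxIdeal_of_constTerm a hx) x_mem_maxIdeal)
    (Ideal.mul_mem_mul (mem_maxIdeal_of_constTerm b hy) y_mem_maxIdeal)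

end MaximalIdeal

end TruncatedPolynomials

/-! ### Universal properties of `u(Hhat)` and of induced modules. -/

section RestrictedEnvelope

variable {k : Type*} [Field k] {p : ℕ} [Fact p.Prime] [Fact (5 ≤ p)] [CharP k p]

open scoped TensorProduct

theorem uι_pow (D : Hhat k p) : uι k p D ^ p = uι k p (pMap D) := by
  change RingQuot.mkAlgHom k (URel k p) (UniversalEnvelopingAlgebra.ι k D) ^ p =
    RingQuot.mkAlgHom k (URel k p) (UniversalEnvelopingAlgebra.ι k (pMap D))
  rw [← map_pow]
  exact RingQuot.mkAlgHom_rel k (URel.pow D)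

section

attribute [local instance] LieRing.ofAssociativeRing

/-- Corestrict `ι` to the subalgebra it generates and lift. Followed by the inclusion, the lift is
the identity by uniqueness, so every element lies in that subalgebra. -/
theorem adjoin_range_ι_enveloping (L : Type*) [LieRing L] [LieAlgebra k L] :
    Algebra.adjoin k (Set.range (UniversalEnvelopingAlgebra.ι k (L := L))) = ⊤ := by
  let S := Algebra.adjoin k (Set.range (UniversalEnvelopingAlgebra.ι k (L := L)))
  let f : L →ₗ⁅k⁆ S :=
    { toFun := fun D => ⟨UniversalEnvelopingAlgebra.ι k D, Algebra.subset_adjoin ⟨D, rfl⟩⟩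
      map_add' := fun D E => Subtype.ext (map_add _ D E)
      map_smul' := fun c D => Subtype.ext (map_smul _ c D)
      map_lie' := fun {D E} => Subtype.ext (LieHom.map_lie _ D E) }
  have h : S.val.comp (UniversalEnvelopingAlgebra.lift k f) = AlgHom.id k _ := by
    apply UniversalEnvelopingAlgebra.hom_ext
    ext D
    change S.val (UniversalEnvelopingAlgebra.lift k f (UniversalEnvelopingAlgebra.ι k D)) = _
    rw [UniversalEnvelopingAlgebra.lift_ι_apply]
    rfl
  rw [eq_top_iff]
  intro a _
  have h2 := AlgHom.congr_fun h a
  rw [← show _ = a from h2]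
  exact (UniversalEnvelopingAlgebra.lift k f a).2

theorem adjoin_range_uι : Algebra.adjoin k (Set.range (uι k p)) = ⊤ := by
  have h := congrArg (Subalgebra.map (RingQuot.mkAlgHom k (URel k p)))
    (adjoin_range_ι_enveloping (k := k) (Hhat k p))
  rw [AlgHom.map_adjoin, Algebra.map_top,
    (AlgHom.range_eq_top _).2 (RingQuot.mkAlgHom_surjective k (URel k p)), ← Set.range_comp] at h
  exact h

/-- The algebra homomorphism out of `u(Hhat)` given by a restricted representation. -/
def uLift {A : Type*} [Ring A] [Algebra k A] (ρ : Hhat k p →ₗ[k] A)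
    (hlie : ∀ D E, ρ ⁅D, E⁆ = ρ D * ρ E - ρ E * ρ D) (hpow : ∀ D, ρ (pMap D) = ρ D ^ p) :
    U k p →ₐ[k] A :=
  RingQuot.liftAlgHom k ⟨UniversalEnvelopingAlgebra.lift k
    { ρ with map_lie' := fun {D E} => hlie D E }, by
      rintro _ _ ⟨D⟩
      rw [map_pow, UniversalEnvelopingAlgebra.lift_ι_apply,
        UniversalEnvelopingAlgebra.lift_ι_apply]
      exact (hpow D).symm⟩

theorem uLift_uι {A : Type*} [Ring A] [Algebra k A] (ρ : Hhat k p →ₗ[k] A)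
    (hlie : ∀ D E, ρ ⁅D, E⁆ = ρ D * ρ E - ρ E * ρ D) (hpow : ∀ D, ρ (pMap D) = ρ D ^ p)
    (D : Hhat k p) : uLift ρ hlie hpow (uι k p D) = ρ D := by
  change RingQuot.liftAlgHom k _ (RingQuot.mkAlgHom k (URel k p) _) = _
  rw [RingQuot.liftAlgHom_mkAlgHom_apply, UniversalEnvelopingAlgebra.lift_ι_apply]
  rfl

end

section Modules

variable {V : Type*} [AddCommGroup V] [Module k V] [Module (U k p) V] [IsScalarTower k (U k p) V]

theorem u_smul_comm (c : k) (a : U k p) (v : V) : a • c • v = c • a • v := by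
  rw [← algebraMap_smul (U k p) c v, ← algebraMap_smul (U k p) c (a • v), smul_smul, smul_smul,
    Algebra.commutes]

theorem u_induction {P : U k p → Prop} (hc : ∀ c, P (algebraMap k _ c)) (hι : ∀ D, P (uι k p D))
    (hadd : ∀ a b, P a → P b → P (a + b)) (hmul : ∀ a b, P a → P b → P (a * b)) (a : U k p) :
    P a := by
  have ha : a ∈ Algebra.adjoin k (Set.range (uι k p)) := by rw [adjoin_range_uι]; trivial
  induction ha using Algebra.adjoin_induction with
  | mem x hx => obtain ⟨D, rfl⟩ := hx; exact hι D
  | algebraMap c => exact hc c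
  | add a b _ _ ha hb => exact hadd a b ha hb
  | mul a b _ _ ha hb => exact hmul a b ha hb

/-- A `k`-subspace stable under `Hhat` is stable under `u(Hhat)`. -/
def uSubmodule (S : Submodule k V) (h : ∀ (D : Hhat k p), ∀ v ∈ S, uι k p D • v ∈ S) :
    Submodule (U k p) V where
  __ := S.toAddSubmonoid
  smul_mem' a := by
    refine u_induction (P := fun a => ∀ {v : V}, v ∈ S → a • v ∈ S) ?_ ?_ ?_ ?_ a
    · intro c v hv
      rw [algebraMap_smul]
      exact S.smul_mem c hv
    · exact fun D v hv => h D v hv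
    · intro a b ha hb v hv
      rw [add_smul]
      exact S.add_mem (ha hv) (hb hv)
    · intro a b ha hb v hv
      rw [mul_smul]
      exact ha (hb hv)

@[simp] theorem mem_uSubmodule (S : Submodule k V)
    (h : ∀ (D : Hhat k p), ∀ v ∈ S, uι k p D • v ∈ S) (v : V) : v ∈ uSubmodule S h ↔ v ∈ S :=
  Iff.rfl

end Modules

section Induced

variable (S : Type*) [AddCommGroup S] [Module k S] [LieRingModule (HhatFil k p 0) S]
  [LieModule k (HhatFil k p 0) S]
variable {V : Type*} [AddCommGroup V] [Module k V] [Module (U k p) V] [IsScalarTower k (U k p) V]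

/-- The canonical map `s ↦ 1 ⊗ s`. -/
def indι : S →ₗ[k] Ind k p S :=
  ((indRel k p S).mkQ.restrictScalars k) ∘ₗ TensorProduct.mk k (U k p) S 1

variable {S}

theorem mkQ_tmul (a : U k p) (s : S) : (indRel k p S).mkQ (a ⊗ₜ[k] s) = a • indι S s := by
  change (indRel k p S).mkQ (a ⊗ₜ[k] s) = a • (indRel k p S).mkQ (1 ⊗ₜ[k] s)
  rw [← map_smul, TensorProduct.smul_tmul', smul_eq_mul, mul_one]

theorem indι_lie (D : HhatFil k p 0) (s : S) :
    uι k p (D : Hhat k p) • (indι S s : Ind k p S) = indι S ⁅D, s⁆ := by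
  refine (mkQ_tmul (uι k p (D : Hhat k p)) s).symm.trans (sub_eq_zero.1 ?_)
  change _ - (indRel k p S).mkQ (1 ⊗ₜ[k] ⁅D, s⁆) = 0
  rw [← map_sub, Submodule.mkQ_apply, Submodule.Quotient.mk_eq_zero]
  exact Submodule.subset_span ⟨1, D, s, by rw [one_mul]⟩

theorem ind_induction {P : Ind k p S → Prop} (hι : ∀ s, P (indι S s))
    (hadd : ∀ a b, P a → P b → P (a + b)) (hsmul : ∀ (a : U k p) b, P b → P (a • b))
    (z : Ind k p S) : P z := by
  obtain ⟨t, rfl⟩ := (indRel k p S).mkQ_surjective z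
  induction t using TensorProduct.induction_on with
  | zero =>
    have h := hsmul 0 _ (hι 0)
    rw [zero_smul] at h
    rwa [map_zero]
  | tmul a s => rw [mkQ_tmul]; exact hsmul a _ (hι s)
  | add a b ha hb => rw [map_add]; exact hadd _ _ ha hb

theorem ind_eq_top (N : Submodule (U k p) (Ind k p S)) (h : ∀ s, indι S s ∈ N) :
    N = ⊤ :=
  eq_top_iff.2 fun z _ => ind_induction (P := fun z => z ∈ N) h (fun _ _ => N.add_mem)
    (fun a _ => N.smul_mem a) z

/-- The homomorphism from the induced module given by a homomorphism of `Hhat_(0)`-modules. -/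
def indLift (φ : S →ₗ[k] V) (h : ∀ (D : HhatFil k p 0) s, φ ⁅D, s⁆ = uι k p (D : Hhat k p) • φ s) :
    Ind k p S →ₗ[U k p] V :=
  (indRel k p S).liftQ (TensorProduct.AlgebraTensorModule.lift
    { toFun := fun a => { toFun := fun s => a • φ s
                          map_add' := fun s t => by rw [map_add, smul_add]
                          map_smul' := fun c s => by
                            rw [map_smul, u_smul_comm, RingHom.id_apply] }
      map_add' := fun a b => LinearMap.ext fun s => add_smul _ _ _
      map_smul' := fun a b => LinearMap.ext fun s => mul_smul _ _ _ }) (by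
    rw [indRel, Submodule.span_le]
    rintro _ ⟨a, D, s, rfl⟩
    simp [h, mul_smul])

theorem indLift_indι (φ : S →ₗ[k] V)
    (h : ∀ (D : HhatFil k p 0) s, φ ⁅D, s⁆ = uι k p (D : Hhat k p) • φ s) (s : S) :
    indLift φ h (indι S s) = φ s := by
  change (indRel k p S).liftQ _ _ ((indRel k p S).mkQ (1 ⊗ₜ[k] s)) = _
  rw [Submodule.mkQ_apply, Submodule.liftQ_apply]
  simp

end Induced

end RestrictedEnvelope

/-! ### Upper bound for the dimension of an induced module. -/

section InducedDimension

variable {k : Type*} [Field k] {p : ℕ} [Fact p.Prime] [Fact (5 ≤ p)] [CharP k p]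

variable (k p) in
/-- `ham f` as an element of `Hhat`. -/
def hamH : O k p →ₗ[k] Hhat k p :=
  LinearMap.codRestrict (Hhat k p).toSubmodule (ham k p) fun f =>
    (mem_Hhat_iff _).2 ⟨f, 0, by rw [zero_smul, add_zero]⟩

@[simp] theorem coe_hamH (f : O k p) : (hamH k p f : W k p) = ham k p f := rfl

theorem pMap_eq (D E : Hhat k p) (hx : (D : W k p)^[p] (x k p) = (E : W k p) (x k p))
    (hy : (D : W k p)^[p] (y k p) = (E : W k p) (y k p)) : pMap D = E := by
  refine Subtype.ext (W_ext ?_ ?_)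
  · rw [← hx]; exact powP_apply _ _
  · rw [← hy]; exact powP_apply _ _

theorem iterate_eq_zero_of_const (D : W k p) {f : O k p} {c : k} (h : D f = algebraMap k _ c) :
    D^[p] f = 0 := by
  have h5 := five_le p
  have h0 : D (0 : O k p) = 0 := map_zero D
  obtain ⟨q, hq⟩ : ∃ q, p = q + 2 := ⟨p - 2, by omega⟩
  have h1 : ∀ n, D^[n] (0 : O k p) = 0 := fun n => Function.iterate_fixed h0 n
  have h2 : ∀ n, n = q + 2 → D^[n] f = 0 := by
    rintro _ rfl
    rw [Function.iterate_add_apply, Function.iterate_succ_apply, Function.iterate_one, h,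
      Derivation.map_algebraMap, h1]
  exact h2 p hq

theorem pMap_hamH_x : pMap (hamH k p (x k p)) = 0 := by
  refine pMap_eq _ _ ?_ ?_
  · rw [iterate_eq_zero_of_const (c := 0) _ (by simp)]; rfl
  · rw [iterate_eq_zero_of_const (c := 1) _ (by simp [xtop_mul_x])]; rfl

theorem iterate_ham_y (n : ℕ) (hn : n < p) : (ham k p (y k p))^[n + 1] (y k p) =
    (-1 : k) ^ n • (divPow (x k p) ((p - 1 - n : ℕ) : ℤ) * y k p) := by
  have h5 := five_le p
  induction n with
  | zero => simp [xtop_eq]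
  | succ n ih =>
    rw [Function.iterate_succ_apply', ih (by omega), Derivation.map_smul, Derivation.leibniz,
      deriv_divPow _ _ _ (by omega)]
    have e : (((p - 1 - n : ℕ) : ℤ) - 1) = ((p - 1 - (n + 1) : ℕ) : ℤ) := by omega
    have h0 := xtop_mul_divPow (k := k) (p := p) (p - 1 - n) (by omega)
    rw [ham_x, ham_y, dx_y, dy_y, zero_add, e, pow_succ, smul_eq_mul, smul_eq_mul,
      show divPow (x k p) ((p - 1 - n : ℕ) : ℤ) * (xtop k p * y k p) =
        (xtop k p * divPow (x k p) ((p - 1 - n : ℕ) : ℤ)) * y k p by ring, h0, zero_mul, zero_add,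
      mul_smul, neg_one_smul]
    congr 1
    ring

/-- The field is `-∂_x + x^(p-1) y ∂_y`. Applied once to `y` it gives `x^(p-1) y`; each further
application lowers the divided power of `x` by one and changes the sign. After `p` applications `y`
returns, since `p - 1` is even. -/
theorem pMap_hamH_y : pMap (hamH k p (y k p)) = ydy k p := by
  have h5 := five_le p
  refine pMap_eq _ _ ?_ ?_
  · rw [iterate_eq_zero_of_const (c := -1) _ (by simp)]
    simp [ydy]
  · have h := iterate_ham_y (k := k) (p := p) (p - 1) (by omega)
    rw [show p - 1 + 1 = p by omega, Nat.sub_self, Nat.cast_zero, divPow_zero,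
      ((Fact.out : p.Prime).even_sub_one (by omega)).neg_one_pow, one_smul, one_mul] at h
    rw [coe_hamH, h]
    simp [ydy]

theorem mem_HhatFil_zero_iff (D : Hhat k p) : D ∈ HhatFil k p 0 ↔
    constTerm k p ((D : W k p) (x k p)) = 0 ∧ constTerm k p ((D : W k p) (y k p)) = 0 := by
  have e : maxIdeal k p ^ (0 + 1) = maxIdeal k p := Submodule.pow_one _
  change (D : W k p) (x k p) ∈ maxIdeal k p ^ (0 + 1) ∧
    (D : W k p) (y k p) ∈ maxIdeal k p ^ (0 + 1) ↔ _
  rw [e]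
  exact ⟨fun h => ⟨constTerm_of_mem _ h.1, constTerm_of_mem _ h.2⟩,
    fun h => ⟨mem_maxIdeal_of_constTerm _ h.1, mem_maxIdeal_of_constTerm _ h.2⟩⟩

/-- `Hhat` is spanned by `Hhat_(0)`, `ham x` and `ham y`. -/
theorem exists_decomposition (D : Hhat k p) : ∃ (a b : k) (E : HhatFil k p 0),
    D = a • hamH k p (x k p) + b • hamH k p (y k p) + E := by
  refine ⟨constTerm k p ((D : W k p) (y k p)), -constTerm k p ((D : W k p) (x k p)),
    ⟨D - (constTerm k p ((D : W k p) (y k p)) • hamH k p (x k p) +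
      (-constTerm k p ((D : W k p) (x k p))) • hamH k p (y k p)), ?_⟩, ?_⟩
  · rw [mem_HhatFil_zero_iff]
    constructor <;> simp [xtop_mul_x]
  · simp

theorem hamH_lie_mem : ⁅hamH k p (y k p), hamH k p (x k p)⁆ ∈ HhatFil k p 0 := by
  rw [mem_HhatFil_zero_iff]
  have e : ((⁅hamH k p (y k p), hamH k p (x k p)⁆ : Hhat k p) : W k p) =
    ⁅ham k p (y k p), ham k p (x k p)⁆ := rfl
  rw [e, ham_lie]
  constructor
  · simp [constTerm_of_mem]
  · have h : constTerm k p (xtop k p) = 0 := by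
      have h5 := five_le p
      rw [xtop_eq_smul, map_smul, map_pow, constTerm_x, zero_pow (by omega), smul_zero]
    simp [xtop_mul_x, h]

variable {S : Type*} [AddCommGroup S] [Module k S] [LieRingModule (HhatFil k p 0) S]
  [LieModule k (HhatFil k p 0) S]

variable (S) in
/-- The span of the vectors `(ham x) ^ i (ham y) ^ j ⊗ v` with `i + j ≤ s`. -/
def indFil (s : ℕ) : Submodule k (Ind k p S) :=
  Submodule.span k {t | ∃ (i j : ℕ) (v : S), i + j ≤ s ∧
    t = uι k p (hamH k p (x k p)) ^ i • uι k p (hamH k p (y k p)) ^ j • indι S v}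

theorem indFil_mono {s t : ℕ} (h : s ≤ t) : indFil (k := k) (p := p) S s ≤ indFil S t :=
  Submodule.span_mono fun _ ⟨i, j, v, hs, e⟩ => ⟨i, j, v, hs.trans h, e⟩

theorem smul_mem_of_span {V : Type*} [AddCommGroup V] [Module k V] [Module (U k p) V]
    [IsScalarTower k (U k p) V] (a : U k p) (T : Set V) (N : Submodule k V)
    (h : ∀ t ∈ T, a • t ∈ N) (u : V) (hu : u ∈ Submodule.span k T) : a • u ∈ N := by
  induction hu using Submodule.span_induction with
  | mem t ht => exact h t ht
  | zero => rw [smul_zero]; exact N.zero_mem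
  | add u v _ _ hu hv => rw [smul_add]; exact N.add_mem hu hv
  | smul c u _ hu => rw [u_smul_comm]; exact N.smul_mem c hu

/-- The three statements need one another. Moving an element of `Hhat_(0)` past `ham x` or `ham y`
leaves a commutator that may be any element of `Hhat`, acting on a vector of lower filtration.
Moving `ham y` past `ham x` leaves a commutator in `Hhat_(0)`. -/
theorem indFil_stable (s : ℕ) :
    (∀ D ∈ HhatFil k p 0, ∀ u : Ind k p S, u ∈ indFil S s → uι k p D • u ∈ indFil S s) ∧
    (∀ u : Ind k p S, u ∈ indFil S s → uι k p (hamH k p (x k p)) • u ∈ indFil S (s + 1)) ∧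
    (∀ u : Ind k p S, u ∈ indFil S s → uι k p (hamH k p (y k p)) • u ∈ indFil S (s + 1)) := by
  induction s with
  | zero =>
    refine ⟨?_, ?_, ?_⟩
    · refine fun D hD u hu => smul_mem_of_span _ _ _ ?_ u hu
      rintro _ ⟨i, j, v, h, rfl⟩
      obtain ⟨rfl, rfl⟩ : i = 0 ∧ j = 0 := by omega
      refine Submodule.subset_span ⟨0, 0, ⁅(⟨D, hD⟩ : HhatFil k p 0), v⁆, le_rfl, ?_⟩
      simp only [pow_zero, one_smul]
      exact indι_lie (⟨D, hD⟩ : HhatFil k p 0) v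
    · refine fun u hu => smul_mem_of_span _ _ _ ?_ u hu
      rintro _ ⟨i, j, v, h, rfl⟩
      exact Submodule.subset_span ⟨i + 1, j, v, by omega, by rw [pow_succ', mul_smul]⟩
    · refine fun u hu => smul_mem_of_span _ _ _ ?_ u hu
      rintro _ ⟨i, j, v, h, rfl⟩
      obtain ⟨rfl, rfl⟩ : i = 0 ∧ j = 0 := by omega
      exact Submodule.subset_span ⟨0, 1, v, by omega, by simp⟩
  | succ s ih =>
    obtain ⟨ih0, ihx, ihy⟩ := ih
    have ihall : ∀ D : Hhat k p, ∀ u : Ind k p S, u ∈ indFil S s → uι k p D • u ∈ indFil S (s + 1) := by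
      intro D u hu
      obtain ⟨a, b, E, rfl⟩ := exists_decomposition D
      rw [map_add, map_add, map_smul, map_smul, add_smul, add_smul, smul_assoc, smul_assoc]
      exact Submodule.add_mem _ (Submodule.add_mem _ (Submodule.smul_mem _ _ (ihx u hu))
        (Submodule.smul_mem _ _ (ihy u hu))) (indFil_mono (Nat.le_succ s) (ih0 _ E.2 u hu))
    have hx : ∀ u : Ind k p S, u ∈ indFil S (s + 1) → uι k p (hamH k p (x k p)) • u ∈ indFil S (s + 1 + 1) := by
      refine fun u hu => smul_mem_of_span _ _ _ ?_ u hu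
      rintro _ ⟨i, j, v, h, rfl⟩
      exact Submodule.subset_span ⟨i + 1, j, v, by omega, by rw [pow_succ', mul_smul]⟩
    have hcomm : ∀ (D E : Hhat k p) (u : Ind k p S),
        uι k p D • uι k p E • u = uι k p E • uι k p D • u + uι k p ⁅D, E⁆ • u := by
      intro D E u
      rw [uι_lie, sub_smul, mul_smul, mul_smul]
      abel
    refine ⟨?_, hx, ?_⟩
    · refine fun D hD u hu => smul_mem_of_span _ _ _ ?_ u hu
      rintro _ ⟨i, j, v, h, rfl⟩
      rcases i with _ | i
      · rcases j with _ | j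
        · refine indFil_mono (Nat.zero_le _) (Submodule.subset_span
            ⟨0, 0, ⁅(⟨D, hD⟩ : HhatFil k p 0), v⁆, le_rfl, ?_⟩)
          simp only [pow_zero, one_smul]
          exact indι_lie (⟨D, hD⟩ : HhatFil k p 0) v
        · have hu : uι k p (hamH k p (y k p)) ^ j • (indι S v : Ind k p S) ∈ indFil S s :=
            Submodule.subset_span ⟨0, j, v, by omega, by simp⟩
          rw [pow_zero, one_smul, pow_succ', mul_smul, hcomm]
          exact Submodule.add_mem _ (ihy _ (ih0 D hD _ hu)) (ihall _ _ hu)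
      · have hu : uι k p (hamH k p (x k p)) ^ i • uι k p (hamH k p (y k p)) ^ j •
            (indι S v : Ind k p S) ∈ indFil S s :=
          Submodule.subset_span ⟨i, j, v, by omega, rfl⟩
        rw [pow_succ', mul_smul, hcomm]
        exact Submodule.add_mem _ (ihx _ (ih0 D hD _ hu)) (ihall _ _ hu)
    · refine fun u hu => smul_mem_of_span _ _ _ ?_ u hu
      rintro _ ⟨i, j, v, h, rfl⟩
      rcases i with _ | i
      · exact Submodule.subset_span ⟨0, j + 1, v, by omega, by
          rw [pow_zero, one_smul, one_smul, pow_succ', mul_smul]⟩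
      · have hu : uι k p (hamH k p (x k p)) ^ i • uι k p (hamH k p (y k p)) ^ j •
            (indι S v : Ind k p S) ∈ indFil S s :=
          Submodule.subset_span ⟨i, j, v, by omega, rfl⟩
        rw [pow_succ', mul_smul, hcomm]
        exact Submodule.add_mem _ (hx _ (ihy _ hu))
          (indFil_mono (by omega) (ih0 _ hamH_lie_mem _ hu))

theorem exists_mem_indFil (z : Ind k p S) : ∃ s, z ∈ indFil S s := by
  have hdir : Directed (· ≤ ·) (fun s => indFil (k := k) (p := p) S s) :=
    fun s t => ⟨max s t, indFil_mono (le_max_left _ _), indFil_mono (le_max_right _ _)⟩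
  have h : uSubmodule (⨆ s, indFil (k := k) (p := p) S s) (by
      intro D v hv
      obtain ⟨s, hs⟩ := (Submodule.mem_iSup_of_directed _ hdir).1 hv
      refine (Submodule.mem_iSup_of_directed _ hdir).2 ⟨s + 1, ?_⟩
      obtain ⟨a, b, E, rfl⟩ := exists_decomposition D
      obtain ⟨h0, hx, hy⟩ := indFil_stable (k := k) (p := p) (S := S) s
      rw [map_add, map_add, map_smul, map_smul, add_smul, add_smul, smul_assoc, smul_assoc]
      exact Submodule.add_mem _ (Submodule.add_mem _ (Submodule.smul_mem _ _ (hx v hs))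
        (Submodule.smul_mem _ _ (hy v hs))) (indFil_mono (Nat.le_succ s) (h0 _ E.2 v hs))) = ⊤ := by
    refine ind_eq_top _ fun v => ?_
    rw [mem_uSubmodule]
    exact (Submodule.mem_iSup_of_directed _ hdir).2
      ⟨0, Submodule.subset_span ⟨0, 0, v, le_rfl, by simp⟩⟩
  have hz : z ∈ (⊤ : Submodule (U k p) (Ind k p S)) := trivial
  rw [← h, mem_uSubmodule] at hz
  exact (Submodule.mem_iSup_of_directed _ hdir).1 hz

variable (k p S) in
/-- The map `(v i j) ↦ ∑ (ham x) ^ i (ham y) ^ j ⊗ v i j`. -/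
def indSum : (Fin p × Fin p → S) →ₗ[k] Ind k p S where
  toFun f := ∑ s : Fin p × Fin p, uι k p (hamH k p (x k p)) ^ (s.1 : ℕ) •
    uι k p (hamH k p (y k p)) ^ (s.2 : ℕ) • indι S (f s)
  map_add' f g := by
    simp only [Pi.add_apply, map_add, smul_add, Finset.sum_add_distrib]
  map_smul' c f := by
    simp only [Pi.smul_apply, map_smul, u_smul_comm, Finset.smul_sum, RingHom.id_apply]

theorem indSum_surjective : Function.Surjective (indSum k p S) := by
  have h1 : ∀ (i j : ℕ) (v : S), uι k p (hamH k p (x k p)) ^ i •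
      uι k p (hamH k p (y k p)) ^ j • (indι S v : Ind k p S) ∈ LinearMap.range (indSum k p S) := by
    intro i j
    by_cases hi : p ≤ i
    · intro v
      obtain ⟨i, rfl⟩ := Nat.exists_eq_add_of_le hi
      rw [pow_add, uι_pow, pMap_hamH_x, map_zero, zero_mul, zero_smul]
      exact Submodule.zero_mem _
    induction j using Nat.strong_induction_on with
    | _ j ih =>
    intro v
    by_cases hj : p ≤ j
    · obtain ⟨j, rfl⟩ := Nat.exists_eq_add_of_le hj
      -- The `p`-th power of `ham y` is `y ∂_y`, which lies in `Hhat_(0)` and is absorbed by the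
      -- vector of `S`. The exponent drops by `p`, which is why the induction is over all vectors at
      -- once.
      have h0 : ydy k p ∈ HhatFil k p 0 := by
        rw [mem_HhatFil_zero_iff]; simp [ydy]
      have := ih j (by have := five_le p; omega) ⁅(⟨ydy k p, h0⟩ : HhatFil k p 0), v⁆
      rw [add_comm p j, pow_add, uι_pow, pMap_hamH_y, mul_smul]
      rwa [← indι_lie] at this
    · refine ⟨Pi.single (⟨i, by omega⟩, ⟨j, by omega⟩) v, ?_⟩
      change ∑ s : Fin p × Fin p, _ = _
      rw [Finset.sum_eq_single (⟨i, by omega⟩, ⟨j, by omega⟩)]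
      · simp
      · intro s _ hs
        rw [Pi.single_eq_of_ne hs, map_zero, smul_zero, smul_zero]
      · simp
  intro z
  obtain ⟨s, hs⟩ := exists_mem_indFil z
  have h2 : indFil S s ≤ LinearMap.range (indSum k p S) := by
    rw [indFil, Submodule.span_le]
    rintro _ ⟨i, j, v, -, rfl⟩
    exact h1 i j v
  exact h2 hs

variable (S) in
theorem finite_ind [Module.Finite k S] : Module.Finite k (Ind k p S) :=
  Module.Finite.of_surjective _ (indSum_surjective (k := k) (p := p) (S := S))

variable (S) in
-- Only this half of the PBW count is needed. The opposite inequality for `Z(l)` comes from the size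
-- of its image in the tensor model, in `exists_equiv`.
theorem finrank_ind_le [Module.Finite k S] :
    Module.finrank k (Ind k p S) ≤ p ^ 2 * Module.finrank k S := by
  have h := LinearMap.finrank_le_finrank_of_surjective
    (indSum_surjective (k := k) (p := p) (S := S))
  rw [Module.finrank_pi_fintype] at h
  simpa [sq] using h

end InducedDimension

/-! ### Derivations acting on the coefficients of polynomials. -/

section CoefficientDerivation

variable {k A σ : Type*} [CommRing k] [CommRing A] [Algebra k A]

/-- The derivation of `A[σ]` given by applying a derivation of `A` to the coefficients. -/
def coeffDeriv (D : Derivation k A A) : Derivation k (MvPolynomial σ A) (MvPolynomial σ A) :=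
  Derivation.mk' (((basisMonomials σ A).repr.symm.toLinearMap.restrictScalars k) ∘ₗ
    Finsupp.mapRange.linearMap (D : A →ₗ[k] A) ∘ₗ
    ((basisMonomials σ A).repr.toLinearMap.restrictScalars k)) (by
      have h : ∀ (s : σ →₀ ℕ) (a : A), (((basisMonomials σ A).repr.symm.toLinearMap.restrictScalars k)
          ∘ₗ Finsupp.mapRange.linearMap (D : A →ₗ[k] A) ∘ₗ
          ((basisMonomials σ A).repr.toLinearMap.restrictScalars k)) (monomial s a) =
          monomial s (D a) := by
        intro s a
        have e : (basisMonomials σ A).repr (monomial s a) = Finsupp.single s a := by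
          rw [← mul_one a, ← smul_eq_mul, ← smul_monomial, map_smul]
          have := (basisMonomials σ A).repr_self s
          rw [coe_basisMonomials] at this
          rw [this, Finsupp.smul_single, smul_eq_mul, mul_one]
        simp [e, smul_monomial]
      intro F G
      induction F using MvPolynomial.induction_on' with
      | add F F' hF hF' =>
        rw [add_mul, map_add, hF, hF', map_add, add_smul, smul_add]; abel
      | monomial s a =>
        induction G using MvPolynomial.induction_on' with
        | add G G' hG hG' =>
          rw [mul_add, map_add, hG, hG', map_add, add_smul, smul_add]; abel
        | monomial t b =>
          rw [monomial_mul, h, h, h, Derivation.leibniz]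
          simp only [smul_eq_mul, monomial_mul, map_add, add_comm t s])

theorem coeffDeriv_monomial (D : Derivation k A A) (s : σ →₀ ℕ) (a : A) :
    coeffDeriv D (monomial s a) = monomial s (D a) := by
  have e : (basisMonomials σ A).repr (monomial s a) = Finsupp.single s a := by
    rw [← mul_one a, ← smul_eq_mul, ← smul_monomial, map_smul]
    have := (basisMonomials σ A).repr_self s
    rw [coe_basisMonomials] at this
    rw [this, Finsupp.smul_single, smul_eq_mul, mul_one]
  simp [coeffDeriv, e, smul_monomial]

@[simp] theorem coeffDeriv_C (D : Derivation k A A) (a : A) :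
    coeffDeriv D (C a : MvPolynomial σ A) = C (D a) := coeffDeriv_monomial D 0 a

@[simp] theorem coeffDeriv_X (D : Derivation k A A) (i : σ) :
    coeffDeriv D (X i : MvPolynomial σ A) = 0 := by
  rw [X, coeffDeriv_monomial, Derivation.map_one_eq_zero, map_zero]

theorem coeff_coeffDeriv (D : Derivation k A A) (F : MvPolynomial σ A) (s : σ →₀ ℕ) :
    coeff s (coeffDeriv D F) = D (coeff s F) := by
  classical
  induction F using MvPolynomial.induction_on' with
  | add F G hF hG => simp [hF, hG]
  | monomial t a =>
    rw [coeffDeriv_monomial, coeff_monomial, coeff_monomial]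
    split_ifs <;> simp

theorem polyDeriv_ext {D E : Derivation k (MvPolynomial σ A) (MvPolynomial σ A)}
    (hC : ∀ a, D (C a) = E (C a)) (hX : ∀ i, D (X i) = E (X i)) : D = E := by
  refine Derivation.ext fun F => ?_
  induction F using MvPolynomial.induction_on with
  | C a => exact hC a
  | add F G hF hG => rw [map_add, map_add, hF, hG]
  | mul_X F i hF => rw [Derivation.leibniz, Derivation.leibniz, hF, hX]

end CoefficientDerivation

/-! ### Product rules for `p`-th powers. -/

section Pairing

theorem mulLeft_sub_mulRight_pow_char {k : Type*} [Field k] {p : ℕ} [Fact p.Prime] [CharP k p]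
    {B : Type*} [Ring B] [Algebra k B] (a b c : B) :
    ((LinearMap.mulLeft k a - LinearMap.mulRight k b) ^ p) c = a ^ p * c - c * b ^ p := by
  rcases subsingleton_or_nontrivial B with hB | hB
  · exact Subsingleton.elim _ _
  have : CharP (Module.End k B) p :=
    charP_of_injective_algebraMap (algebraMap k (Module.End k B)).injective p
  have h := sub_pow_char_of_commute p (LinearMap.commute_mulLeft_right (R := k) a b)
  rw [LinearMap.pow_mulLeft, LinearMap.pow_mulRight] at h
  rw [h]
  rfl

/-- The Leibniz rule for `p`-th powers in characteristic `p`. -/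
theorem pow_char_pairing {k : Type*} [Field k] {p : ℕ} [Fact p.Prime] [CharP k p]
    {A : Type*} [CommRing A] [Algebra k A] (P Q S : Module.End k A)
    (h : ∀ f g, S (f * g) = P f * g + f * Q g) (f g : A) :
    (S ^ p) (f * g) = (P ^ p) f * g + f * (Q ^ p) g := by
  -- By hypothesis, left composition with `S` minus right composition with `Q` takes multiplication
  -- by `f` to multiplication by `P f`. The two compositions commute, so the `p`-th power of their
  -- difference is the difference of their `p`-th powers.
  have h1 : ∀ n : ℕ, (((LinearMap.mulLeft k S - LinearMap.mulRight k Q) ^ n :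
      Module.End k (Module.End k A)) (LinearMap.mulLeft k f)) = LinearMap.mulLeft k ((P ^ n) f) := by
    intro n
    induction n with
    | zero => rfl
    | succ n ih =>
      rw [pow_succ', Module.End.mul_apply, ih, pow_succ', Module.End.mul_apply]
      ext t
      simp [h]
  have h2 := h1 p
  rw [mulLeft_sub_mulRight_pow_char] at h2
  have h3 := LinearMap.congr_fun h2 g
  simp only [LinearMap.sub_apply, LinearMap.mulLeft_apply,
    Module.End.mul_apply] at h3
  linear_combination h3

end Pairing

/-! ### The tensor model `O[ξ, η]` twisted by the divergence. -/

section PolynomialModel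

variable {k : Type*} [Field k] {p : ℕ} [Fact p.Prime] [Fact (5 ≤ p)] [CharP k p]

variable (k p) in
/-- The ring `O[ξ, η]`, in which `ξ` and `η` stand for `dx` and `dy`. -/
abbrev R : Type _ := MvPolynomial (Fin 2) (O k p)

variable (k p) in
/-- `∂_ξ` and `∂_η` -/
def pd (i : Fin 2) : Derivation k (R k p) (R k p) := (pderiv i).restrictScalars k

@[simp] theorem pd_C (i : Fin 2) (f : O k p) : pd k p i (C f) = 0 := pderiv_C

@[simp] theorem pd_X_self (i : Fin 2) : pd k p i (X i) = 1 := pderiv_X_self i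

@[simp] theorem pd_zero_X_one : pd k p 0 (X 1) = 0 := pderiv_X_of_ne (by decide)

@[simp] theorem pd_one_X_zero : pd k p 1 (X 0) = 0 := pderiv_X_of_ne (by decide)

/-- The differential `f ↦ ∂_x f ξ + ∂_y f η`. -/
def dd (f : O k p) : R k p := C (dx k p f) * X 0 + C (dy k p f) * X 1

/-- The derivation of `O[ξ, η]` extending `D` and commuting with the differential. -/
def liftD (D : W k p) : Derivation k (R k p) (R k p) :=
  coeffDeriv D + (dd (D (x k p)) • pd k p 0 + dd (D (y k p)) • pd k p 1)

@[simp] theorem liftD_C (D : W k p) (f : O k p) : liftD D (C f) = C (D f) := by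
  simp [liftD]

@[simp] theorem liftD_X_zero (D : W k p) : liftD D (X 0) = dd (D (x k p)) := by
  simp [liftD]

@[simp] theorem liftD_X_one (D : W k p) : liftD D (X 1) = dd (D (y k p)) := by
  simp [liftD]

theorem liftD_dd (D : W k p) (f : O k p) : liftD D (dd f) = dd (D f) := by
  rw [W_apply D f, dd, map_add, Derivation.leibniz, Derivation.leibniz, liftD_C, liftD_C,
    liftD_X_zero, liftD_X_one, W_apply D (dx k p f), W_apply D (dy k p f)]
  simp only [dd, map_add, Derivation.leibniz, smul_eq_mul, map_mul, dx_dy_comm]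
  ring

theorem liftD_iterate_C (D : W k p) (n : ℕ) (f : O k p) :
    (liftD D)^[n] (C f) = C (D^[n] f) := by
  induction n with
  | zero => rfl
  | succ n ih => rw [Function.iterate_succ_apply', ih, liftD_C, Function.iterate_succ_apply']

theorem liftD_iterate_dd (D : W k p) (n : ℕ) (f : O k p) :
    (liftD D)^[n] (dd f) = dd (D^[n] f) := by
  induction n with
  | zero => rfl
  | succ n ih => rw [Function.iterate_succ_apply', ih, liftD_dd, Function.iterate_succ_apply']

theorem dd_x : dd (x k p) = X 0 := by simp [dd]

theorem dd_y : dd (y k p) = X 1 := by simp [dd]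

theorem liftD_lie (D E : W k p) : liftD ⁅D, E⁆ = ⁅liftD D, liftD E⁆ := by
  refine polyDeriv_ext (fun f => ?_) (fun i => ?_)
  · simp [Derivation.commutator_apply]
  · fin_cases i
    · change liftD ⁅D, E⁆ (X 0) = ⁅liftD D, liftD E⁆ (X 0)
      rw [← dd_x]
      simp only [Derivation.commutator_apply, liftD_dd]
      simp [dd]
      ring
    · change liftD ⁅D, E⁆ (X 1) = ⁅liftD D, liftD E⁆ (X 1)
      rw [← dd_y]
      simp only [Derivation.commutator_apply, liftD_dd]
      simp [dd]
      ring

/-- Both sides are derivations, so it suffices to compare them on functions and on `ξ = dx`, `η =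
dy`; there `liftD` commutes with the differential. -/
theorem liftD_powP (D : W k p) (F : R k p) :
    liftD (powP D) F = ((liftD D : Module.End k (R k p)) ^ p) F := by
  let E : Derivation k (R k p) (R k p) := Derivation.mk' ((liftD D : Module.End k (R k p)) ^ p)
    fun f g => by
      rw [pow_char_pairing (p := p) (liftD D : Module.End k (R k p)) (liftD D : Module.End k (R k p))
        (liftD D : Module.End k (R k p)) (fun f g => by simp [Derivation.leibniz]; ring)]
      simp
      ring
  have h : liftD (powP D) = E := by
    refine polyDeriv_ext (fun f => ?_) (fun i => ?_)
    · change _ = ((liftD D : Module.End k (R k p)) ^ p) (C f)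
      rw [liftD_C, powP_apply, Module.End.pow_apply]
      exact (liftD_iterate_C D p f).symm
    · fin_cases i
      · change liftD (powP D) (X 0) = ((liftD D : Module.End k (R k p)) ^ p) (X 0)
        rw [← dd_x, liftD_dd, powP_apply, Module.End.pow_apply]
        exact (liftD_iterate_dd D p _).symm
      · change liftD (powP D) (X 1) = ((liftD D : Module.End k (R k p)) ^ p) (X 1)
        rw [← dd_y, liftD_dd, powP_apply, Module.End.pow_apply]
        exact (liftD_iterate_dd D p _).symm
  rw [h]
  rfl

/-- The divergence `∂_x D(x) + ∂_y D(y)`. -/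
def div0 (D : W k p) : O k p := dx k p (D (x k p)) + dy k p (D (y k p))

theorem div0_lie (D E : W k p) : div0 ⁅D, E⁆ = D (div0 E) - E (div0 D) := by
  have h1 := W_apply D
  have h2 := W_apply E
  simp only [div0, Derivation.commutator_apply]
  rw [h1 (E (x k p)), h1 (E (y k p)), h2 (D (x k p)), h2 (D (y k p)), h1 (_ + _), h2 (_ + _)]
  simp [dx_dy_comm]
  ring

variable (k p) in
/-- The action of `W` on functions, twisted by `b` times the divergence. -/
def actO (b : ℕ) : W k p →ₗ[k] Module.End k (O k p) where
  toFun D := (D : Module.End k (O k p)) + b • LinearMap.mulLeft k (div0 D)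
  map_add' D E := by ext f; simp [div0]; ring
  map_smul' c D := by
    ext f
    simp [div0, ← smul_add]

theorem actO_apply (b : ℕ) (D : W k p) (f : O k p) :
    actO k p b D f = D f + b * (div0 D * f) := by
  simp [actO]

variable (k p) in
/-- The action of `W` on `O[ξ, η]`, twisted by `b` times the divergence. -/
def actR (b : ℕ) : W k p →ₗ[k] Module.End k (R k p) where
  toFun D := (liftD D : Module.End k (R k p)) + b • LinearMap.mulLeft k (C (div0 D))
  map_add' D E := by
    have h : liftD (D + E) = liftD D + liftD E := by
      refine polyDeriv_ext (fun f => ?_) (fun i => ?_)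
      · simp
      · fin_cases i <;> simp [dd] <;> ring
    refine LinearMap.ext fun F => ?_
    simp [div0, h]
    ring
  map_smul' c D := by
    have h : liftD (c • D) = c • liftD D := by
      refine polyDeriv_ext (fun f => ?_) (fun i => ?_)
      · rw [liftD_C, Derivation.smul_apply, Derivation.smul_apply, liftD_C, Algebra.smul_def,
          Algebra.smul_def, map_mul, MvPolynomial.algebraMap_apply]
      · fin_cases i <;> simp [dd, Algebra.smul_def, MvPolynomial.algebraMap_apply] <;> ring
    refine LinearMap.ext fun F => ?_
    simp [div0, h, Algebra.smul_def, MvPolynomial.algebraMap_apply]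
    ring

theorem actR_apply (b : ℕ) (D : W k p) (F : R k p) :
    actR k p b D F = liftD D F + (b : R k p) * (C (div0 D) * F) := by
  simp [actR]

theorem actR_C (b : ℕ) (D : W k p) (f : O k p) : actR k p b D (C f) = C (actO k p b D f) := by
  simp [actR_apply, actO_apply]

theorem actR_lie (b : ℕ) (D E : W k p) :
    actR k p b ⁅D, E⁆ = actR k p b D * actR k p b E - actR k p b E * actR k p b D := by
  refine LinearMap.ext fun F => ?_
  simp only [LinearMap.sub_apply, Module.End.mul_apply, actR_apply, liftD_lie, div0_lie,
    Derivation.commutator_apply, map_add, Derivation.leibniz, smul_eq_mul, liftD_C, map_sub,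
    Derivation.map_natCast]
  ring

variable (k p) in
/-- The coefficient of `x ^ (p - 1) y ^ (p - 1)`, up to a scalar. -/
def integral : O k p →ₗ[k] k := taylor k p (p - 1) (p - 1)

theorem iterate_dx_dy (n : ℕ) (f : O k p) : (dy k p)^[n] (dx k p f) = dx k p ((dy k p)^[n] f) := by
  induction n with
  | zero => rfl
  | succ n ih => rw [Function.iterate_succ_apply', ih, ← dx_dy_comm, Function.iterate_succ_apply']

theorem integral_dx (f : O k p) : integral k p (dx k p f) = 0 := by
  have h5 := five_le p
  rw [integral, taylor_apply, iterate_dx_dy, ← Function.iterate_succ_apply]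
  have h := iterate_dx_eq_zero ((dy k p)^[p - 1] f)
  rw [Nat.succ_eq_add_one, show p - 1 + 1 = p by omega, h, map_zero]

theorem integral_dy (f : O k p) : integral k p (dy k p f) = 0 := by
  have h5 := five_le p
  rw [integral, taylor_apply, ← Function.iterate_succ_apply (f := dy k p)]
  have h := iterate_dy_eq_zero f
  have h0 := Function.iterate_fixed (map_zero (dx k p)) (p - 1)
  rw [Nat.succ_eq_add_one, show p - 1 + 1 = p by omega, h, h0, map_zero]

theorem integral_monomial (i j : ℕ) : integral k p (x k p ^ i * y k p ^ j) =
    if p - 1 = i ∧ p - 1 = j then ((p - 1).factorial : k) * (p - 1).factorial else 0 :=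
  taylor_monomial _ _ _ _

/-- Multiplying by the complementary monomial moves any chosen coefficient of `g` to the top
monomial: `(f, g) ↦ ∫ f g` is a perfect pairing. -/
theorem eq_zero_of_integral_mul (g : O k p) (h : ∀ f, integral k p (f * g) = 0) : g = 0 := by
  have h5 := five_le p
  rw [← (monomialBasis k p).sum_repr g]
  refine Finset.sum_eq_zero fun s _ => ?_
  have h1 := h (x k p ^ (p - 1 - s.1 : ℕ) * y k p ^ (p - 1 - s.2 : ℕ))
  rw [← (monomialBasis k p).sum_repr g, Finset.mul_sum, map_sum, Finset.sum_eq_single s] at h1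
  · rw [mul_smul_comm, map_smul, monomialBasis, Module.Basis.mk_apply, mul_mul_mul_comm,
      ← pow_add, ← pow_add, integral_monomial, if_pos (by omega), smul_eq_mul] at h1
    rw [monomialBasis, (mul_eq_zero.1 h1).resolve_right (mul_ne_zero
      (factorial_ne_zero' k p (by omega)) (factorial_ne_zero' k p (by omega))), zero_smul]
  · intro t _ ht
    rw [mul_smul_comm, map_smul, monomialBasis, Module.Basis.mk_apply, mul_mul_mul_comm,
      ← pow_add, ← pow_add, integral_monomial, if_neg, smul_zero]
    rintro ⟨h1, h2⟩
    exact ht (Prod.ext (Fin.ext (by omega)) (Fin.ext (by omega)))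
  · simp

/-- With twist one the action is a total divergence, `∂_x (D(x) f) + ∂_y (D(y) f)`. -/
theorem integral_actO_one (D : W k p) (f : O k p) : integral k p (actO k p 1 D f) = 0 := by
  have h : actO k p 1 D f = dx k p (D (x k p) * f) + dy k p (D (y k p) * f) := by
    rw [actO_apply, W_apply D f]
    simp [div0, Derivation.leibniz]
    ring
  rw [h, map_add, integral_dx, integral_dy, add_zero]

theorem powP_apply' (D : W k p) (f : O k p) : powP D f = ((D : Module.End k (O k p)) ^ p) f := by
  rw [powP_apply, Module.End.pow_apply]; rfl

/-- This determines the divergence of `D ^ p` without computing it. Both operators satisfy the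
Leibniz rule over `powP D`, so they differ by multiplication by a function. Both have values of
integral zero, so this function is orthogonal to everything and vanishes. -/
theorem actO_one_pow (D : W k p) : actO k p 1 D ^ p = actO k p 1 (powP D) := by
  have h1 : ∀ f g, (actO k p 1 D ^ p) (f * g) = powP D f * g + f * (actO k p 1 D ^ p) g := by
    intro f g
    rw [pow_char_pairing (p := p) (D : Module.End k (O k p)) (actO k p 1 D), powP_apply']
    intro f g
    simp [actO_apply, Derivation.leibniz]
    ring
  have h2 : (actO k p 1 D ^ p) 1 = actO k p 1 (powP D) 1 := by
    rw [← sub_eq_zero]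
    refine eq_zero_of_integral_mul _ fun f => ?_
    have e : f * ((actO k p 1 D ^ p) 1 - actO k p 1 (powP D) 1) =
        (actO k p 1 D ^ p) f - actO k p 1 (powP D) f := by
      have := h1 f 1
      rw [mul_one, mul_one] at this
      rw [this, actO_apply, actO_apply]
      simp
      ring
    have hp : p = p - 1 + 1 := by have := five_le p; omega
    have e2 : actO k p 1 D ^ p = actO k p 1 D * actO k p 1 D ^ (p - 1) := by
      rw [← pow_succ', ← hp]
    rw [e, map_sub, e2, Module.End.mul_apply, integral_actO_one, integral_actO_one, sub_zero]
  refine LinearMap.ext fun f => ?_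
  have := h1 f 1
  rw [mul_one, mul_one, h2] at this
  rw [this, actO_apply, actO_apply]
  simp
  ring

/-- Twist `b + 1` is the product of twist `b` and twist `1`. Applying the product rule for `p`-th
powers to `F * 1` reduces the inductive step to `actO_one_pow`. -/
theorem actR_pow (b : ℕ) (D : W k p) : actR k p b D ^ p = actR k p b (powP D) := by
  induction b with
  | zero =>
    refine LinearMap.ext fun F => ?_
    have e : ∀ E, actR k p 0 E = (liftD E : Module.End k (R k p)) := fun E => by
      refine LinearMap.ext fun F => ?_; simp [actR_apply]
    rw [e, e, ← liftD_powP]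
    rfl
  | succ b ih =>
    have h1 := pow_char_pairing (p := p) (actR k p b D) (actR k p 1 D) (actR k p (b + 1) D)
      (fun f g => by simp [actR_apply, Derivation.leibniz]; ring)
    have h2 : ∀ n, (actR k p 1 D ^ n) 1 = C ((actO k p 1 D ^ n) 1) := by
      intro n
      induction n with
      | zero => simp
      | succ n ih => rw [pow_succ', Module.End.mul_apply, ih, actR_C, pow_succ',
          Module.End.mul_apply]
    refine LinearMap.ext fun F => ?_
    have h3 := h1 F 1
    rw [mul_one, mul_one, h2, ih, actO_one_pow] at h3
    rw [h3]
    simp [actR_apply, actO_apply]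
    ring

theorem C_injective' : Function.Injective (C : O k p → R k p) := C_injective _ _

end PolynomialModel

/-! ### Submodules of the modules of functions and densities. -/

section FunctionModules

variable {k : Type*} [Field k] {p : ℕ} [Fact p.Prime] [Fact (5 ≤ p)] [CharP k p]

theorem ham_mem (f : O k p) : ham k p f ∈ Hhat k p := (hamH k p f).2

theorem actO_ham (b : ℕ) (f g : O k p) : actO k p b (ham k p f) g =
    (dx k p f + xtop k p * f) * dy k p g - dy k p f * dx k p g + b * (xtop k p * dy k p f * g) := by
  rw [actO_apply, W_apply (ham k p f) g]
  simp [div0, dx_dy_comm]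
  ring

theorem actO_xdx (b : ℕ) (g : O k p) :
    actO k p b (xdx k p : W k p) g = x k p * dx k p g + b * g := by
  change actO k p b (x k p • dx k p) g = _
  simp [actO_apply, div0]

theorem actO_ydy (b : ℕ) (g : O k p) :
    actO k p b (ydy k p : W k p) g = y k p * dy k p g + b * g := by
  change actO k p b (y k p • dy k p) g = _
  simp [actO_apply, div0]

theorem actO_xdy (b : ℕ) (g : O k p) :
    actO k p b (xdy k p : W k p) g = x k p * dy k p g := by
  change actO k p b (x k p • dy k p) g = _
  simp [actO_apply, div0]

theorem actO_ham_x (b : ℕ) (g : O k p) : actO k p b (ham k p (x k p)) g = dy k p g := by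
  rw [actO_ham]
  simp [xtop_mul_x]

theorem mem_span_x_pow (f : O k p) (h : dy k p f = 0) :
    f ∈ Submodule.span k (Set.range fun i : Fin p => x k p ^ (i : ℕ)) := by
  have key : f = ∑ i : Fin p, (taylor k p i 0 f * (((i : ℕ).factorial : k))⁻¹) • x k p ^ (i : ℕ) := by
    rw [← sub_eq_zero]
    refine eq_zero_of_taylor _ fun i j hi hj => ?_
    have hm : ∀ a : ℕ, taylor k p i j (x k p ^ a) =
        if i = a ∧ j = 0 then (i.factorial : k) * j.factorial else 0 := fun a => by
      rw [← taylor_monomial, pow_zero, mul_one]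
    rw [map_sub, map_sum, Finset.sum_eq_single ⟨i, hi⟩]
    · rw [map_smul, hm]
      rcases j with _ | j
      · simp [factorial_ne_zero' k p hi]
      · have h0 : (dy k p)^[j + 1] f = 0 := by
          rw [Function.iterate_succ_apply, h]
          exact Function.iterate_fixed (map_zero _) _
        rw [taylor_apply, h0, Function.iterate_fixed (map_zero (dx k p))]
        simp
    · intro a _ ha
      rw [map_smul, hm, if_neg, smul_zero]
      rintro ⟨h1, -⟩
      exact ha (Fin.ext h1.symm)
    · simp
  rw [key]
  exact Submodule.sum_mem _ fun i _ => Submodule.smul_mem _ _ (Submodule.subset_span ⟨i, rfl⟩)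

theorem xtop_mul_pow {i : ℕ} (h : i ≠ 0) : xtop k p * x k p ^ i = 0 := by
  obtain ⟨i, rfl⟩ := Nat.exists_eq_succ_of_ne_zero h
  rw [pow_succ', ← mul_assoc, xtop_mul_x, zero_mul]

theorem xtop_mul_of_dy_eq_zero (f : O k p) (h : dy k p f = 0) :
    xtop k p * f = constTerm k p f • xtop k p := by
  have hf := mem_span_x_pow f h
  clear h
  induction hf using Submodule.span_induction with
  | mem f hf =>
    obtain ⟨i, rfl⟩ := hf
    dsimp only
    by_cases hi : (i : ℕ) = 0
    · simp [hi]
    · rw [xtop_mul_pow hi, map_pow, constTerm_x, zero_pow hi, zero_smul]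
  | zero => simp
  | add f g _ _ hf hg => rw [mul_add, hf, hg, map_add, add_smul]
  | smul c f _ hf => rw [mul_smul_comm, hf, map_smul, smul_assoc]

/-- A stable line in the module of functions consists of constants, and the twist is zero. -/
theorem stable_line (b : ℕ) (S : Submodule k (O k p))
    (hS : ∀ D ∈ Hhat k p, ∀ f ∈ S, actO k p b D f ∈ S) (h1 : Module.finrank k S = 1) :
    (b : k) = 0 ∧ S = Submodule.span k {1} := by
  obtain ⟨⟨g, hg⟩, hg0, hspan⟩ := finrank_eq_one_iff'.1 h1
  have hg0 : g ≠ 0 := fun h => hg0 (Subtype.ext h)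
  have hsp : ∀ f ∈ S, ∃ c : k, c • g = f := fun f hf => by
    obtain ⟨c, hc⟩ := hspan ⟨f, hf⟩
    exact ⟨c, congrArg Subtype.val hc⟩
  have hdy : dy k p g = 0 := by
    obtain ⟨c, hc⟩ := hsp _ (hS _ (ham_mem (x k p)) g hg)
    rw [actO_ham_x] at hc
    -- `∂_y` acts on the line by a scalar `c`, and `∂_y ^ p = 0` forces `c = 0`.
    have h : ∀ n, (dy k p)^[n] g = c ^ n • g := by
      intro n
      induction n with
      | zero => simp
      | succ n ih => rw [Function.iterate_succ_apply', ih, Derivation.map_smul, ← hc, pow_succ, mul_smul]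
    have h0 := h p
    rw [iterate_dy_eq_zero] at h0
    have : c = 0 := by
      have := (smul_eq_zero.1 h0.symm).resolve_right hg0
      exact pow_eq_zero_iff (Fact.out : p.Prime).ne_zero |>.1 this
    rw [← hc, this, zero_smul]
  -- On functions of `x` alone `ham y` acts as `T = -∂_x + b x^(p-1)`, and `[x∂_x, T] = -T` because
  -- `x ∂_x` has eigenvalue `-1` on `x^(p-1)`. Operators on a line commute, so `T g = 0`.
  have hT : dx k p g = (b : k) • (xtop k p * g) := by
    obtain ⟨c, hc⟩ := hsp _ (hS _ (ham_mem (y k p)) g hg)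
    obtain ⟨d, hd⟩ := hsp _ (hS _ (xdx k p).2 g hg)
    rw [actO_ham, hdy, dy_y, dx_y] at hc
    rw [actO_xdx] at hd
    have e : (b : k) • (xtop k p * g) = b * (xtop k p * g) := by
      rw [Algebra.smul_def, map_natCast]
    have h2 := x_mul_dx_xtop (k := k) (p := p)
    have hc' : dx k p (c • g) = dx k p
      ((0 + xtop k p * y k p) * 0 - 1 * dx k p g + b * (xtop k p * 1 * g)) := by rw [hc]
    have hd' : dx k p (d • g) = dx k p (x k p * dx k p g + b * g) := by rw [hd]
    simp only [Derivation.map_smul, map_add, map_sub, Derivation.leibniz, smul_eq_mul, mul_zero,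
      Derivation.map_natCast, dx_x, Derivation.map_one_eq_zero, map_zero] at hc' hd'
    simp only [Algebra.smul_def] at hc hd hc' hd' e ⊢
    linear_combination -(algebraMap k (O k p) c * hd + x k p * hc' - algebraMap k (O k p) d * hc +
      hd' - b * xtop k p * hd + b * hc + b * g * h2) - e
  rw [xtop_mul_of_dy_eq_zero _ hdy, smul_smul] at hT
  have hb := eq_zero_of_dx_eq_smul_xtop hT
  rw [hb, zero_smul] at hT
  have hc := algebraMap_constTerm_of_const g hT hdy
  have hne : constTerm k p g ≠ 0 := fun h => hg0 (by rw [hc, h, map_zero])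
  refine ⟨(mul_eq_zero.1 hb).resolve_right hne, ?_⟩
  have hS' : S = Submodule.span k {g} := by
    apply le_antisymm
    · intro f hf
      exact Submodule.mem_span_singleton.2 (hsp f hf)
    · rw [Submodule.span_singleton_le_iff_mem]; exact hg
  rw [hS', hc, Algebra.algebraMap_eq_smul_one]
  exact Submodule.span_singleton_smul_eq (IsUnit.mk0 _ hne) 1

variable (k p) in
-- Apply `∂_y` as long as the result is nonconstant. If the last such function has a nonzero
-- constant `∂_y`-derivative, `x∂_y` takes it to a multiple of `x`. Otherwise it depends on `x`
-- alone, `ham y` acts as `-∂_x`, and repeating the process in `x` ends with `c x + const` and with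
-- `1`, both in `S`.
theorem one_mem_and_x_mem_of_stable (S : Submodule k (O k p))
    (hS : ∀ D ∈ Hhat k p, ∀ f ∈ S, actO k p 0 D f ∈ S) (g : O k p) (hg : g ∈ S)
    (hgc : ¬ (dx k p g = 0 ∧ dy k p g = 0)) : x k p ∈ S := by
  have hdyS : ∀ f ∈ S, dy k p f ∈ S := fun f hf => by
    have := hS _ (ham_mem (x k p)) f hf
    rwa [actO_ham_x] at this
  have hdyS' : ∀ n, (dy k p)^[n] g ∈ S := by
    intro n
    induction n with
    | zero => exact hg
    | succ n ih => rw [Function.iterate_succ_apply']; exact hdyS _ ih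
  obtain ⟨i, hi1, hi2⟩ := exists_iterate_not_mem (dy k p) {f | dx k p f = 0 ∧ dy k p f = 0} p g hgc
    (by rw [iterate_dy_eq_zero]; simp)
  have hu := hdyS' i
  set u := (dy k p)^[i] g
  by_cases hc : dy k p u = 0
  · have hTS : ∀ f, dy k p f = 0 → f ∈ S → - dx k p f ∈ S := fun f h hf => by
      have := hS _ (ham_mem (y k p)) f hf
      rw [actO_ham, h, dy_y, dx_y] at this
      simpa using this
    have hn : ∀ n, (dx k p)^[n] u ∈ S ∧ dy k p ((dx k p)^[n] u) = 0 := by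
      intro n
      induction n with
      | zero => exact ⟨hu, hc⟩
      | succ n ih =>
        rw [Function.iterate_succ_apply']
        refine ⟨?_, by rw [← dx_dy_comm, ih.2, map_zero]⟩
        exact neg_neg (dx k p ((dx k p)^[n] u)) ▸ S.neg_mem (hTS _ ih.2 ih.1)
    obtain ⟨j, hj1, hj2⟩ := exists_iterate_not_mem (dx k p) {f | dx k p f = 0 ∧ dy k p f = 0} p u hi1
      (by rw [iterate_dx_eq_zero]; simp)
    obtain ⟨hv, hv'⟩ := hn j
    set v := (dx k p)^[j] u
    have hc1 := algebraMap_constTerm_of_const _ hj2.1 hj2.2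
    set c := constTerm k p (dx k p v)
    have hc0 : c ≠ 0 := fun h0 => hj1 ⟨by rw [hc1, h0, map_zero], hv'⟩
    have h1 : (1 : O k p) ∈ S := by
      have := hTS v hv' hv
      rw [hc1, Algebra.algebraMap_eq_smul_one, ← neg_smul] at this
      exact (S.smul_mem_iff (neg_ne_zero.2 hc0)).1 this
    have h2 := algebraMap_constTerm_of_const (v - c • x k p)
      (by rw [map_sub, Derivation.map_smul, dx_x, hc1, Algebra.algebraMap_eq_smul_one, sub_self])
      (by rw [map_sub, Derivation.map_smul, dy_x, hv', smul_zero, sub_zero])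
    have h3 : c • x k p ∈ S := by
      rw [Algebra.algebraMap_eq_smul_one] at h2
      have : c • x k p = v - (v - c • x k p) := by abel
      rw [this]
      refine S.sub_mem hv ?_
      rw [h2]
      exact S.smul_mem _ h1
    exact (S.smul_mem_iff hc0).1 h3
  · have hc1 := algebraMap_constTerm_of_const _ hi2.1 hi2.2
    have h1 := hS _ (xdy k p).2 u hu
    rw [actO_xdy, hc1, Algebra.algebraMap_eq_smul_one, mul_smul_comm, mul_one] at h1
    refine (S.smul_mem_iff fun h0 => hc ?_).1 h1
    rw [hc1, h0, map_zero]

theorem dy_monomial_succ (i j : ℕ) : dy k p (x k p ^ i * y k p ^ (j + 1)) =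
    ((j + 1 : ℕ) : k) • (x k p ^ i * y k p ^ j) := by
  rw [Derivation.leibniz, dy_y_pow, dy_x_pow, smul_zero, add_zero, Nat.add_sub_cancel, smul_comm,
    smul_eq_mul]

/-- `ham f` sends `x` to `-∂_y f`, the twist contributing nothing because `x^(p-1) x = 0`; this
yields all exponents `j < p - 1`. Then `ham (y²)` raises the exponent of `y` to `p - 1` at the cost
of one `x`. The top monomial is excluded because for `b = 1` it need not belong to `S`. -/
theorem monomial_mem_of_stable (b : ℕ) (S : Submodule k (O k p))
    (hS : ∀ D ∈ Hhat k p, ∀ f ∈ S, actO k p b D f ∈ S) (hx : x k p ∈ S) (i j : ℕ)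
    (hij : i + 1 < p ∨ j + 1 < p) (hj : j < p) : x k p ^ i * y k p ^ j ∈ S := by
  have h5 := five_le p
  have h1 : ∀ i j : ℕ, j + 1 < p → x k p ^ i * y k p ^ j ∈ S := by
    intro i j hj
    have := hS _ (ham_mem (x k p ^ i * y k p ^ (j + 1))) _ hx
    have e : xtop k p * dy k p (x k p ^ i * y k p ^ (j + 1)) * x k p = 0 := by
      rw [mul_right_comm, xtop_mul_x, zero_mul]
    rw [actO_ham, e, dy_x, dx_x, mul_zero, mul_zero, mul_one, zero_sub, add_zero,
      dy_monomial_succ, ← smul_neg] at this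
    exact (S.neg_mem_iff).1 ((S.smul_mem_iff (natCast_ne_zero_of_lt k (by omega) hj)).1 this)
  by_cases hj1 : j + 1 < p
  · exact h1 i j hj1
  obtain rfl : j = p - 1 := by omega
  have hi : i + 1 < p := by omega
  have h := hS _ (ham_mem (y k p ^ 2)) _ (h1 (i + 1) (p - 2) (by omega))
  have e : xtop k p * x k p ^ (i + 1) = 0 := xtop_mul_pow (by omega)
  have e2 : y k p ^ (p - 1) = y k p * y k p ^ (p - 2) := by
    rw [← pow_succ']; congr 1; omega
  have e3 : actO k p b (ham k p (y k p ^ 2)) (x k p ^ (i + 1) * y k p ^ (p - 2)) =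
      (-(2 * ((i + 1 : ℕ) : k))) • (x k p ^ i * y k p ^ (p - 1)) := by
    rw [actO_ham, e2]
    simp only [Derivation.leibniz, dx_x_pow, dy_y_pow, dx_y_pow, dy_x_pow, add_zero,
      zero_add, smul_eq_mul, Algebra.smul_def, map_neg, map_mul, map_natCast,
      map_ofNat, Nat.add_sub_cancel, Nat.cast_ofNat, mul_zero]
    linear_combination (y k p ^ 2 * ((p - 2 : ℕ) * y k p ^ (p - 2 - 1)) +
      b * (2 * y k p ^ (2 - 1)) * y k p ^ (p - 2)) * e
  rw [e3] at h
  exact (S.smul_mem_iff (neg_ne_zero.2 (mul_ne_zero (by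
    have := natCast_ne_zero_of_lt k (p := p) (n := 2) (by omega) (by omega)
    exact_mod_cast this) (natCast_ne_zero_of_lt k (by omega) hi)))).1 h

/-- In the module of functions every submodule containing a nonconstant function is everything. -/
theorem stable_eq_top (S : Submodule k (O k p))
    (hS : ∀ D ∈ Hhat k p, ∀ f ∈ S, actO k p 0 D f ∈ S) (g : O k p) (hg : g ∈ S)
    (hgc : ¬ (dx k p g = 0 ∧ dy k p g = 0)) : S = ⊤ := by
  have h5 := five_le p
  have h1 := monomial_mem_of_stable 0 S hS (one_mem_and_x_mem_of_stable k p S hS g hg hgc)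
  -- The non-graded term `x^(p-1) y ∂_y` of `ham y` takes `y ^ (p-1)` to a nonzero multiple of the
  -- top monomial.
  have h3 : x k p ^ (p - 1) * y k p ^ (p - 1) ∈ S := by
    have h := hS _ (ham_mem (y k p)) _ (h1 0 (p - 1) (by omega) (by omega))
    have e2 : y k p ^ (p - 1) = y k p * y k p ^ (p - 2) := by
      rw [← pow_succ']; congr 1; omega
    have e3 : actO k p 0 (ham k p (y k p)) (x k p ^ 0 * y k p ^ (p - 1)) =
        (((p - 1 : ℕ) : k) * ((p - 1).factorial : k)⁻¹) • (x k p ^ (p - 1) * y k p ^ (p - 1)) := by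
      rw [actO_ham, pow_zero, one_mul, dy_y_pow, show p - 1 - 1 = p - 2 by omega, xtop_eq_smul, e2]
      simp only [dx_y, dy_y, Derivation.leibniz, dx_y_pow, Algebra.smul_def, map_natCast,
        Nat.cast_zero, map_mul]
      simp
      ring
    rw [e3] at h
    exact (S.smul_mem_iff (mul_ne_zero (natCast_ne_zero_of_lt k (by omega) (by omega))
      (inv_ne_zero (factorial_ne_zero' k p (by omega))))).1 h
  refine eq_top_iff.2 fun f _ => mem_of_monomials S (fun i j hi hj => ?_) f
  by_cases h : i + 1 < p ∨ j + 1 < p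
  · exact h1 i j h hj
  · obtain rfl : i = p - 1 := by omega
    obtain rfl : j = p - 1 := by omega
    exact h3

/-- In the module of densities every nonzero submodule contains all densities of integral zero. -/
theorem ker_integral_le_of_stable (S : Submodule k (O k p))
    (hS : ∀ D ∈ Hhat k p, ∀ f ∈ S, actO k p 1 D f ∈ S) (g : O k p) (hg : g ∈ S) (hg0 : g ≠ 0) :
    LinearMap.ker (integral k p) ≤ S := by
  have h5 := five_le p
  have hdyS : ∀ n, (dy k p)^[n] g ∈ S := by
    intro n
    induction n with
    | zero => exact hg
    | succ n ih =>
      have := hS _ (ham_mem (x k p)) _ ih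
      rwa [Function.iterate_succ_apply', ← actO_ham_x 1]
  obtain ⟨i, hi1, hi2⟩ := exists_iterate_not_mem (dy k p) {0} p g hg0
    (iterate_dy_eq_zero g)
  have hu := hdyS i
  set u := (dy k p)^[i] g
  have hu0 : u ≠ 0 := hi1
  have hdu : dy k p u = 0 := hi2
  have hT : ∀ f, dy k p f = 0 → f ∈ S → constTerm k p f • xtop k p - dx k p f ∈ S :=
    fun f h hf => by
      have := hS _ (ham_mem (y k p)) f hf
      rw [actO_ham, h, dy_y, dx_y, mul_zero, one_mul, mul_one, Nat.cast_one, one_mul,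
        xtop_mul_of_dy_eq_zero f h, zero_sub, neg_add_eq_sub] at this
      exact this
  -- If every function of `x` alone in `S` vanished at the origin, `ham y` would act on these as
  -- `-∂_x`, and all Taylor coefficients of `u` would vanish.
  have hone : ∃ h ∈ S, dy k p h = 0 ∧ constTerm k p h ≠ 0 := by
    by_contra! hno
    have hn : ∀ n, (dx k p)^[n] u ∈ S ∧ dy k p ((dx k p)^[n] u) = 0 := by
      intro n
      induction n with
      | zero => exact ⟨hu, hdu⟩
      | succ n ih =>
        rw [Function.iterate_succ_apply']
        refine ⟨?_, by rw [← dx_dy_comm, ih.2, map_zero]⟩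
        have := hT _ ih.2 ih.1
        rw [hno _ ih.1 ih.2, zero_smul, zero_sub] at this
        exact (S.neg_mem_iff).1 this
    refine hu0 (eq_zero_of_taylor u fun i j _ _ => ?_)
    rw [taylor_apply]
    rcases j with _ | j
    · exact hno _ (hn i).1 (hn i).2
    · rw [Function.iterate_succ_apply, hdu, Function.iterate_fixed (map_zero (dy k p)),
        Function.iterate_fixed (map_zero (dx k p)), map_zero]
  obtain ⟨h, hhS, hdh, hh0⟩ := hone
  have h1 : (1 : O k p) ∈ S := by
    -- By Fermat's little theorem, `1 - (x∂_x) ^ (p-1)` projects functions of `x` onto their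
    -- constant term. The twist only shifts `x∂_x` by a scalar.
    let E : Module.End k (O k p) := LinearMap.mulLeft k (x k p) ∘ₗ (dx k p : Module.End k (O k p))
    have hE : ∀ n, (E ^ n) h ∈ S := by
      intro n
      induction n with
      | zero => exact hhS
      | succ n ih =>
        have := S.sub_mem (hS _ (xdx k p).2 _ ih) ih
        rw [actO_xdx, Nat.cast_one, one_mul, add_sub_cancel_right] at this
        rw [pow_succ']
        exact this
    have hE1 : ∀ n i : ℕ, (E ^ n) (x k p ^ i) = ((i : k) ^ n) • x k p ^ i := by
      intro n i
      induction n with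
      | zero => simp
      | succ n ih =>
        rw [pow_succ', Module.End.mul_apply, ih, map_smul]
        change (i : k) ^ n • (x k p * dx k p (x k p ^ i)) = _
        rw [dx_x_pow, mul_smul_comm, smul_smul, ← pow_succ]
        rcases i with _ | i
        · simp
        · rw [Nat.add_sub_cancel, ← pow_succ']
    have hE2 : ∀ f ∈ Submodule.span k (Set.range fun i : Fin p => x k p ^ (i : ℕ)),
        f - (E ^ (p - 1)) f = algebraMap k _ (constTerm k p f) := by
      intro f hf
      induction hf using Submodule.span_induction with
      | mem f hf =>
        obtain ⟨i, rfl⟩ := hf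
        dsimp only
        rw [hE1]
        by_cases hi : (i : ℕ) = 0
        · simp [hi, show p - 1 ≠ 0 by omega]
        · have hi' : ((i : ℕ) : k) ≠ 0 := natCast_ne_zero_of_lt k hi i.2
          have h2 : ((i : ℕ) : k) ^ (p - 1) = 1 := by
            have h3 : ((i : ℕ) : k) ^ p = (i : ℕ) := by
              have := map_natCast (frobenius k p) (i : ℕ)
              rwa [frobenius_def] at this
            rw [← mul_left_inj' hi', ← pow_succ, show p - 1 + 1 = p by omega, h3, one_mul]
          rw [h2, one_smul, sub_self, map_pow, constTerm_x, zero_pow hi, map_zero]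
      | zero => simp
      | add f g _ _ hf hg => rw [map_add, map_add, map_add, ← hf, ← hg]; abel
      | smul c f _ hf => rw [map_smul, map_smul, ← smul_sub, hf, smul_eq_mul, map_mul,
          Algebra.smul_def]
    have h2 := S.sub_mem hhS (hE (p - 1))
    rw [hE2 h (mem_span_x_pow h hdh), Algebra.algebraMap_eq_smul_one] at h2
    exact (S.smul_mem_iff hh0).1 h2
  -- `ham y` takes `1` to `x^(p-1)` by the twist term and then differentiates down the powers of
  -- `x`.
  have hx : ∀ n : ℕ, n < p → x k p ^ (p - 1 - n) ∈ S := by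
    intro n
    induction n with
    | zero =>
      intro _
      have h2 := hT 1 (by simp) h1
      rw [map_one, one_smul, Derivation.map_one_eq_zero, sub_zero, xtop_eq_smul] at h2
      exact (S.smul_mem_iff (inv_ne_zero (factorial_ne_zero' k p (by omega)))).1 h2
    | succ n ih =>
      intro hn
      have h2 := hT _ (dy_x_pow _) (ih (by omega))
      rw [map_pow, constTerm_x, zero_pow (by omega), zero_smul, zero_sub, dx_x_pow,
        S.neg_mem_iff, S.smul_mem_iff (natCast_ne_zero_of_lt k (by omega) (by omega))] at h2
      convert h2 using 2
      omega
  have hx1 : x k p ∈ S := by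
    have := hx (p - 2) (by omega)
    rwa [show p - 1 - (p - 2) = 1 by omega, pow_one] at this
  have hm := monomial_mem_of_stable 1 S hS hx1
  have hc : integral k p (x k p ^ (p - 1) * y k p ^ (p - 1)) ≠ 0 := by
    rw [integral_monomial, if_pos ⟨rfl, rfl⟩]
    exact mul_ne_zero (factorial_ne_zero' k p (by omega)) (factorial_ne_zero' k p (by omega))
  set t := x k p ^ (p - 1) * y k p ^ (p - 1) with ht
  set c := integral k p t
  -- `φ` removes the top coefficient and is the identity on functions of integral zero, so it can be
  -- tested on monomials.
  let φ : O k p →ₗ[k] O k p := LinearMap.id - (integral k p).smulRight (c⁻¹ • t)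
  intro f hf
  have h2 := mem_of_monomials (S.comap φ) (fun i j hi hj => by
    rw [Submodule.mem_comap]
    change x k p ^ i * y k p ^ j - integral k p (x k p ^ i * y k p ^ j) • c⁻¹ • t ∈ S
    by_cases h : i + 1 < p ∨ j + 1 < p
    · rw [integral_monomial, if_neg (by omega), zero_smul, sub_zero]
      exact hm i j h hj
    · obtain rfl : i = p - 1 := by omega
      obtain rfl : j = p - 1 := by omega
      rw [← ht, smul_smul, mul_inv_cancel₀ hc, one_smul, sub_self]
      exact S.zero_mem) f
  have h3 : f - integral k p f • c⁻¹ • t ∈ S := h2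
  rwa [LinearMap.mem_ker.1 hf, zero_smul, sub_zero] at h3

end FunctionModules

/-! ### One-forms and the twisted de Rham complex. -/

section OneForms

variable {k : Type*} [Field k] {p : ℕ} [Fact p.Prime] [Fact (5 ≤ p)] [CharP k p]

variable (k p) in
/-- The `1`-form `f ξ + g η`. -/
def form : O k p × O k p →ₗ[k] R k p where
  toFun w := C w.1 * X 0 + C w.2 * X 1
  map_add' v w := by simp; ring
  map_smul' c w := by
    change C (c • w.1) * X 0 + C (c • w.2) * X 1 = c • (C w.1 * X 0 + C w.2 * X 1)
    simp only [Algebra.smul_def, map_mul, MvPolynomial.algebraMap_apply]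
    ring

theorem form_apply (f g : O k p) : form k p (f, g) = C f * X 0 + C g * X 1 := rfl

theorem form_injective : Function.Injective (form k p) := by
  classical
  rw [injective_iff_map_eq_zero]
  rintro ⟨f, g⟩ h
  rw [form_apply] at h
  have h0 := congrArg (coeff (Finsupp.single 0 1)) h
  have h1 := congrArg (coeff (Finsupp.single 1 1)) h
  simp only [coeff_add, coeff_C_mul, coeff_zero] at h0 h1
  have e1 : coeff (Finsupp.single 0 1) (X 1 : R k p) = 0 := by
    rw [coeff_X, if_neg]
    rw [Finsupp.single_left_inj one_ne_zero]; decide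
  have e2 : coeff (Finsupp.single 1 1) (X 0 : R k p) = 0 := by
    rw [coeff_X, if_neg]
    rw [Finsupp.single_left_inj one_ne_zero]; decide
  have e3 (i : Fin 2) : coeff (Finsupp.single i 1) (X i : R k p) = 1 := by
    rw [coeff_X, if_pos rfl]
  rw [e1, e3, mul_one, mul_zero, add_zero] at h0
  rw [e2, e3, mul_one, mul_zero, zero_add] at h1
  rw [h0, h1]
  rfl

variable (k p) in
/-- The action on `1`-forms, twisted by `b` times the divergence. -/
def actF (b : ℕ) (D : W k p) : Module.End k (O k p × O k p) where
  toFun w := (D w.1 + w.1 * dx k p (D (x k p)) + w.2 * dx k p (D (y k p)) + b * (div0 D * w.1),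
      D w.2 + w.1 * dy k p (D (x k p)) + w.2 * dy k p (D (y k p)) + b * (div0 D * w.2))
  map_add' v w := Prod.ext (by simp; ring) (by simp; ring)
  map_smul' c w := Prod.ext (by simp [smul_add]) (by simp [smul_add])

theorem actF_apply (b : ℕ) (D : W k p) (f g : O k p) : actF k p b D (f, g) =
    (D f + f * dx k p (D (x k p)) + g * dx k p (D (y k p)) + b * (div0 D * f),
      D g + f * dy k p (D (x k p)) + g * dy k p (D (y k p)) + b * (div0 D * g)) := rfl

theorem actR_form (b : ℕ) (D : W k p) (w : O k p × O k p) :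
    actR k p b D (form k p w) = form k p (actF k p b D w) := by
  obtain ⟨f, g⟩ := w
  rw [actF_apply, form_apply, form_apply]
  simp only [actR_apply, map_add, Derivation.leibniz, liftD_C, liftD_X_zero,
    liftD_X_one, dd, smul_eq_mul, map_mul, map_natCast]
  ring

/-- `Hhat` preserves, up to scalars, a volume form whose density has logarithmic differential
`x^(p-1) dx`. Twisting by `b` times the divergence is thus compensated by correcting the
differential by `-b x^(p-1) dx`, which is the origin of `dTwist` and `curl`. -/
theorem exists_div0_eq (D : W k p) (hD : D ∈ Hhat k p) :
    ∃ c : k, div0 D = algebraMap k _ c - xtop k p * D (x k p) := by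
  obtain ⟨f, c, rfl⟩ := (mem_Hhat_iff D).1 hD
  refine ⟨c * 2, ?_⟩
  simp only [div0, Derivation.add_apply, Derivation.smul_apply, ham_x, ham_y, euler_x, euler_y,
    map_add, map_neg, Derivation.map_algebraMap, mul_zero, mul_one, dx_x, dy_y, dx_dy_comm, Derivation.leibniz, dy_xtop,
    Algebra.smul_def, map_mul, map_ofNat]
  linear_combination (algebraMap k (O k p) c) * xtop_mul_x (k := k) (p := p)

variable (k p) in
/-- The twisted differential `f ↦ df - b x^(p-1) f dx`. -/
def dTwist (b : ℕ) : O k p →ₗ[k] O k p × O k p where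
  toFun f := (dx k p f - b * (xtop k p * f), dy k p f)
  map_add' f g := Prod.ext (by simp; ring) (by simp)
  map_smul' c f := Prod.ext (by simp [smul_sub]) (by simp)

variable (k p) in
/-- The twisted exterior derivative of `1`-forms. -/
def curl (b : ℕ) : O k p × O k p →ₗ[k] O k p where
  toFun w := dx k p w.2 - dy k p w.1 - b * (xtop k p * w.2)
  map_add' v w := by simp; ring
  map_smul' c w := by simp [smul_sub]

theorem actF_dTwist (b : ℕ) (D : W k p) (hD : D ∈ Hhat k p) (f : O k p) :
    actF k p b D (dTwist k p b f) = dTwist k p b (actO k p b D f) := by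
  obtain ⟨c, hc⟩ := exists_div0_eq D hD
  have hx := congrArg (dx k p) hc
  have hy := congrArg (dy k p) hc
  simp only [map_sub, Derivation.map_algebraMap, Derivation.leibniz, smul_eq_mul, dy_xtop,
    mul_zero, add_zero, zero_sub] at hx hy
  refine Prod.ext ?_ ?_
  · change D (dx k p f - b * (xtop k p * f)) + (dx k p f - b * (xtop k p * f)) * _ +
      dy k p f * _ + b * (div0 D * (dx k p f - b * (xtop k p * f))) = dx k p (actO k p b D f) - b * (xtop k p * actO k p b D f)
    rw [actO_apply, W_apply D f, map_sub, Derivation.leibniz, Derivation.leibniz, W_apply D (dx k p f),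
      W_apply D (xtop k p)]
    simp only [map_add, Derivation.leibniz, smul_eq_mul, hx, dy_xtop, Derivation.map_natCast,
      dx_dy_comm, W_apply D f]
    ring
  · change D (dy k p f) + (dx k p f - b * (xtop k p * f)) * _ + dy k p f * _ +
      b * (div0 D * dy k p f) = dy k p (actO k p b D f)
    rw [actO_apply, W_apply D f, W_apply D (dy k p f)]
    simp only [map_add, Derivation.leibniz, smul_eq_mul, hy, Derivation.map_natCast, dx_dy_comm]
    ring

/-- Two-forms are functions twisted by one further divergence, which accounts for `b + 1`. The terms
in which derivatives fall on `b` times the divergence are cancelled by the correction in `curl`. -/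
theorem curl_actF (b : ℕ) (D : W k p) (hD : D ∈ Hhat k p) (w : O k p × O k p) :
    curl k p b (actF k p b D w) = actO k p (b + 1) D (curl k p b w) := by
  obtain ⟨c, hc⟩ := exists_div0_eq D hD
  have hx := congrArg (dx k p) hc
  have hy := congrArg (dy k p) hc
  simp only [map_sub, Derivation.map_algebraMap, Derivation.leibniz, smul_eq_mul, dy_xtop,
    mul_zero, add_zero, zero_sub] at hx hy
  obtain ⟨f, g⟩ := w
  change dx k p (_ + _) - dy k p (_ + _) - b * (xtop k p * (_ + _)) =
    actO k p (b + 1) D (dx k p g - dy k p f - b * (xtop k p * g))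
  rw [actO_apply, W_apply D f, W_apply D g, W_apply D (_ - _)]
  simp only [map_add, map_sub, Derivation.leibniz, smul_eq_mul, hx, hy, Derivation.map_natCast,
    dx_dy_comm, dy_xtop, Nat.cast_add, Nat.cast_one]
  simp only [div0]
  ring

theorem curl_zero_integral (w : O k p × O k p) : integral k p (curl k p 0 w) = 0 := by
  change integral k p (dx k p w.2 - dy k p w.1 - (0 : ℕ) * (xtop k p * w.2)) = 0
  rw [Nat.cast_zero, zero_mul, sub_zero, map_sub, integral_dx, integral_dy, sub_zero]

theorem integral_mul_top_ne_zero : integral k p (x k p ^ (p - 1) * y k p ^ (p - 1)) ≠ 0 := by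
  have h5 := five_le p
  rw [integral_monomial, if_pos ⟨rfl, rfl⟩]
  exact mul_ne_zero (factorial_ne_zero' k p (by omega)) (factorial_ne_zero' k p (by omega))

/-- Every monomial except the top one is `∂_x` or `∂_y` of a monomial up to a nonzero scalar, and
the integral reads off the top coefficient. -/
theorem exists_curl_zero (f : O k p) (hf : integral k p f = 0) : ∃ w, curl k p 0 w = f := by
  have h5 := five_le p
  have hm : ∀ i j : ℕ, i < p → j < p → (i + 1 < p ∨ j + 1 < p) →
      x k p ^ i * y k p ^ j ∈ LinearMap.range (curl k p 0) := by
    intro i j hi hj h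
    rcases h with h | h
    · refine ⟨((i + 1 : ℕ) : k)⁻¹ • (0, x k p ^ (i + 1) * y k p ^ j), ?_⟩
      rw [map_smul, inv_smul_eq_iff₀ (natCast_ne_zero_of_lt k (by omega) h)]
      change dx k p (x k p ^ (i + 1) * y k p ^ j) - dy k p 0 - (0 : ℕ) * _ = _
      rw [Derivation.leibniz, dx_x_pow, dx_y_pow, Nat.add_sub_cancel]
      simp [Algebra.smul_def]
      ring
    · refine ⟨((j + 1 : ℕ) : k)⁻¹ • (-(x k p ^ i * y k p ^ (j + 1)), 0), ?_⟩
      rw [map_smul, inv_smul_eq_iff₀ (natCast_ne_zero_of_lt k (by omega) h)]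
      change dx k p 0 - dy k p (-(x k p ^ i * y k p ^ (j + 1))) - (0 : ℕ) * _ = _
      rw [map_neg, dy_monomial_succ]
      simp
  set t := x k p ^ (p - 1) * y k p ^ (p - 1) with ht
  have hc : integral k p t ≠ 0 := integral_mul_top_ne_zero
  let φ : O k p →ₗ[k] O k p := LinearMap.id - (integral k p).smulRight ((integral k p t)⁻¹ • t)
  have h2 := mem_of_monomials ((LinearMap.range (curl k p 0)).comap φ) (fun i j hi hj => by
    rw [Submodule.mem_comap]
    change x k p ^ i * y k p ^ j - integral k p (x k p ^ i * y k p ^ j) • (integral k p t)⁻¹ • t ∈ _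
    by_cases h : i + 1 < p ∨ j + 1 < p
    · rw [integral_monomial, if_neg (by omega), zero_smul, sub_zero]
      exact hm i j hi hj h
    · obtain rfl : i = p - 1 := by omega
      obtain rfl : j = p - 1 := by omega
      rw [← ht, smul_smul, mul_inv_cancel₀ hc, one_smul, sub_self]
      exact Submodule.zero_mem _) f
  have h3 : f - integral k p f • (integral k p t)⁻¹ • t ∈ LinearMap.range (curl k p 0) := h2
  rwa [hf, zero_smul, sub_zero] at h3

/-- Cartan's formula for closed forms. -/
theorem actF_of_curl_eq_zero (D : W k p) (w : O k p × O k p) (hw : curl k p 0 w = 0) :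
    actF k p 0 D w = dTwist k p 0 (w.1 * D (x k p) + w.2 * D (y k p)) := by
  obtain ⟨f, g⟩ := w
  change dx k p g - dy k p f - (0 : ℕ) * (xtop k p * g) = 0 at hw
  rw [Nat.cast_zero, zero_mul, sub_zero] at hw
  refine Prod.ext ?_ ?_
  · change D f + f * _ + g * _ + (0 : ℕ) * _ = dx k p (f * D (x k p) + g * D (y k p)) - (0 : ℕ) * _
    rw [W_apply D f]
    simp only [map_add, Derivation.leibniz, smul_eq_mul, Nat.cast_zero]
    linear_combination (-D (y k p)) * hw
  · change D g + f * _ + g * _ + (0 : ℕ) * _ = dy k p (f * D (x k p) + g * D (y k p))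
    rw [W_apply D g]
    simp only [map_add, Derivation.leibniz, smul_eq_mul, Nat.cast_zero]
    linear_combination D (x k p) * hw

theorem actF_ham_x (b : ℕ) (w : O k p × O k p) :
    actF k p b (ham k p (x k p)) w = (dy k p w.1, dy k p w.2) := by
  refine Prod.ext ?_ ?_
  · change ham k p (x k p) w.1 + w.1 * _ + w.2 * _ + b * (div0 (ham k p (x k p)) * w.1) = _
    rw [W_apply (ham k p (x k p))]
    simp [div0, xtop_mul_x]
  · change ham k p (x k p) w.2 + w.1 * _ + w.2 * _ + b * (div0 (ham k p (x k p)) * w.2) = _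
    rw [W_apply (ham k p (x k p))]
    simp [div0, xtop_mul_x]

theorem actF_ham_y (w : O k p × O k p) : actF k p 0 (ham k p (y k p)) w =
    (xtop k p * y k p * dy k p w.1 - dx k p w.1 + w.2 * (dx k p (xtop k p) * y k p),
      xtop k p * y k p * dy k p w.2 - dx k p w.2 + w.2 * xtop k p) := by
  refine Prod.ext ?_ ?_
  · change ham k p (y k p) w.1 + w.1 * _ + w.2 * _ + (0 : ℕ) * (div0 (ham k p (y k p)) * w.1) = _
    rw [W_apply (ham k p (y k p))]
    simp
    ring
  · change ham k p (y k p) w.2 + w.1 * _ + w.2 * _ + (0 : ℕ) * (div0 (ham k p (y k p)) * w.2) = _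
    rw [W_apply (ham k p (y k p))]
    simp
    ring

theorem actF_xdx (w : O k p × O k p) :
    actF k p 0 (xdx k p : W k p) w = (x k p * dx k p w.1 + w.1, x k p * dx k p w.2) := by
  refine Prod.ext ?_ ?_
  · change (x k p • dx k p) w.1 + w.1 * dx k p ((x k p • dx k p) (x k p)) +
      w.2 * dx k p ((x k p • dx k p) (y k p)) + (0 : ℕ) * _ = _
    simp
  · change (x k p • dx k p) w.2 + w.1 * dy k p ((x k p • dx k p) (x k p)) +
      w.2 * dy k p ((x k p • dx k p) (y k p)) + (0 : ℕ) * _ = _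
    simp

theorem actF_ydy (w : O k p × O k p) :
    actF k p 0 (ydy k p : W k p) w = (y k p * dy k p w.1, y k p * dy k p w.2 + w.2) := by
  refine Prod.ext ?_ ?_
  · change (y k p • dy k p) w.1 + w.1 * dx k p ((y k p • dy k p) (x k p)) +
      w.2 * dx k p ((y k p • dy k p) (y k p)) + (0 : ℕ) * _ = _
    simp
  · change (y k p • dy k p) w.2 + w.1 * dy k p ((y k p • dy k p) (x k p)) +
      w.2 * dy k p ((y k p • dy k p) (y k p)) + (0 : ℕ) * _ = _
    simp

theorem x_mul_dx_pow (n : ℕ) : x k p * dx k p (x k p ^ n) = (n : k) • x k p ^ n := by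
  rcases n with _ | n
  · simp
  · rw [dx_x_pow, mul_smul_comm, Nat.add_sub_cancel, ← pow_succ']

theorem y_mul_dy_pow (n : ℕ) : y k p * dy k p (y k p ^ n) = (n : k) • y k p ^ n := by
  rcases n with _ | n
  · simp
  · rw [dy_y_pow, mul_smul_comm, Nat.add_sub_cancel, ← pow_succ']

/-- If the action of `Hhat` takes all `1`-forms into `S`, then `S` contains all `1`-forms. -/
theorem eq_top_of_actF_mem (S : Submodule k (O k p × O k p))
    (h : ∀ D ∈ Hhat k p, ∀ w, actF k p 0 D w ∈ S) : S = ⊤ := by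
  have h5 := five_le p
  have hcast : ∀ n : ℕ, n < p → n ≠ 0 → (n : k) ≠ 0 := fun n hn h0 => natCast_ne_zero_of_lt k h0 hn
  have h1 : ∀ f, (f, 0) ∈ S := fun f =>
    mem_of_monomials (S.comap (LinearMap.inl k _ _)) (fun i j hi hj => by
      rw [Submodule.mem_comap, LinearMap.inl_apply]
      by_cases hj1 : j + 1 < p
      · have := h _ (ham_mem (x k p)) (x k p ^ i * y k p ^ (j + 1), 0)
        rw [actF_ham_x, dy_monomial_succ, map_zero] at this
        have e : (((j + 1 : ℕ) : k) • (x k p ^ i * y k p ^ j), (0 : O k p)) =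
            ((j + 1 : ℕ) : k) • (x k p ^ i * y k p ^ j, (0 : O k p)) := by ext <;> simp
        rw [e] at this
        exact (S.smul_mem_iff (hcast _ hj1 (by omega))).1 this
      -- `∂_y` does not reach the exponent `p - 1`, but here `y∂_y` acts by `j = p - 1 ≠ 0`.
      · have := h _ (ydy k p).2 (x k p ^ i * y k p ^ j, 0)
        rw [actF_ydy, map_zero, Derivation.leibniz, dy_x_pow, smul_zero, add_zero, smul_eq_mul,
          mul_left_comm, y_mul_dy_pow, mul_zero, zero_add] at this
        have e : (x k p ^ i * (j : k) • y k p ^ j, (0 : O k p)) =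
            (j : k) • (x k p ^ i * y k p ^ j, (0 : O k p)) := by ext <;> simp
        rw [e] at this
        exact (S.smul_mem_iff (hcast _ hj (by omega))).1 this) f
  have h2 : ∀ f, (0, f) ∈ S := fun f =>
    mem_of_monomials (S.comap (LinearMap.inr k _ _)) (fun i j hi hj => by
      rw [Submodule.mem_comap, LinearMap.inr_apply]
      by_cases hj1 : j + 1 < p
      · have := h _ (ham_mem (x k p)) (0, x k p ^ i * y k p ^ (j + 1))
        rw [actF_ham_x, dy_monomial_succ, map_zero] at this
        have e : ((0 : O k p), ((j + 1 : ℕ) : k) • (x k p ^ i * y k p ^ j)) =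
            ((j + 1 : ℕ) : k) • ((0 : O k p), x k p ^ i * y k p ^ j) := by ext <;> simp
        rw [e] at this
        exact (S.smul_mem_iff (hcast _ hj1 (by omega))).1 this
      -- On `x^i y^(p-1) η` the operator `y∂_y` has weight `p = 0`, so `x∂_x` is used, with weight
      -- `i`. For `i = 0` this fails too, and `ham y` applied to `x y^(p-1) η` serves instead.
      by_cases hi0 : i = 0
      · subst hi0
        have hy : y k p * y k p ^ j = 0 := by
          rw [← pow_succ', show j + 1 = p by omega, y_pow]
        have := h _ (ham_mem (y k p)) (0, x k p * y k p ^ j)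
        rw [actF_ham_y] at this
        have e : (xtop k p * y k p * dy k p 0 - dx k p 0 +
            x k p * y k p ^ j * (dx k p (xtop k p) * y k p),
            xtop k p * y k p * dy k p (x k p * y k p ^ j) - dx k p (x k p * y k p ^ j) +
            x k p * y k p ^ j * xtop k p) = -((0 : O k p), x k p ^ 0 * y k p ^ j) := by
          refine Prod.ext ?_ ?_
          · simp
            linear_combination x k p * dx k p (xtop k p) * hy
          · simp [Derivation.leibniz (dx k p), Derivation.leibniz (dy k p) (x k p)]
            linear_combination (y k p * (j * y k p ^ (j - 1)) + y k p ^ j) * xtop_mul_x (k := k) (p := p)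
        rw [e] at this
        exact (S.neg_mem_iff).1 this
      · have := h _ (xdx k p).2 (0, x k p ^ i * y k p ^ j)
        rw [actF_xdx, map_zero, Derivation.leibniz, dx_y_pow, smul_zero, zero_add, smul_eq_mul,
          mul_left_comm, x_mul_dx_pow, mul_zero, add_zero] at this
        have e : ((0 : O k p), y k p ^ j * (i : k) • x k p ^ i) =
            (i : k) • ((0 : O k p), x k p ^ i * y k p ^ j) := by ext <;> simp [mul_comm]
        rw [e] at this
        exact (S.smul_mem_iff (hcast _ hi hi0)).1 this) f
  refine eq_top_iff.2 fun w _ => ?_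
  have := S.add_mem (h1 w.1) (h2 w.2)
  simpa using this

/-- The hypotheses say that modulo constants `g` is killed by `x∂_x` and `ham (x²y)` and has weight
`-1` under `y∂_y`. Evaluation at the origin makes two of the constants zero; then `2x (y∂_y g) = x
(x∂_x g) = 0` gives `x g = c x`, and differentiating in `x` gives `g = c`. This excludes maximal
vectors of weight `(0, -1)` in `O / k` and also removes an exact correction in
`oneForms_stable_eq_top`. -/
theorem exists_eq_algebraMap (g : O k p) (h1 : ∃ c, x k p * dx k p g = algebraMap k _ c)
    (h2 : ∃ c, y k p * dy k p g + g = algebraMap k _ c)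
    (h3 : ∃ c, actO k p 0 (ham k p (x k p ^ 2 * y k p)) g = algebraMap k _ c) :
    ∃ c, g = algebraMap k _ c := by
  have h5 := five_le p
  have e3 : actO k p 0 (ham k p (x k p ^ 2 * y k p)) g =
      2 * (x k p * y k p * dy k p g) - x k p ^ 2 * dx k p g := by
    rw [actO_ham]
    simp only [Derivation.leibniz, dy_x_pow, dx_x_pow, dx_y, dy_y, smul_eq_mul,
      Algebra.smul_def, map_natCast]
    simp
    linear_combination (x k p * y k p * dy k p g) * xtop_mul_x (k := k) (p := p)
  rw [e3] at h3
  obtain ⟨c1, h1⟩ := h1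
  obtain ⟨c2, h2⟩ := h2
  obtain ⟨c3, h3⟩ := h3
  have h10 : c1 = 0 := by
    have := congrArg (constTerm k p) h1
    simpa using this.symm
  have h30 : c3 = 0 := by
    have := congrArg (constTerm k p) h3
    simpa using this.symm
  rw [h10, map_zero] at h1
  rw [h30, map_zero] at h3
  have hxg : (2 : k) • (x k p * g - c2 • x k p) = 0 := by
    simp only [Algebra.smul_def, map_ofNat]
    linear_combination 2 * x k p * h2 - h3 - x k p * h1
  have hxg' : x k p * g - c2 • x k p = 0 := (smul_eq_zero.1 hxg).resolve_left (by
    have := natCast_ne_zero_of_lt k (p := p) (n := 2) (by omega) (by omega)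
    exact_mod_cast this)
  have hg0 : g = algebraMap k _ c2 := by
    have h4 := congrArg (dx k p) hxg'
    rw [map_sub, Derivation.leibniz, Derivation.map_smul, dx_x, map_zero, smul_eq_mul,
      smul_eq_mul, mul_one, h1, zero_add, ← Algebra.algebraMap_eq_smul_one, sub_eq_zero] at h4
    exact h4
  exact ⟨c2, hg0⟩

/-- In the module of `1`-forms every submodule containing a form which is not closed is
everything. -/
theorem oneForms_stable_eq_top (S : Submodule k (O k p × O k p))
    (hS : ∀ D ∈ Hhat k p, ∀ w ∈ S, actF k p 0 D w ∈ S) (w₀ : O k p × O k p) (hw₀ : w₀ ∈ S)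
    (hc₀ : curl k p 0 w₀ ≠ 0) : S = ⊤ := by
  have h5 := five_le p
  -- The curls of `S` form a nonzero submodule of the densities, which contains every density of
  -- integral zero, hence every curl. So `S` and the closed forms together span all one-forms.
  have hcl : ∀ w, ∃ v ∈ S, curl k p 0 (w - v) = 0 := by
    intro w
    have h := ker_integral_le_of_stable (S.map (curl k p 0)) (by
      rintro D hD _ ⟨v, hv, rfl⟩
      exact ⟨_, hS D hD v hv, curl_actF 0 D hD v⟩) _ ⟨w₀, hw₀, rfl⟩ hc₀
    obtain ⟨v, hv, e⟩ := h (LinearMap.mem_ker.2 (curl_zero_integral w))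
    exact ⟨v, hv, by rw [map_sub, e, sub_self]⟩
  -- By Cartan's formula `Hhat` maps the closed part of `w` to exact forms.
  have hex : ∀ D ∈ Hhat k p, ∀ w, ∃ v ∈ S, ∃ f, actF k p 0 D w = v + dTwist k p 0 f := by
    intro D hD w
    obtain ⟨v, hv, e⟩ := hcl w
    refine ⟨_, hS D hD v hv, (w - v).1 * D (x k p) + (w - v).2 * D (y k p), ?_⟩
    rw [← actF_of_curl_eq_zero D _ e, map_sub]
    abel
  have hstab : ∀ D ∈ Hhat k p, ∀ f ∈ S.comap (dTwist k p 0),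
      actO k p 0 D f ∈ S.comap (dTwist k p 0) := fun D hD f hf => by
    rw [Submodule.mem_comap, ← actF_dTwist 0 D hD]
    exact hS D hD _ hf
  -- One nonzero exact form in `S` brings all exact forms, by `stable_eq_top`; then `S` contains
  -- everything that `Hhat` produces from one-forms, which is all of them.
  by_cases hg : ∃ g, dTwist k p 0 g ∈ S ∧ ¬ (dx k p g = 0 ∧ dy k p g = 0)
  · obtain ⟨g, hg, hgc⟩ := hg
    have htop := stable_eq_top _ hstab g hg hgc
    refine eq_top_of_actF_mem S fun D hD w => ?_
    obtain ⟨v, hv, f, e⟩ := hex D hD w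
    rw [e]
    exact S.add_mem hv (show f ∈ S.comap (dTwist k p 0) from htop ▸ trivial)
  -- Otherwise `S` contains no nonzero exact form. The form `t ξ` has weights `0` and `-1` under
  -- `x∂_x` and `y∂_y` and is killed by `ham (x²y)`. Since `-t ξ` differs from some `v ∈ S` by an
  -- exact form `dg`, applying these operators to `v` leaves exact forms in `S`, which must vanish;
  -- this forces `g` to be constant and `t ξ ∈ S`.
  · exfalso
    push Not at hg
    have hconst : ∀ g, dTwist k p 0 g ∈ S → ∃ c, g = algebraMap k _ c := fun g h =>
      ⟨_, algebraMap_constTerm_of_const g (by by_contra hx; exact absurd (hg g h) (by tauto))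
        (by by_contra hx; exact absurd (hg g h) (by tauto))⟩
    set t := x k p ^ (p - 1) * y k p ^ (p - 1) with ht
    have hp1 : ((p - 1 : ℕ) : k) = -1 := by
      rw [Nat.cast_sub (by omega), CharP.cast_eq_zero, Nat.cast_one, zero_sub]
    have htx : x k p * dx k p t = -t := by
      rw [ht, Derivation.leibniz, dx_y_pow, smul_zero, zero_add, smul_eq_mul, mul_left_comm,
        x_mul_dx_pow, hp1, neg_one_smul]
      ring
    have hty : y k p * dy k p t = -t := by
      rw [ht, Derivation.leibniz, dy_x_pow, smul_zero, add_zero, smul_eq_mul, mul_left_comm,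
        y_mul_dy_pow, hp1, neg_one_smul]
      ring
    have hxt : x k p * t = 0 := by
      rw [ht, ← mul_assoc, ← pow_succ', show p - 1 + 1 = p by omega, x_pow, zero_mul]
    obtain ⟨v, hv, g, e⟩ := hex _ (ydy k p).2 (t, 0)
    rw [actF_ydy, hty, map_zero, mul_zero, zero_add] at e
    have hv' : v = -(t, 0) - dTwist k p 0 g := by
      rw [eq_sub_iff_add_eq, ← e]; ext <;> simp
    have htS : (t, (0 : O k p)) ∈ S := by
      have h1 : ∃ c, x k p * dx k p g = algebraMap k _ c := by
        have h := hS _ (xdx k p).2 v hv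
        rw [hv', map_sub, map_neg, actF_dTwist 0 _ (xdx k p).2, actF_xdx, actO_xdx] at h
        simp only [htx, neg_add_cancel, map_zero, mul_zero, Nat.cast_zero, zero_mul, add_zero,
          Prod.mk_zero_zero, neg_zero, zero_sub] at h
        exact hconst _ ((S.neg_mem_iff).1 h)
      have h2 : ∃ c, y k p * dy k p g + g = algebraMap k _ c := by
        have h := S.add_mem (hS _ (ydy k p).2 v hv) hv
        rw [hv', map_sub, map_neg, actF_dTwist 0 _ (ydy k p).2, actF_ydy, actO_ydy] at h
        simp only [hty, map_zero, mul_zero, Nat.cast_zero, zero_mul, add_zero] at h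
        have e : -(-t, (0 : O k p)) - dTwist k p 0 (y k p * dy k p g) + (-(t, 0) - dTwist k p 0 g) =
            -dTwist k p 0 (y k p * dy k p g + g) := by
          rw [map_add]
          ext <;> simp <;> ring
        rw [e] at h
        exact hconst _ ((S.neg_mem_iff).1 h)
      have h3 : ∃ c, actO k p 0 (ham k p (x k p ^ 2 * y k p)) g = algebraMap k _ c := by
        have hD := ham_mem (x k p ^ 2 * y k p)
        have h := hS _ hD v hv
        have e1 : actF k p 0 (ham k p (x k p ^ 2 * y k p)) (t, 0) = 0 := by
          have e2 : ham k p (x k p ^ 2 * y k p) t = 0 := by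
            rw [W_apply]
            simp only [ham_x, ham_y, Derivation.leibniz, dy_x_pow, dx_x_pow, dx_y, dy_y,
              smul_eq_mul, Algebra.smul_def, Nat.cast_ofNat, map_ofNat]
            linear_combination (2 * x k p + xtop k p * x k p ^ 2) * hty - x k p * htx - hxt -
              x k p * xtop k p * hxt
          refine Prod.ext ?_ ?_
          · change ham k p (x k p ^ 2 * y k p) t + t * dx k p (ham k p (x k p ^ 2 * y k p) (x k p))
              + 0 * _ + (0 : ℕ) * _ = 0
            rw [e2, ham_x, Derivation.leibniz, dy_x_pow, dy_y, map_neg]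
            simp only [smul_eq_mul, mul_one, mul_zero, add_zero, dx_x_pow, Algebra.smul_def,
              map_ofNat, Nat.cast_zero, Nat.cast_ofNat]
            linear_combination (-2 : O k p) * hxt
          · change ham k p (x k p ^ 2 * y k p) 0 + t * dy k p (ham k p (x k p ^ 2 * y k p) (x k p))
              + 0 * _ + (0 : ℕ) * _ = 0
            rw [map_zero, ham_x, Derivation.leibniz, dy_x_pow, dy_y, map_neg]
            simp
        rw [hv', map_sub, map_neg, e1, actF_dTwist 0 _ hD, neg_zero, zero_sub, S.neg_mem_iff] at h
        exact hconst _ h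
      obtain ⟨c2, hg0⟩ := exists_eq_algebraMap g h1 h2 h3
      have hd0 : dTwist k p 0 g = 0 := by
        rw [hg0]
        refine Prod.ext ?_ ?_
        · change dx k p _ - (0 : ℕ) * _ = 0
          simp
        · change dy k p _ = 0
          simp
      rw [hd0, sub_zero] at hv'
      rw [hv'] at hv
      exact (S.neg_mem_iff).1 hv
    -- Lowering `t ξ` with `∂_y` and then with `ham y` ends at `ξ = dx`, an exact form in `S` whose
    -- primitive `x` is not constant.
    have hyS : ∀ n, n < p → (x k p ^ (p - 1) * y k p ^ (p - 1 - n), (0 : O k p)) ∈ S := by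
      intro n
      induction n with
      | zero => intro _; exact htS
      | succ n ih =>
        intro hn
        have h := hS _ (ham_mem (x k p)) _ (ih (by omega))
        rw [actF_ham_x, show p - 1 - n = p - 1 - (n + 1) + 1 by omega, dy_monomial_succ,
          map_zero] at h
        have e : ∀ (c : k) (f : O k p), (c • f, (0 : O k p)) = c • (f, (0 : O k p)) := by
          intro c f; ext <;> simp
        rw [e] at h
        exact (S.smul_mem_iff (natCast_ne_zero_of_lt k (by omega) (by omega))).1 h
    have hxS : ∀ n, n < p → (x k p ^ (p - 1 - n), (0 : O k p)) ∈ S := by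
      intro n
      induction n with
      | zero =>
        intro _
        have h := hyS (p - 1) (by omega)
        rwa [Nat.sub_self, pow_zero, mul_one] at h
      | succ n ih =>
        intro hn
        have h := hS _ (ham_mem (y k p)) _ (ih (by omega))
        rw [actF_ham_y, dy_x_pow, dx_x_pow] at h
        have e : (xtop k p * y k p * 0 - ((p - 1 - n : ℕ) : k) • x k p ^ (p - 1 - n - 1) +
            0 * (dx k p (xtop k p) * y k p), xtop k p * y k p * dy k p 0 - dx k p 0 +
            0 * xtop k p) = (-((p - 1 - n : ℕ) : k)) •
              (x k p ^ (p - 1 - (n + 1)), (0 : O k p)) := by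
          refine Prod.ext ?_ ?_
          · rw [show p - 1 - n - 1 = p - 1 - (n + 1) by omega]; simp
          · simp
        rw [e] at h
        exact (S.smul_mem_iff (neg_ne_zero.2 (natCast_ne_zero_of_lt k (by omega) (by omega)))).1 h
    have h := hxS (p - 1) (by omega)
    rw [Nat.sub_self, pow_zero] at h
    have hdx : dTwist k p 0 (x k p) = (1, 0) := by
      refine Prod.ext ?_ ?_
      · change dx k p (x k p) - (0 : ℕ) * _ = 1
        simp
      · exact dy_x
    obtain ⟨c, hc⟩ := hconst (x k p) (by rwa [hdx])
    have := congrArg (dx k p) hc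
    simp at this

end OneForms

/-! ### Exactness of the twisted complex for nonzero twist. -/

section Twisted

variable {k : Type*} [Field k] {p : ℕ} [Fact p.Prime] [Fact (5 ≤ p)] [CharP k p]

theorem curl_dTwist (b : ℕ) (f : O k p) : curl k p b (dTwist k p b f) = 0 := by
  change dx k p (dy k p f) - dy k p (dx k p f - b * (xtop k p * f)) -
    b * (xtop k p * dy k p f) = 0
  simp [dx_dy_comm]

/-- A function in the kernel depends on `x` only and satisfies `∂_x f = b f(0) x^(p-1)`. As
`x^(p-1)` is not an `x`-derivative, `f(0) = 0` and `f` is constant. -/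
theorem dTwist_injective (b : ℕ) (hb : (b : k) ≠ 0) : Function.Injective (dTwist k p b) := by
  rw [injective_iff_map_eq_zero]
  intro f hf
  have h1 : dx k p f - b * (xtop k p * f) = 0 := congrArg Prod.fst hf
  have h2 : dy k p f = 0 := congrArg Prod.snd hf
  rw [xtop_mul_of_dy_eq_zero f h2, ← map_natCast (algebraMap k (O k p)), ← Algebra.smul_def,
    smul_smul, sub_eq_zero] at h1
  have h3 := eq_zero_of_dx_eq_smul_xtop h1
  have h4 : constTerm k p f = 0 := (mul_eq_zero.1 h3).resolve_left hb
  rw [h3, zero_smul] at h1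
  rw [algebraMap_constTerm_of_const f h1 h2, h4, map_zero]

/-- `∂_x` misses only the monomials with `x`-exponent `p - 1`, and these come from the term `b
x^(p-1)` applied to `y ^ j`. -/
theorem curl_surjective (b : ℕ) (hb : (b : k) ≠ 0) : Function.Surjective (curl k p b) := by
  intro f
  refine mem_of_monomials (LinearMap.range (curl k p b)) (fun i j hi hj => ?_) f
  have key : ∀ g, curl k p b (0, g) = dx k p g - (b : k) • (xtop k p * g) := fun g => by
    change dx k p g - dy k p 0 - b * (xtop k p * g) = _
    rw [map_zero, sub_zero, Algebra.smul_def, map_natCast]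
  by_cases h : i + 1 < p
  · refine ⟨((i + 1 : ℕ) : k)⁻¹ • (0, x k p ^ (i + 1) * y k p ^ j), ?_⟩
    rw [map_smul, inv_smul_eq_iff₀ (natCast_ne_zero_of_lt k (by omega) h), key, ← mul_assoc,
      xtop_mul_pow (by omega), zero_mul, smul_zero, sub_zero, Derivation.leibniz, dx_x_pow,
      dx_y_pow, smul_zero, zero_add, Nat.add_sub_cancel, smul_eq_mul, mul_smul_comm, mul_comm]
  · obtain rfl : i = p - 1 := by omega
    have hf := factorial_ne_zero' k p (n := p - 1) (by omega)
    refine ⟨(-((p - 1).factorial : k) * (b : k)⁻¹) • (0, y k p ^ j), ?_⟩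
    rw [map_smul, key, dx_y_pow, zero_sub, xtop_eq_smul, smul_mul_assoc, smul_neg, smul_smul,
      smul_smul, ← neg_smul]
    convert one_smul k _
    field_simp

/-- One inclusion is `curl_dTwist`. With injectivity and surjectivity at the ends, the other is the
dimension count `2p² - p² = p²`. -/
theorem range_dTwist (b : ℕ) (hb : (b : k) ≠ 0) :
    LinearMap.range (dTwist k p b) = LinearMap.ker (curl k p b) := by
  refine Submodule.eq_of_le_of_finrank_eq ?_ ?_
  · rintro _ ⟨f, rfl⟩
    exact curl_dTwist b f
  · have h2 := LinearMap.finrank_range_add_finrank_ker (curl k p b)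
    rw [LinearMap.range_eq_top.2 (curl_surjective b hb), finrank_top, Module.finrank_prod] at h2
    rw [LinearMap.finrank_range_of_inj (dTwist_injective b hb)]
    omega

theorem finrank_curl_map (b : ℕ) (hb : (b : k) ≠ 0) (N : Submodule k (O k p × O k p))
    (hN : LinearMap.range (dTwist k p b) ≤ N) :
    Module.finrank k (N.map (curl k p b)) + p ^ 2 = Module.finrank k N := by
  have h3 := LinearMap.finrank_range_add_finrank_ker ((curl k p b).domRestrict N)
  rw [LinearMap.range_domRestrict, LinearMap.ker_domRestrict, ← range_dTwist b hb] at h3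
  rw [← h3, LinearEquiv.finrank_eq (Submodule.comapSubtypeEquivOfLe hN),
    LinearMap.finrank_range_of_inj (dTwist_injective b hb), finrank_O]

end Twisted

/-! ### The operator `ξ∂_η` and multiplication by functions. -/

section HigherDegree

variable {k : Type*} [Field k] {p : ℕ} [Fact p.Prime] [Fact (5 ≤ p)] [CharP k p]

variable (k p) in
/-- The derivation `ξ ∂_η`. -/
def raise : Derivation k (R k p) (R k p) := (X 0 : R k p) • pd k p 1

theorem raise_apply (F : R k p) : raise k p F = X 0 * pd k p 1 F := rfl

variable (k p) in
/-- The derivation `η ∂_η - ξ ∂_ξ`. -/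
def weightDiff : Derivation k (R k p) (R k p) :=
  (X 1 : R k p) • pd k p 1 - (X 0 : R k p) • pd k p 0

theorem weightDiff_apply (F : R k p) : weightDiff k p F = X 1 * pd k p 1 F - X 0 * pd k p 0 F := rfl

theorem liftD_eq (D : W k p) (F : R k p) : liftD D F =
    C (D (x k p)) * coeffDeriv (dx k p) F + C (D (y k p)) * coeffDeriv (dy k p) F +
      (C (dx k p (D (x k p))) * (X 0 * pd k p 0 F) + C (dy k p (D (x k p))) * (X 1 * pd k p 0 F)) +
      (C (dx k p (D (y k p))) * (X 0 * pd k p 1 F) +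
        C (dy k p (D (y k p))) * (X 1 * pd k p 1 F)) := by
  have h : (coeffDeriv D : Derivation k (R k p) (R k p)) =
      (C (D (x k p)) : R k p) • (coeffDeriv (dx k p) : Derivation k (R k p) (R k p)) +
      (C (D (y k p)) : R k p) • (coeffDeriv (dy k p) : Derivation k (R k p) (R k p)) := by
    refine polyDeriv_ext (fun a => ?_) (fun i => by simp)
    rw [coeffDeriv_C, W_apply D a]
    simp
  simp only [liftD, h, dd, Derivation.add_apply, Derivation.smul_apply, smul_eq_mul]
  ring

theorem pd_comm (F : R k p) : pd k p 0 (pd k p 1 F) = pd k p 1 (pd k p 0 F) := by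
  have : ⁅pd k p 0, pd k p 1⁆ = 0 := polyDeriv_ext
    (fun a => by simp [Derivation.commutator_apply])
    (fun i => by fin_cases i <;> simp [Derivation.commutator_apply])
  have h := Derivation.congr_fun this F
  rwa [Derivation.commutator_apply, Derivation.zero_apply, sub_eq_zero] at h

theorem coeffDeriv_pd (D : W k p) (i : Fin 2) (F : R k p) :
    coeffDeriv D (pd k p i F) = pd k p i (coeffDeriv D F) := by
  have : ⁅(coeffDeriv D : Derivation k (R k p) (R k p)), pd k p i⁆ = 0 := polyDeriv_ext
    (fun a => by simp [Derivation.commutator_apply])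
    (fun j => by fin_cases i <;> fin_cases j <;> simp [Derivation.commutator_apply])
  have h := Derivation.congr_fun this F
  rwa [Derivation.commutator_apply, Derivation.zero_apply, sub_eq_zero] at h

theorem coeffDeriv_comm (F : R k p) :
    coeffDeriv (dx k p) (coeffDeriv (dy k p) F) = coeffDeriv (dy k p) (coeffDeriv (dx k p) F) := by
  ext s
  rw [coeff_coeffDeriv, coeff_coeffDeriv, coeff_coeffDeriv, coeff_coeffDeriv, dx_dy_comm]

theorem coeffDeriv_raise (D : W k p) (F : R k p) :
    coeffDeriv D (raise k p F) = raise k p (coeffDeriv D F) := by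
  rw [raise_apply, raise_apply, Derivation.leibniz, coeffDeriv_X, smul_zero, add_zero, smul_eq_mul,
    coeffDeriv_pd]

theorem raise_C_mul (f : O k p) (F : R k p) : raise k p (C f * F) = C f * raise k p F := by
  simp [raise_apply, Derivation.leibniz]

theorem liftD_raise (D : W k p) (F : R k p) : liftD D (raise k p F) = raise k p (liftD D F) +
    C (dx k p (D (x k p)) - dy k p (D (y k p))) * raise k p F +
    C (dy k p (D (x k p))) * weightDiff k p F := by
  have h : ⁅liftD D, raise k p⁆ = (C (dx k p (D (x k p)) - dy k p (D (y k p))) : R k p) • raise k p +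
      (C (dy k p (D (x k p))) : R k p) • weightDiff k p := by
    refine polyDeriv_ext (fun a => ?_) (fun i => ?_)
    · simp [Derivation.commutator_apply, raise_apply, weightDiff_apply]
    · fin_cases i <;>
      simp [Derivation.commutator_apply, raise_apply, weightDiff_apply, dd, Derivation.leibniz] <;>
      ring
  have h2 := Derivation.congr_fun h F
  rw [Derivation.commutator_apply, Derivation.add_apply, Derivation.smul_apply,
    Derivation.smul_apply, smul_eq_mul, smul_eq_mul] at h2
  linear_combination h2

theorem weightDiff_raise (F : R k p) :
    weightDiff k p (raise k p F) = raise k p (weightDiff k p F) - 2 * raise k p F := by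
  simp [raise_apply, weightDiff_apply, Derivation.leibniz, pd_comm]
  ring

theorem liftD_raise_raise (D : W k p) (F : R k p) :
    liftD D (raise k p (raise k p F)) = raise k p (raise k p (liftD D F)) +
      2 * C (dx k p (D (x k p)) - dy k p (D (y k p))) * raise k p (raise k p F) +
      2 * C (dy k p (D (x k p))) * (weightDiff k p (raise k p F) + raise k p F) := by
  rw [liftD_raise D (raise k p F), liftD_raise D F, map_add, map_add, raise_C_mul, raise_C_mul]
  linear_combination (-C (dy k p (D (x k p)))) * weightDiff_raise F

/-- Apart from the action on `F` itself, `b` does not enter: the divergence acts by multiplication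
by a function, which commutes with `ξ∂_η`. The formula computes commutators of `Hhat` with the
operators `f (ξ∂_η)²`. -/
theorem actR_raise_raise (b : ℕ) (D : W k p) (f : O k p) (F : R k p) :
    actR k p b D (C f * raise k p (raise k p F)) =
      C f * raise k p (raise k p (actR k p b D F)) +
      C (D f + 2 * (dx k p (D (x k p)) - dy k p (D (y k p))) * f) * raise k p (raise k p F) +
      2 * C (dy k p (D (x k p)) * f) * (weightDiff k p (raise k p F) + raise k p F) := by
  have e : (b : R k p) = C (b : O k p) := (map_natCast C b).symm
  rw [actR_apply, actR_apply, map_add, map_add, e, raise_C_mul, raise_C_mul, raise_C_mul,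
    raise_C_mul, Derivation.leibniz, liftD_C, liftD_raise_raise]
  simp only [smul_eq_mul, map_add, map_mul, map_ofNat]
  ring

theorem smul_dy_mem (A : O k p) (hA : dy k p A = 0) : A • dy k p ∈ Hhat k p :=
  mem_Hhat_of_divE _ 0 (by simp [divE, hA])

theorem actR_smul_dy (b : ℕ) (A : O k p) (hA : dy k p A = 0) (F : R k p) :
    actR k p b (A • dy k p) F = C A * coeffDeriv (dy k p) F + C (dx k p A) * raise k p F := by
  rw [actR_apply, liftD_eq, div0]
  simp [hA, raise_apply]

section Stable

variable (b : ℕ) (S : Submodule k (R k p)) (hS : ∀ D ∈ Hhat k p, ∀ F ∈ S, actR k p b D F ∈ S)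
include hS

/-- If `A` and `B` are functions of `x`, the operators `(A∂_y)(B∂_y)` and `(AB∂_y)∂_y` have the same
terms differentiating the coefficients of `F`. Their difference is `A'B' (ξ∂_η)²`. -/
theorem deriv_mul_deriv_raise_raise_mem (A B : O k p) (hA : dy k p A = 0) (hB : dy k p B = 0)
    (F : R k p) (hF : F ∈ S) : C (dx k p A * dx k p B) * raise k p (raise k p F) ∈ S := by
  have hAB : dy k p (A * B) = 0 := by rw [Derivation.leibniz, hA, hB, smul_zero, smul_zero, add_zero]
  have h1 := hS _ (smul_dy_mem A hA) _ (hS _ (smul_dy_mem B hB) _ hF)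
  have h2 := hS _ (smul_dy_mem (A * B) hAB) _
    (hS _ (smul_dy_mem 1 (by simp)) _ hF)
  have e : C (dx k p A * dx k p B) * raise k p (raise k p F) =
      actR k p b (A • dy k p) (actR k p b (B • dy k p) F) -
      actR k p b ((A * B) • dy k p) (actR k p b ((1 : O k p) • dy k p) F) := by
    rw [actR_smul_dy _ _ hA, actR_smul_dy _ _ hB, actR_smul_dy _ _ hAB, actR_smul_dy _ _ (by simp)]
    have hB' : dy k p (dx k p B) = 0 := by rw [← dx_dy_comm, hB, map_zero]
    rw [Derivation.leibniz (dx k p) A B, map_add (coeffDeriv (dy k p)),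
      map_add (coeffDeriv (dy k p)), Derivation.leibniz (coeffDeriv (dy k p)),
      Derivation.leibniz (coeffDeriv (dy k p)), Derivation.leibniz (coeffDeriv (dy k p)),
      Derivation.leibniz (coeffDeriv (dy k p))]
    simp only [map_add, coeffDeriv_C, hB, hB', raise_C_mul, coeffDeriv_raise,
      smul_eq_mul, map_mul, Derivation.map_one_eq_zero, map_zero, zero_mul, add_zero, map_one,
      one_mul, mul_zero]
    ring
  rw [e]
  exact S.sub_mem h1 h2

/-- Take the commutator of `ham (xβ)` with `f (ξ∂_η)²` minus that of `ham β` with `x f (ξ∂_η)²`. The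
terms with `∂_x f` and those with `weightDiff` cancel, leaving a multiple of `(ξ∂_η)²`; the
coefficient `-3` is `-4 + 1`. -/
theorem raise_raise_mem_step (β f : O k p) (hβ : dx k p β = 0)
    (h1 : ∀ F ∈ S, C f * raise k p (raise k p F) ∈ S)
    (h2 : ∀ F ∈ S, C (x k p * f) * raise k p (raise k p F) ∈ S) (F : R k p) (hF : F ∈ S) :
    C (β * dy k p f - 3 * (dy k p β * f)) * raise k p (raise k p F) ∈ S := by
  have m1 := ham_mem (x k p * β)
  have m2 := ham_mem β
  have a1 := S.sub_mem (hS _ m1 _ (h1 F hF)) (h1 _ (hS _ m1 _ hF))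
  have a2 := S.sub_mem (hS _ m2 _ (h2 F hF)) (h2 _ (hS _ m2 _ hF))
  have a3 := S.sub_mem a1 a2
  convert a3 using 1
  rw [actR_raise_raise, actR_raise_raise, W_apply (ham k p (x k p * β)) f,
    W_apply (ham k p β) (x k p * f)]
  have hdx : dx k p (dy k p β) = 0 := by rw [dx_dy_comm, hβ, map_zero]
  simp only [ham_x, ham_y, Derivation.leibniz, dx_x, dy_x, hβ, smul_eq_mul, mul_zero, mul_one,
    zero_add, add_zero, map_neg, map_add, map_sub, map_mul, hdx, dy_xtop, neg_zero, map_ofNat,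
    zero_sub]
  generalize raise k p (raise k p F) = G
  ring

/-- The space `K` of admissible multipliers contains the powers of `x` by the product formula, and
`raise_raise_mem_step` then brings in the powers of `y`. The scalars `3` and `8` that occur are
nonzero since `p ≥ 5`. -/
theorem C_mul_raise_raise_mem (f : O k p) (F : R k p) (hF : F ∈ S) :
    C f * raise k p (raise k p F) ∈ S := by
  have h5 := five_le p
  let K : Submodule k (O k p) :=
    { carrier := {f | ∀ F ∈ S, C f * raise k p (raise k p F) ∈ S}
      add_mem' := fun {f g} hf hg F hF => by
        rw [map_add, add_mul]; exact S.add_mem (hf F hF) (hg F hF)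
      zero_mem' := fun F _ => by rw [map_zero, zero_mul]; exact S.zero_mem
      smul_mem' := fun c f hf F hF => by
        have e : (C (c • f) : R k p) = c • C f := by
          rw [Algebra.smul_def, Algebra.smul_def, map_mul, MvPolynomial.algebraMap_apply]
        rw [e, smul_mul_assoc]
        exact S.smul_mem c (hf F hF) }
  have hmul : ∀ f g : O k p, dy k p f = 0 → dy k p g = 0 → dx k p f * dx k p g ∈ K :=
    fun f g hf hg F hF => deriv_mul_deriv_raise_raise_mem b S hS f g hf hg F hF
  have hstep : ∀ β f : O k p, dx k p β = 0 → f ∈ K → x k p * f ∈ K →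
      β * dy k p f - 3 * (dy k p β * f) ∈ K := fun β f hβ h1 h2 F hF =>
    raise_raise_mem_step b S hS β f hβ h1 h2 F hF
  have hx : ∀ i, i < p → x k p ^ i ∈ K := by
    intro i hi
    by_cases h : i + 1 < p
    · have := hmul (x k p) (x k p ^ (i + 1)) (by simp) (by simp)
      rw [dx_x, one_mul, dx_x_pow, Nat.add_sub_cancel] at this
      exact (K.smul_mem_iff (natCast_ne_zero_of_lt k (by omega) h)).1 this
    -- The power `x ^ (p-1)` is not a derivative, but it is a product of two, up to a scalar: `1 +
    -- (p - 2) = p - 1`.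
    · have := hmul (x k p ^ 2) (x k p ^ (p - 1)) (by simp) (by simp)
      rw [dx_x_pow, dx_x_pow, smul_mul_smul_comm, ← pow_add,
        show 2 - 1 + (p - 1 - 1) = i by omega] at this
      exact (K.smul_mem_iff (mul_ne_zero (natCast_ne_zero_of_lt k (by omega) (by omega))
        (natCast_ne_zero_of_lt k (by omega) (by omega)))).1 this
  have hx' : ∀ i, x k p ^ i ∈ K := fun i => by
    by_cases h : i < p
    · exact hx i h
    · rw [show i = p + (i - p) by omega, pow_add, x_pow, zero_mul]; exact K.zero_mem
  have h3 : (3 : k) ≠ 0 := by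
    have := natCast_ne_zero_of_lt k (p := p) (n := 3) (by omega) (by omega)
    exact_mod_cast this
  have h8 : (8 : k) ≠ 0 := by
    have := natCast_ne_zero_of_lt k (p := p) (n := 2) (by omega) (by omega)
    have h : (2 : k) ≠ 0 := by exact_mod_cast this
    rw [show (8 : k) = 2 ^ 3 by norm_num]
    exact pow_ne_zero 3 h
  have hxy : ∀ i j, j + 1 < p → x k p ^ i * y k p ^ j ∈ K := by
    intro i j hj
    have h := hstep (y k p ^ (j + 1)) (x k p ^ i) (by simp) (hx' i) (by
      rw [← pow_succ']; exact hx' _)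
    have e : y k p ^ (j + 1) * dy k p (x k p ^ i) - 3 * (dy k p (y k p ^ (j + 1)) * x k p ^ i) =
        (-3 * ((j + 1 : ℕ) : k)) • (x k p ^ i * y k p ^ j) := by
      rw [dy_x_pow, dy_y_pow, Nat.add_sub_cancel]
      simp only [Algebra.smul_def, map_mul, map_neg, map_ofNat]
      ring
    rw [e] at h
    exact (K.smul_mem_iff (mul_ne_zero (neg_ne_zero.2 h3)
      (natCast_ne_zero_of_lt k (by omega) hj))).1 h
  refine mem_of_monomials K (fun i j hi hj => ?_) f F hF
  by_cases h : j + 1 < p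
  · exact hxy i j h
  · have hp2 : ((p - 2 : ℕ) : k) = -2 := by
      rw [Nat.cast_sub (by omega), CharP.cast_eq_zero, Nat.cast_ofNat, zero_sub]
    -- For the exponent `p - 1` the choice `β = y ^ (j+1)` would be `y ^ p = 0`. With `β = y²` and
    -- `f = x^i y^(p-2)` the coefficient is `(p - 2) - 6 = -8`.
    have h := hstep (y k p ^ 2) (x k p ^ i * y k p ^ (p - 2)) (by simp) (hxy i _ (by omega)) (by
      rw [← mul_assoc, ← pow_succ']; exact hxy _ _ (by omega))
    have e1 : y k p ^ j = y k p ^ 2 * y k p ^ (p - 2 - 1) := by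
      rw [← pow_add]; congr 1; omega
    have e2 : y k p ^ j = y k p * y k p ^ (p - 2) := by
      rw [← pow_succ']; congr 1; omega
    have e : y k p ^ 2 * dy k p (x k p ^ i * y k p ^ (p - 2)) -
        3 * (dy k p (y k p ^ 2) * (x k p ^ i * y k p ^ (p - 2))) =
        (-8 : k) • (x k p ^ i * y k p ^ j) := by
      rw [Derivation.leibniz, dy_x_pow, dy_y_pow, dy_y_pow, hp2]
      simp only [Algebra.smul_def, map_neg, map_ofNat, Algebra.algebraMap_self_apply,
        Nat.cast_ofNat]
      linear_combination (2 * x k p ^ i) * e1 + 6 * x k p ^ i * e2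
    rw [e] at h
    exact (K.smul_mem_iff (neg_ne_zero.2 h8)).1 h

end Stable

end HigherDegree

/-! ### Simplicity of the tensor modules of degree at least two. -/

section Homogeneous

variable {k : Type*} [Field k] {p : ℕ} [Fact p.Prime] [Fact (5 ≤ p)] [CharP k p]

theorem euler_homogeneous {n : ℕ} {F : R k p} (hF : F.IsHomogeneous n) :
    X 0 * pd k p 0 F + X 1 * pd k p 1 F = (n : k) • F := by
  have h := hF.sum_X_mul_pderiv
  rw [Fin.sum_univ_two] at h
  rw [Nat.cast_smul_eq_nsmul]
  exact h

theorem isHomogeneous_raise {n : ℕ} (hn : n ≠ 0) {F : R k p} (hF : F.IsHomogeneous n) :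
    (raise k p F).IsHomogeneous n := by
  have h := (isHomogeneous_X (O k p) (0 : Fin 2)).mul (hF.pderiv (i := 1))
  rwa [show 1 + (n - 1) = n by omega] at h

theorem pd_one_eq_zero_of_raise {F : R k p} (h : raise k p F = 0) : pd k p 1 F = 0 := by
  rw [raise_apply, ← mul_zero (X 0 : R k p)] at h
  exact X_mul_cancel_left_iff.1 h

theorem weightDiff_of_pd_one {n : ℕ} {F : R k p} (hF : F.IsHomogeneous n) (h : pd k p 1 F = 0) :
    weightDiff k p F = -((n : k) • F) := by
  have e := euler_homogeneous hF
  rw [h, mul_zero, add_zero] at e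
  rw [weightDiff_apply, h, mul_zero, zero_sub, e]

/-- The field `ham (y²)` has a constant coefficient `∂_y D(x) = -2`, and on the kernel of `ξ∂_η` the
operator `weightDiff` is the scalar `-n`. If `(ξ∂_η)²` killed `S`, commuting with this field would
give `(1 - n) ξ∂_η F = 0`, and then in the same way `n F = 0`; neither `n` nor `n - 1` vanishes in
`k`. -/
theorem exists_raise_raise_ne_zero (b n : ℕ) (hn : 2 ≤ n) (hnp : n < p) (S : Submodule k (R k p))
    (hS : ∀ D ∈ Hhat k p, ∀ F ∈ S, actR k p b D F ∈ S) (hom : ∀ F ∈ S, F.IsHomogeneous n)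
    (h0 : S ≠ ⊥) : ∃ F ∈ S, raise k p (raise k p F) ≠ 0 := by
  by_contra! h
  have h5 := five_le p
  have h2 : (2 : k) ≠ 0 := by
    have := natCast_ne_zero_of_lt k (p := p) (n := 2) (by omega) (by omega)
    exact_mod_cast this
  have hD := ham_mem (y k p ^ 2)
  have hDx : dy k p (ham k p (y k p ^ 2) (x k p)) = algebraMap k _ (-2) := by
    rw [ham_x, dy_y_pow]
    simp [Algebra.smul_def]
  have hC : ∀ (c : k) (G : R k p), C (algebraMap k (O k p) c) * G = c • G := fun c G => by
    rw [Algebra.smul_def, MvPolynomial.algebraMap_apply]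
  have h1 : ∀ F ∈ S, raise k p F = 0 := by
    intro F hF
    have e := actR_raise_raise b (ham k p (y k p ^ 2)) 1 F
    rw [h F hF, h _ (hS _ hD F hF), hDx, mul_zero, mul_zero, map_zero, zero_add, zero_add,
      mul_one, mul_assoc, hC, weightDiff_of_pd_one (isHomogeneous_raise (by omega) (hom F hF))
        (pd_one_eq_zero_of_raise (h F hF))] at e
    have e' : (2 * (-2) * (1 - n) : k) • raise k p F = 0 := by
      rw [e, mul_smul, mul_smul, sub_smul, one_smul, ← Nat.cast_ofNat (R := k), Nat.cast_smul_eq_nsmul,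
        nsmul_eq_mul, Nat.cast_ofNat]
      congr 2
      abel
    refine (smul_eq_zero.1 e').resolve_left (mul_ne_zero (mul_ne_zero h2 (neg_ne_zero.2 h2)) ?_)
    have := natCast_ne_zero_of_lt k (p := p) (n := n - 1) (by omega) (by omega)
    rw [Nat.cast_sub (by omega), Nat.cast_one] at this
    rw [← neg_sub]
    exact neg_ne_zero.2 this
  apply h0
  rw [eq_bot_iff]
  intro F hF
  have e := liftD_raise (ham k p (y k p ^ 2)) F
  have e1 : raise k p (liftD (ham k p (y k p ^ 2)) F) = 0 := by
    have := h1 _ (hS _ hD F hF)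
    have eb : (b : R k p) = C (b : O k p) := (map_natCast C b).symm
    rw [actR_apply, eb, map_add, raise_C_mul, raise_C_mul, h1 F hF, mul_zero, mul_zero,
      add_zero] at this
    exact this
  rw [h1 F hF, e1, map_zero, mul_zero, zero_add, zero_add, hDx, hC,
    weightDiff_of_pd_one (hom F hF) (pd_one_eq_zero_of_raise (h1 F hF)), smul_neg, neg_smul,
    neg_neg, smul_smul, eq_comm] at e
  exact (smul_eq_zero.1 e).resolve_left
    (mul_ne_zero h2 (natCast_ne_zero_of_lt k (by omega) hnp))

theorem iterate_coeffDeriv_coeff (D : W k p) (m : ℕ) (F : R k p) (s : Fin 2 →₀ ℕ) :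
    coeff s ((coeffDeriv D)^[m] F) = D^[m] (coeff s F) := by
  induction m with
  | zero => rfl
  | succ m ih => rw [Function.iterate_succ_apply', coeff_coeffDeriv, ih,
      Function.iterate_succ_apply']

theorem iterate_raise (m : ℕ) (F : R k p) : (raise k p)^[m] F = X 0 ^ m * (pd k p 1)^[m] F := by
  induction m with
  | zero => simp
  | succ m ih =>
    rw [Function.iterate_succ_apply', ih, Function.iterate_succ_apply', raise_apply,
      Derivation.leibniz, Derivation.leibniz_pow, pd_one_X_zero, smul_zero, smul_zero, smul_zero,
      add_zero, smul_eq_mul, pow_succ']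
    ring

theorem iterate_raise_eq_zero {n : ℕ} {F : R k p} (hF : F.IsHomogeneous n) :
    (raise k p)^[n + 1] F = 0 := by
  have h : ∀ m, ((pd k p 1)^[m] F).IsHomogeneous (n - m) := by
    intro m
    induction m with
    | zero => exact hF
    | succ m ih =>
      rw [Function.iterate_succ_apply', Nat.sub_add_eq]
      exact ih.pderiv
  have h1 := h n
  rw [Nat.sub_self, ← totalDegree_zero_iff_isHomogeneous, totalDegree_eq_zero_iff_eq_C] at h1
  rw [iterate_raise, Function.iterate_succ_apply', h1, pd_C, mul_zero]

/-- A monomial with positive `η`-exponent survives `∂_η` because that exponent is at most `n < p`.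
-/
theorem eq_monomial_of_pd_one {n : ℕ} (hnp : n < p) {F : R k p} (hF : F.IsHomogeneous n)
    (h : pd k p 1 F = 0) : F = C (coeff (Finsupp.single 0 n) F) * X 0 ^ n := by
  have key : ∀ s : Fin 2 →₀ ℕ, s ≠ Finsupp.single 0 n → coeff s F = 0 := by
    intro s hs
    by_contra hc
    have hd := hF hc
    rw [Finsupp.weight_apply, Finsupp.sum_fintype _ _ (by simp), Fin.sum_univ_two] at hd
    simp only [Pi.one_apply, smul_eq_mul, mul_one] at hd
    by_cases h1 : s 1 = 0
    · refine hs (Finsupp.ext fun i => ?_)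
      fin_cases i
      · simpa [h1] using hd
      · simpa using h1
    · have e : s - Finsupp.single 1 1 + Finsupp.single 1 1 = s := by
        refine Finsupp.ext fun i => ?_
        fin_cases i
        · simp
        · simp; omega
      have h2 := congrArg (coeff (s - Finsupp.single 1 1)) h
      rw [pd, Derivation.restrictScalars_apply, coeff_pderiv, e, coeff_zero] at h2
      have e1 : (((s - Finsupp.single 1 1 : Fin 2 →₀ ℕ) 1 : ℕ) : O k p) + 1 =
          algebraMap k _ ((s 1 : ℕ) : k) := by
        rw [map_natCast, ← Nat.cast_add_one]
        congr 1
        simp; omega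
      rw [e1, mul_comm, ← Algebra.smul_def] at h2
      exact hc ((smul_eq_zero.1 h2).resolve_left (natCast_ne_zero_of_lt k h1 (by omega)))
  ext s
  rw [X_pow_eq_monomial, C_mul_monomial, mul_one, coeff_monomial]
  split_ifs with hs
  · rw [hs]
  · exact key s (Ne.symm hs)

section ModuleStable

variable (b : ℕ) (N : Submodule (O k p) (R k p))
  (hN : ∀ D ∈ Hhat k p, ∀ F ∈ N, actR k p b D F ∈ N)
include hN

/-- As `N` is closed under multiplication by functions, the actions of suitable fields can be
stripped term by term. This lemma and the next ones isolate `∂_y`, `ξ∂_η`, `η∂_η`, `∂_x` and `η∂_ξ`.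
-/
theorem coeffDeriv_dy_mem {F : R k p} (hF : F ∈ N) : coeffDeriv (dy k p) F ∈ N := by
  have h := hN _ (smul_dy_mem 1 (by simp)) F hF
  rw [actR_smul_dy _ _ (by simp)] at h
  simpa using h

theorem raise_mem {F : R k p} (hF : F ∈ N) : raise k p F ∈ N := by
  have h := hN _ (smul_dy_mem (x k p) (by simp)) F hF
  rw [actR_smul_dy _ _ (by simp), dx_x, map_one, one_mul, ← smul_eq_C_mul] at h
  exact (N.add_mem_iff_right (N.smul_mem _ (coeffDeriv_dy_mem b N hN hF))).1 h

theorem X_one_mul_pd_one_mem {F : R k p} (hF : F ∈ N) : X 1 * pd k p 1 F ∈ N := by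
  have h := hN _ (ydy k p).2 F hF
  have e : actR k p b (ydy k p : W k p) F =
      y k p • coeffDeriv (dy k p) F + X 1 * pd k p 1 F + (b : O k p) • F := by
    have e1 : (ydy k p : W k p) (x k p) = 0 := by
      change (y k p • dy k p) (x k p) = 0
      simp
    have e2 : (ydy k p : W k p) (y k p) = y k p := by
      change (y k p • dy k p) (y k p) = y k p
      simp
    rw [actR_apply, liftD_eq, div0, e1, e2]
    simp [smul_eq_C_mul]
  rw [e] at h
  have h1 := N.sub_mem (N.sub_mem h (N.smul_mem (b : O k p) hF))
    (N.smul_mem (y k p) (coeffDeriv_dy_mem b N hN hF))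
  convert h1 using 1
  abel

theorem coeffDeriv_dx_mem {F : R k p} (hF : F ∈ N) : coeffDeriv (dx k p) F ∈ N := by
  have h := hN _ (ham_mem (y k p)) F hF
  have e : actR k p b (ham k p (y k p)) F =
      -coeffDeriv (dx k p) F + (xtop k p * y k p) • coeffDeriv (dy k p) F +
        (dx k p (xtop k p) * y k p) • raise k p F + xtop k p • (X 1 * pd k p 1 F) +
        (b * xtop k p) • F := by
    rw [actR_apply, liftD_eq, div0]
    simp [smul_eq_C_mul, raise_apply, Derivation.leibniz]
    ring
  rw [e] at h
  have h1 := N.neg_mem (N.sub_mem (N.sub_mem (N.sub_mem (N.sub_mem h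
    (N.smul_mem (b * xtop k p) hF)) (N.smul_mem (xtop k p) (X_one_mul_pd_one_mem b N hN hF)))
    (N.smul_mem (dx k p (xtop k p) * y k p) (raise_mem b N hN hF)))
    (N.smul_mem (xtop k p * y k p) (coeffDeriv_dy_mem b N hN hF)))
  convert h1 using 1
  abel

theorem X_one_mul_pd_zero_mem {F : R k p} (hF : F ∈ N) : X 1 * pd k p 0 F ∈ N := by
  have h5 := five_le p
  have h := hN _ (ham_mem (y k p ^ 2)) F hF
  have e : actR k p b (ham k p (y k p ^ 2)) F =
      (-2 * y k p) • coeffDeriv (dx k p) F + (xtop k p * y k p ^ 2) • coeffDeriv (dy k p) F -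
        (2 : O k p) • (X 1 * pd k p 0 F) + (dx k p (xtop k p) * y k p ^ 2) • raise k p F +
        (2 * xtop k p * y k p) • (X 1 * pd k p 1 F) + (b * (2 * xtop k p * y k p)) • F := by
    rw [actR_apply, liftD_eq, div0]
    have h2 : ∀ D : W k p, D 2 = 0 := fun D => by simpa using D.map_natCast 2
    simp [smul_eq_C_mul, raise_apply, Derivation.leibniz, h2]
    ring
  rw [e] at h
  have h1 := N.neg_mem (N.sub_mem (N.sub_mem (N.sub_mem (N.sub_mem (N.sub_mem h
    (N.smul_mem (b * (2 * xtop k p * y k p)) hF))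
    (N.smul_mem (2 * xtop k p * y k p) (X_one_mul_pd_one_mem b N hN hF)))
    (N.smul_mem (dx k p (xtop k p) * y k p ^ 2) (raise_mem b N hN hF)))
    (N.smul_mem (xtop k p * y k p ^ 2) (coeffDeriv_dy_mem b N hN hF)))
    (N.smul_mem (-2 * y k p) (coeffDeriv_dx_mem b N hN hF)))
  have h2 : (2 : O k p) • (X 1 * pd k p 0 F) ∈ N := by
    convert h1 using 1
    abel
  have h3 := N.smul_mem (algebraMap k (O k p) (2 : k)⁻¹) h2
  have hk : (2 : k) ≠ 0 := by
    have := natCast_ne_zero_of_lt k (p := p) (n := 2) (by omega) (by omega)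
    exact_mod_cast this
  rw [smul_smul, ← map_ofNat (algebraMap k (O k p)), ← map_mul, inv_mul_cancel₀ hk, map_one,
    one_smul] at h3
  exact h3

/-- Applying the nilpotent operators `∂_x`, `∂_y` and `ξ∂_η` in turn, and stopping each before zero,
leads to a nonzero constant multiple of `ξ ^ n`. The operator `η∂_ξ` then gives all monomials, with
nonzero coefficients since `n < p`, and the `O`-structure gives the rest. -/
theorem homogeneous_mem_of_module_stable {n : ℕ} (hnp : n < p) (hom : ∀ F ∈ N, F.IsHomogeneous n)
    (h0 : N ≠ ⊥) {F : R k p} (hF : F.IsHomogeneous n) : F ∈ N := by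
  obtain ⟨v, hv, hv0⟩ := N.ne_bot_iff.1 h0
  have iter : ∀ (f : R k p → R k p) (P : R k p → Prop), (∀ w, P w → P (f w)) → ∀ w, P w →
      ∀ i, P (f^[i] w) := by
    intro f P hf w hw i
    induction i with
    | zero => exact hw
    | succ i ih => rw [Function.iterate_succ_apply']; exact hf _ ih
  obtain ⟨i, hi0, hi1⟩ := exists_iterate_not_mem (coeffDeriv (dx k p)) {(0 : R k p)} p v hv0 (by
    rw [Set.mem_singleton_iff]
    ext s
    rw [iterate_coeffDeriv_coeff, iterate_dx_eq_zero, coeff_zero])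
  have hi := iter _ (· ∈ N) (fun w hw => coeffDeriv_dx_mem b N hN hw) v hv i
  generalize (coeffDeriv (dx k p))^[i] v = v1 at hi0 hi1 hi
  obtain ⟨j, hj0, hj1⟩ := exists_iterate_not_mem (coeffDeriv (dy k p)) {(0 : R k p)} p v1 hi0 (by
    rw [Set.mem_singleton_iff]
    ext s
    rw [iterate_coeffDeriv_coeff, iterate_dy_eq_zero, coeff_zero])
  have hj := iter _ (fun w => w ∈ N ∧ coeffDeriv (dx k p) w = 0)
    (fun w hw => ⟨coeffDeriv_dy_mem b N hN hw.1, by rw [coeffDeriv_comm, hw.2, map_zero]⟩)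
    v1 ⟨hi, hi1⟩ j
  generalize (coeffDeriv (dy k p))^[j] v1 = v2 at hj0 hj1 hj
  obtain ⟨m, hm0, hm1⟩ := exists_iterate_not_mem (raise k p) {(0 : R k p)} (n + 1) v2 hj0
    (iterate_raise_eq_zero (hom _ hj.1))
  have hm := iter _ (fun w => w ∈ N ∧ coeffDeriv (dx k p) w = 0 ∧ coeffDeriv (dy k p) w = 0)
    (fun w hw => ⟨raise_mem b N hN hw.1, by rw [coeffDeriv_raise, hw.2.1, map_zero],
      by rw [coeffDeriv_raise, hw.2.2, map_zero]⟩) v2 ⟨hj.1, hj.2, hj1⟩ m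
  generalize (raise k p)^[m] v2 = v3 at hm0 hm1 hm
  have e := eq_monomial_of_pd_one hnp (hom _ hm.1) (pd_one_eq_zero_of_raise hm1)
  have hc := algebraMap_constTerm_of_const (coeff (Finsupp.single 0 n) v3)
    (by rw [← coeff_coeffDeriv, hm.2.1, coeff_zero])
    (by rw [← coeff_coeffDeriv, hm.2.2, coeff_zero])
  rw [hc] at e
  generalize constTerm k p (coeff (Finsupp.single 0 n) v3) = c at e
  have hc0 : c ≠ 0 := by
    rintro rfl
    rw [map_zero, map_zero, zero_mul] at e
    exact hm0 e
  have hX : ∀ i ≤ n, (X 0 ^ (n - i) * X 1 ^ i : R k p) ∈ N := by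
    intro i
    induction i with
    | zero =>
      intro _
      have h := N.smul_mem (algebraMap k (O k p) c⁻¹) hm.1
      rw [e, ← smul_eq_C_mul, smul_smul, ← map_mul, inv_mul_cancel₀ hc0, map_one, one_smul] at h
      simpa using h
    | succ i ih =>
      intro hi
      have h := X_one_mul_pd_zero_mem b N hN (ih (by omega))
      obtain ⟨r, hr⟩ : ∃ r, n - i = r + 1 := ⟨n - i - 1, by omega⟩
      have e1 : (X 1 * pd k p 0 (X 0 ^ (r + 1) * X 1 ^ i) : R k p) =
          (algebraMap k (O k p) ((r + 1 : ℕ) : k)) • (X 0 ^ r * X 1 ^ (i + 1)) := by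
        rw [Derivation.leibniz, Derivation.leibniz_pow, Derivation.leibniz_pow, pd_zero_X_one,
          pd_X_self, map_natCast, Nat.add_sub_cancel, smul_eq_C_mul]
        simp
        ring
      rw [hr, e1] at h
      have h2 := N.smul_mem (algebraMap k (O k p) ((r + 1 : ℕ) : k)⁻¹) h
      rw [smul_smul, ← map_mul, inv_mul_cancel₀ (natCast_ne_zero_of_lt k (by omega) (by omega)),
        map_one, one_smul] at h2
      rwa [show n - (i + 1) = r by omega]
  rw [F.as_sum]
  refine N.sum_mem fun s hs => ?_
  have hd := hF (mem_support_iff.1 hs)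
  rw [Finsupp.weight_apply, Finsupp.sum_fintype _ _ (by simp), Fin.sum_univ_two] at hd
  simp only [Pi.one_apply, smul_eq_mul, mul_one] at hd
  rw [monomial_eq, Finsupp.prod_fintype _ _ (by simp), Fin.prod_univ_two, ← smul_eq_C_mul]
  refine N.smul_mem _ ?_
  have := hX (s 1) (by omega)
  rwa [show n - s 1 = s 0 by omega] at this

end ModuleStable

/-- The homogeneous polynomials of degree `n` form a simple module if `2 ≤ n < p`. -/
theorem homogeneous_mem_of_stable (b n : ℕ) (hn : 2 ≤ n) (hnp : n < p) (S : Submodule k (R k p))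
    (hS : ∀ D ∈ Hhat k p, ∀ F ∈ S, actR k p b D F ∈ S) (hom : ∀ F ∈ S, F.IsHomogeneous n)
    (h0 : S ≠ ⊥) {F : R k p} (hF : F.IsHomogeneous n) : F ∈ S := by
  -- `N` is the largest `O`-submodule inside `S`. It is nonzero because it contains `(ξ∂_η)² G` for
  -- every `G ∈ S`.
  let N : Submodule (O k p) (R k p) :=
    { carrier := {v | ∀ f : O k p, C f * v ∈ S}
      add_mem' := fun {v w} hv hw f => by rw [mul_add]; exact S.add_mem (hv f) (hw f)
      zero_mem' := fun f => by rw [mul_zero]; exact S.zero_mem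
      smul_mem' := fun g v hv f => by
        rw [smul_eq_C_mul, ← mul_assoc, ← map_mul]; exact hv _ }
  have hNS : ∀ F ∈ N, F ∈ S := fun F hF => by simpa using hF 1
  obtain ⟨G, hG, hG0⟩ := exists_raise_raise_ne_zero b n hn hnp S hS hom h0
  refine hNS F (homogeneous_mem_of_module_stable b N (fun D hD v hv f => ?_) hnp
    (fun F hF => hom F (hNS F hF)) (N.ne_bot_iff.2 ⟨_, fun f => C_mul_raise_raise_mem b S hS f G hG,
      hG0⟩) hF)
  have e : C f * actR k p b D v = actR k p b D (C f * v) - C (D f) * v := by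
    rw [actR_apply, actR_apply, Derivation.leibniz, liftD_C, smul_eq_mul, smul_eq_mul]
    ring
  rw [e]
  exact S.sub_mem (hS D hD _ (hv f)) (hv (D f))

end Homogeneous

/-! ### The homomorphism from `Z(l)` to the tensor model. -/

section InducedModel

variable {k : Type*} [Field k] {p : ℕ} [Fact p.Prime] [Fact (5 ≤ p)] [CharP k p]

variable (k p) in
/-- The module `O[ξ, η]`, twisted by `b` times the divergence. -/
def Rep (_b : ℕ) : Type _ := R k p

variable {b : ℕ}

instance : AddCommGroup (Rep k p b) := inferInstanceAs (AddCommGroup (R k p))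
instance : Module k (Rep k p b) := inferInstanceAs (Module k (R k p))

variable (k p b) in
/-- The representation of `u(Hhat)` on `O[ξ, η]`. -/
def repHom : U k p →ₐ[k] Module.End k (Rep k p b) :=
  uLift ((actR k p b).comp (Hhat k p).subtype)
    (fun D E => actR_lie b (D : W k p) (E : W k p)) (fun D => (actR_pow b (D : W k p)).symm)

instance : Module (U k p) (Rep k p b) := Module.compHom _ (repHom k p b).toRingHom

theorem u_smul_rep (a : U k p) (F : Rep k p b) : a • F = repHom k p b a F := rfl

instance : IsScalarTower k (U k p) (Rep k p b) where
  smul_assoc c a F := by rw [u_smul_rep, u_smul_rep, map_smul, LinearMap.smul_apply]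

theorem uι_smul_rep (D : Hhat k p) (F : Rep k p b) :
    uι k p D • F = actR k p b (D : W k p) F := by
  rw [u_smul_rep]
  exact LinearMap.congr_fun (uLift_uι _ _ _ D) F

variable (k p) in
/-- `x ^ (p - 1) y ^ (p - 1)` -/
def socle : O k p := x k p ^ (p - 1) * y k p ^ (p - 1)

theorem x_mul_socle : x k p * socle k p = 0 := by
  have := five_le p
  rw [socle, ← mul_assoc, ← pow_succ', show p - 1 + 1 = p by omega, x_pow, zero_mul]

theorem y_mul_socle : y k p * socle k p = 0 := by
  have := five_le p
  rw [socle, mul_left_comm, ← pow_succ', show p - 1 + 1 = p by omega, y_pow, mul_zero]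

theorem mul_socle_of_mem {f : O k p} (hf : f ∈ maxIdeal k p) : f * socle k p = 0 := by
  obtain ⟨a, b, rfl⟩ := Ideal.mem_span_pair.1 hf
  linear_combination a * x_mul_socle (k := k) (p := p) + b * y_mul_socle (k := k) (p := p)

theorem mul_socle (f : O k p) : f * socle k p = algebraMap k _ (constTerm k p f) * socle k p := by
  rw [← sub_eq_zero, ← sub_mul]
  refine mul_socle_of_mem (mem_maxIdeal_of_constTerm _ ?_)
  simp

/-- Differentiate `f * socle = 0`. -/
theorem mul_deriv_socle (D : W k p) {f : O k p} (hf : f ∈ maxIdeal k p) :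
    f * D (socle k p) = -(algebraMap k _ (constTerm k p (D f)) * socle k p) := by
  have h := congrArg D (mul_socle_of_mem hf)
  rw [Derivation.leibniz, map_zero, smul_eq_mul, smul_eq_mul, mul_comm (socle k p), mul_socle] at h
  linear_combination h

/-- The maximal ideal kills the socle, so only the linear part of `D` acts. Differentiating the
socle contributes minus the trace of the linear part, which turns `b` into `b - 1`. -/
theorem actR_socle_mul (b : ℕ) (D : HhatFil k p 0) (P : R k p) (hx : coeffDeriv (dx k p) P = 0)
    (hy : coeffDeriv (dy k p) P = 0) :
    actR k p b ((D : Hhat k p) : W k p) (C (socle k p) * P) = C (socle k p) *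
      (linCoeff k p 0 0 (D : Hhat k p) • (X 0 * pd k p 0 P + ((b : k) - 1) • P) +
      linCoeff k p 1 1 (D : Hhat k p) • (X 1 * pd k p 1 P + ((b : k) - 1) • P) +
      linCoeff k p 1 0 (D : Hhat k p) • raise k p P +
      linCoeff k p 0 1 (D : Hhat k p) • (X 1 * pd k p 0 P)) := by
  obtain ⟨⟨D, hD⟩, hD0⟩ := D
  obtain ⟨h0, h1⟩ := (mem_HhatFil_zero_iff _).1 hD0
  have m0 := mem_maxIdeal_of_constTerm _ h0
  have m1 := mem_maxIdeal_of_constTerm _ h1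
  dsimp only at m0 m1 ⊢
  have e1 : (C (D (x k p) * dx k p (socle k p)) : R k p) = _ :=
    congrArg C (mul_deriv_socle (dx k p) m0)
  have e2 : (C (D (y k p) * dy k p (socle k p)) : R k p) = _ :=
    congrArg C (mul_deriv_socle (dy k p) m1)
  have e3 : ∀ f, (C (f * socle k p) : R k p) = _ := fun f => congrArg C (mul_socle f)
  have f1 := e3 (dx k p (D (x k p)))
  have f2 := e3 (dx k p (D (y k p)))
  have f3 := e3 (dy k p (D (x k p)))
  have f4 := e3 (dy k p (D (y k p)))
  rw [actR_apply, liftD_eq, div0]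
  simp only [Derivation.leibniz, hx, hy, coeffDeriv_C, pd_C,
    smul_eq_mul, Algebra.smul_def, MvPolynomial.algebraMap_apply, map_add, map_sub, map_mul,
    map_neg, map_natCast, map_one, linCoeff, LinearMap.coe_mk, AddHom.coe_mk, raise_apply,
    Matrix.cons_val_zero, Matrix.cons_val_one] at e1 e2 f1 f2 f3 f4 ⊢
  linear_combination P * e1 + P * e2 + (X 0 * pd k p 0 P + b * P) * f1 + X 0 * pd k p 1 P * f2 +
    X 1 * pd k p 0 P * f3 + (X 1 * pd k p 1 P + b * P) * f4

variable (l : ZMod p × ZMod p)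

variable (k) in
/-- The polynomial with constant coefficients attached to a vector of `L_0(l)`. -/
def L0.toPoly : L0 k p l →ₗ[k] R k p where
  -- The factor `n! / (n - j)!` makes `ξ∂_η` carry the image of `m_j` to that of `m_{j+1}` with
  -- coefficient one.
  toFun v := ∑ j ∈ Finset.range ((l.1 - l.2).val + 1),
    (L0.coord v j * ((l.1 - l.2).val.descFactorial j : k)) •
      (X 0 ^ j * X 1 ^ ((l.1 - l.2).val - j))
  map_add' v w := by simp only [L0.coord_add, add_mul, add_smul, Finset.sum_add_distrib]
  map_smul' c v := by
    simp only [L0.coord_smul, mul_assoc, mul_smul, Finset.smul_sum, RingHom.id_apply]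

variable {l}

theorem L0.toPoly_apply (v : L0 k p l) : L0.toPoly k l v =
    ∑ j ∈ Finset.range ((l.1 - l.2).val + 1),
      (L0.coord v j * ((l.1 - l.2).val.descFactorial j : k)) •
        (X 0 ^ j * X 1 ^ ((l.1 - l.2).val - j)) := rfl

theorem coeffDeriv_toPoly (D : W k p) (v : L0 k p l) : coeffDeriv D (L0.toPoly k l v) = 0 := by
  rw [L0.toPoly_apply, map_sum]
  refine Finset.sum_eq_zero fun j _ => ?_
  rw [Derivation.map_smul, Derivation.leibniz, Derivation.leibniz_pow, Derivation.leibniz_pow,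
    coeffDeriv_X, coeffDeriv_X]
  simp

theorem X_mul_pd_pow (i : Fin 2) (j : ℕ) :
    X i * pd k p i (X i ^ j) = (j : k) • (X i ^ j : R k p) := by
  rw [Derivation.leibniz_pow, pd_X_self, Nat.cast_smul_eq_nsmul]
  rcases j with _ | j
  · simp
  · rw [Nat.add_sub_cancel, smul_eq_mul, mul_one, mul_smul_comm, ← pow_succ']

theorem X_zero_mul_pd_toPoly (v : L0 k p l) :
    X 0 * pd k p 0 (L0.toPoly k l v) + (l.2.cast : k) • L0.toPoly k l v =
      L0.toPoly k l (L0.opA v) := by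
  rw [L0.toPoly_apply, L0.toPoly_apply, map_sum, Finset.mul_sum, Finset.smul_sum,
    ← Finset.sum_add_distrib]
  refine Finset.sum_congr rfl fun j _ => ?_
  have h := X_mul_pd_pow (k := k) (p := p) 0 j
  rw [Derivation.map_smul, Derivation.leibniz, Derivation.leibniz_pow _ (X 1 : R k p),
    pd_zero_X_one, smul_zero, smul_zero, smul_zero, zero_add, mul_smul_comm, smul_eq_mul,
    mul_left_comm, h, L0.coord_opA, mul_smul_comm, smul_smul, smul_smul, mul_comm (X 1 ^ _ : R k p),
    ← add_smul]
  congr 1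
  ring

theorem natCast_val_sub : (((l.1 - l.2).val : ℕ) : k) = l.1.cast - l.2.cast := by
  rw [← ZMod.cast_sub (dvd_refl p) l.1 l.2, ZMod.natCast_val]

theorem X_one_mul_pd_toPoly (v : L0 k p l) :
    X 1 * pd k p 1 (L0.toPoly k l v) + (l.2.cast : k) • L0.toPoly k l v =
      L0.toPoly k l (L0.opB v) := by
  rw [L0.toPoly_apply, L0.toPoly_apply, map_sum, Finset.mul_sum, Finset.smul_sum,
    ← Finset.sum_add_distrib]
  refine Finset.sum_congr rfl fun j hj => ?_
  rw [Finset.mem_range] at hj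
  have h := X_mul_pd_pow (k := k) (p := p) 1 ((l.1 - l.2).val - j)
  rw [Derivation.map_smul, Derivation.leibniz, Derivation.leibniz_pow _ (X 0 : R k p),
    pd_one_X_zero, smul_zero, smul_zero, smul_zero, add_zero, mul_smul_comm, smul_eq_mul,
    mul_left_comm, h, L0.coord_opB, mul_smul_comm, smul_smul, smul_smul, ← add_smul,
    Nat.cast_sub (by omega), natCast_val_sub]
  congr 1
  ring

theorem raise_toPoly (v : L0 k p l) :
    raise k p (L0.toPoly k l v) = L0.toPoly k l (L0.opX v) := by
  rw [L0.toPoly_apply, L0.toPoly_apply, map_sum, Finset.sum_range_succ, Finset.sum_range_succ',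
    L0.coord_opX_zero, zero_mul, zero_smul, Nat.sub_self, pow_zero, mul_one, Derivation.map_smul,
    raise_apply (X 0 ^ _), Derivation.leibniz_pow _ (X 0 : R k p), pd_one_X_zero, smul_zero,
    smul_zero, mul_zero, smul_zero]
  congr 1
  refine Finset.sum_congr rfl fun j hj => ?_
  rw [Finset.mem_range] at hj
  obtain ⟨r, hr⟩ : ∃ r, (l.1 - l.2).val - j = r + 1 := ⟨(l.1 - l.2).val - j - 1, by omega⟩
  rw [Derivation.map_smul, raise_apply, Derivation.leibniz, Derivation.leibniz_pow _ (X 0 : R k p),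
    pd_one_X_zero, smul_zero, smul_zero, smul_zero, add_zero, Derivation.leibniz_pow, pd_X_self,
    L0.coord_opX_succ, if_pos hj, Nat.descFactorial_succ, hr,
    show (l.1 - l.2).val - (j + 1) = r by omega, Nat.add_sub_cancel, ← Nat.cast_smul_eq_nsmul k,
    smul_eq_mul, smul_eq_mul, mul_one, mul_smul_comm, mul_smul_comm, smul_smul, Nat.cast_mul,
    pow_succ]
  congr 1
  · ring
  · ring

theorem lower_toPoly (v : L0 k p l) :
    X 1 * pd k p 0 (L0.toPoly k l v) = L0.toPoly k l (L0.opY v) := by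
  rw [L0.toPoly_apply, L0.toPoly_apply, map_sum, Finset.mul_sum, Finset.sum_range_succ',
    Finset.sum_range_succ, L0.coord_opY, L0.coord_of_le v _ le_rfl, mul_zero, zero_mul, zero_smul,
    pow_zero, one_mul, Derivation.map_smul, Derivation.leibniz_pow, pd_zero_X_one, smul_zero,
    smul_zero, smul_zero, mul_zero]
  congr 1
  refine Finset.sum_congr rfl fun j hj => ?_
  rw [Finset.mem_range] at hj
  obtain ⟨r, hr⟩ : ∃ r, (l.1 - l.2).val - j = r + 1 := ⟨(l.1 - l.2).val - j - 1, by omega⟩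
  rw [Derivation.map_smul, Derivation.leibniz, Derivation.leibniz_pow _ (X 1 : R k p),
    pd_zero_X_one, smul_zero, smul_zero, smul_zero, zero_add, Derivation.leibniz_pow, pd_X_self,
    L0.coord_opY, Nat.descFactorial_succ, ← Nat.cast_sub (by omega), hr,
    show (l.1 - l.2).val - (j + 1) = r by omega, Nat.add_sub_cancel, ← Nat.cast_smul_eq_nsmul k,
    smul_eq_mul, smul_eq_mul, mul_one, mul_smul_comm, mul_smul_comm, mul_smul_comm, smul_smul,
    Nat.cast_mul, pow_succ]
  congr 1
  · push_cast; ring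
  · ring

variable (l) in
/-- The twist by which the model of `Z(l)` is formed. -/
def twist : ℕ := (l.2 + 1).val

theorem twist_cast : ((twist l : ℕ) : k) = l.2.cast + 1 := by
  rw [twist, ZMod.natCast_val, ZMod.cast_add (dvd_refl p), ZMod.cast_one (dvd_refl p)]

variable (k l) in
/-- The embedding of `L_0(l)` in the model of `Z(l)`. -/
def socleMap : L0 k p l →ₗ[k] Rep k p (twist l) :=
  (LinearMap.mulLeft k (C (socle k p) : R k p)).comp (L0.toPoly k l)

theorem socleMap_apply (v : L0 k p l) :
    socleMap k l v = (C (socle k p) * L0.toPoly k l v : R k p) := rfl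

/-- The twist is `l.2 + 1` so that after the shift `b - 1` from the socle the scalar is `l.2`, the
weight of `m_0` under `x∂_x`. -/
theorem socleMap_lie (D : HhatFil k p 0) (v : L0 k p l) :
    socleMap k l ⁅D, v⁆ = uι k p (D : Hhat k p) • socleMap k l v := by
  rw [uι_smul_rep, socleMap_apply, socleMap_apply,
    actR_socle_mul _ _ _ (coeffDeriv_toPoly _ v) (coeffDeriv_toPoly _ v), twist_cast,
    add_sub_cancel_right, X_zero_mul_pd_toPoly, X_one_mul_pd_toPoly, raise_toPoly, lower_toPoly]
  change C (socle k p) * L0.toPoly k l (L0.act (D : Hhat k p) v) = _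
  simp only [L0.act, LinearMap.add_apply, LinearMap.smul_apply, map_add, map_smul]
  rfl

variable (k l) in
/-- The homomorphism from `Z(l)` to its model. -/
def zMap : Z k p l →ₗ[U k p] Rep k p (twist l) := indLift (socleMap k l) socleMap_lie

theorem zMap_uι (D : Hhat k p) (z : Z k p l) :
    zMap k l (uι k p D • z) = actR k p (twist l) (D : W k p) (zMap k l z) := by
  rw [map_smul, uι_smul_rep]

/-- Start from the socle. The field `∂_y` lowers the exponent of `y` and leaves the
constant-coefficient factor alone. Then `ham y`, essentially `-∂_x`, lowers the exponent of `x`. -/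
theorem mul_toPoly_mem_range (f : O k p) (v : L0 k p l) :
    ∃ z, zMap k l z = (C f * L0.toPoly k l v : R k p) := by
  have h5 := five_le p
  let S : Submodule k (R k p) :=
    { carrier := {F | ∃ z, zMap k l z = F}
      add_mem' := by
        rintro _ _ ⟨z, rfl⟩ ⟨w, rfl⟩
        exact ⟨z + w, map_add _ _ _⟩
      zero_mem' := ⟨0, map_zero _⟩
      smul_mem' := by
        rintro c _ ⟨z, rfl⟩
        exact ⟨c • z, by rw [← algebraMap_smul (U k p), map_smul, algebraMap_smul]; rfl⟩ }
  have hS : ∀ D ∈ Hhat k p, ∀ F ∈ S, actR k p (twist l) D F ∈ S := by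
    rintro D hD _ ⟨z, rfl⟩
    exact ⟨uι k p ⟨D, hD⟩ • z, zMap_uι ⟨D, hD⟩ z⟩
  change C f * L0.toPoly k l v ∈ S
  have hsm : ∀ (c : k) (f : O k p) (P : R k p), C (c • f) * P = c • (C f * P) := by
    intro c f P
    rw [Algebra.smul_def, Algebra.smul_def, map_mul, MvPolynomial.algebraMap_apply, mul_assoc]
  have htop : ∀ (v : L0 k p l) m, m < p →
      C (x k p ^ (p - 1) * y k p ^ (p - 1 - m)) * L0.toPoly k l v ∈ S := by
    intro v m
    induction m with
    | zero => exact fun _ => ⟨indι _ v, indLift_indι _ _ v⟩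
    | succ m ih =>
      intro hm
      have h := hS _ (smul_dy_mem 1 (by simp)) _ (ih (by omega))
      rw [actR_smul_dy _ _ (by simp), Derivation.leibniz, coeffDeriv_toPoly, smul_zero, zero_add,
        coeffDeriv_C, show p - 1 - m = p - 1 - (m + 1) + 1 by omega, dy_monomial_succ] at h
      simp only [Derivation.map_one_eq_zero, map_zero, zero_mul, add_zero, map_one, one_mul,
        smul_eq_mul, mul_comm (L0.toPoly k l v), hsm] at h
      exact (S.smul_mem_iff (natCast_ne_zero_of_lt k (by omega) (by omega))).1 h
  have htop' : ∀ (v : L0 k p l) j, C (x k p ^ (p - 1) * y k p ^ j) * L0.toPoly k l v ∈ S := by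
    intro v j
    by_cases hj : j < p
    · have := htop v (p - 1 - j) (by omega)
      rwa [show p - 1 - (p - 1 - j) = j by omega] at this
    · rw [show j = p + (j - p) by omega, pow_add, y_pow, zero_mul, mul_zero, map_zero, zero_mul]
      exact S.zero_mem
  have hall : ∀ m, m < p → ∀ (v : L0 k p l) j, j < p →
      C (x k p ^ (p - 1 - m) * y k p ^ j) * L0.toPoly k l v ∈ S := by
    intro m
    induction m with
    | zero => exact fun _ v j hj => htop' v j
    | succ m ih =>
      intro hm v j hj
      obtain ⟨i, hi⟩ : ∃ i, p - 1 - m = i + 1 := ⟨p - 1 - m - 1, by omega⟩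
      have hi' : p - 1 - (m + 1) = i := by omega
      have h := hS _ (ham_mem (y k p)) _ (ih (by omega) v j hj)
      have e : actR k p (twist l) (ham k p (y k p)) (C (x k p ^ (p - 1 - m) * y k p ^ j) *
          L0.toPoly k l v) = -(((i + 1 : ℕ) : k) • (C (x k p ^ i * y k p ^ j) * L0.toPoly k l v)) -
          C (xtop k p * x k p ^ i * y k p ^ (j + 1)) * L0.toPoly k l (L0.opX v) := by
        have e1 : xtop k p * x k p ^ (i + 1) = 0 := xtop_mul_pow (by omega)
        have e2 : dx k p (xtop k p) * x k p ^ (i + 1) = -(xtop k p * x k p ^ i) := by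
          rw [pow_succ']
          linear_combination x k p ^ i * x_mul_dx_xtop (k := k) (p := p)
        have e1' := congrArg (C : O k p → R k p) e1
        have e2' := congrArg (C : O k p → R k p) e2
        rw [pow_succ (y k p) j, hi, actR_apply, liftD_eq, div0, ← raise_toPoly, raise_apply, ← hsm]
        simp only [Derivation.leibniz, coeffDeriv_toPoly, coeffDeriv_C, pd_C, ham_x, ham_y, dx_y,
          dy_y, dy_xtop, map_neg, Derivation.map_one_eq_zero, dx_x_pow, dx_y_pow, dy_x_pow,
          Nat.add_sub_cancel, zero_add, add_zero, smul_eq_mul, mul_zero, mul_one,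
          neg_zero, map_zero, zero_mul, map_mul, map_one, Algebra.smul_def] at e1' e2' ⊢
        linear_combination (C (y k p) * C (dy k p (y k p ^ j)) * L0.toPoly k l v +
          C (y k p ^ j) * (X 1 * pd k p 1 (L0.toPoly k l v)) +
          twist l * C (y k p ^ j) * L0.toPoly k l v) * e1' +
          C (y k p) * C (y k p ^ j) * (X 0 * pd k p 1 (L0.toPoly k l v)) * e2'
      rw [e] at h
      -- The error term of `ham y` survives only for `i = 0`; there it has `x`-exponent `p - 1`, a
      -- case already treated.
      have h2 : C (xtop k p * x k p ^ i * y k p ^ (j + 1)) * L0.toPoly k l (L0.opX v) ∈ S := by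
        by_cases hi0 : i = 0
        · rw [hi0, pow_zero, mul_one, xtop_eq_smul, smul_mul_assoc, hsm]
          exact S.smul_mem _ (htop' _ _)
        · rw [xtop_mul_pow hi0, zero_mul, map_zero, zero_mul]
          exact S.zero_mem
      rw [hi']
      exact (S.smul_mem_iff (natCast_ne_zero_of_lt k (by omega) (by omega))).1
        (S.neg_mem_iff.1 ((S.sub_mem_iff_left h2).1 h))
  refine mem_of_monomials (S.comap ((LinearMap.mulRight k (L0.toPoly k l v)).comp
    ((Algebra.linearMap (O k p) (R k p)).restrictScalars k))) (fun i j hi hj => ?_) f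
  have := hall (p - 1 - i) (by omega) v j hj
  rwa [show p - 1 - (p - 1 - i) = i by omega] at this

end InducedModel

/-! ### Identification of `Z(l)` with functions, one-forms and higher tensors. -/

section ModelEquivalences

variable {k : Type*} [Field k] {p : ℕ} [Fact p.Prime] [Fact (5 ≤ p)] [CharP k p]
  {l : ZMod p × ZMod p}

theorem val_sub_lt : (l.1 - l.2).val < p := ZMod.val_lt _

theorem monomial_mem_range (f : O k p) (i : ℕ) (hi : i ≤ (l.1 - l.2).val) :
    ∃ z, zMap k l z = (C f * (X 0 ^ i * X 1 ^ ((l.1 - l.2).val - i)) : R k p) := by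
  have hd := descFactorial_ne_zero (k := k) (val_sub_lt (l := l)) hi
  obtain ⟨z, hz⟩ := mul_toPoly_mem_range f
    (L0.ofSeq fun j => if j = i then ((l.1 - l.2).val.descFactorial i : k)⁻¹ else 0 : L0 k p l)
  refine ⟨z, hz.trans ?_⟩
  rw [L0.toPoly_apply, Finset.sum_eq_single i]
  · rw [L0.coord_ofSeq, if_pos (by omega), if_pos rfl, inv_mul_cancel₀ hd, one_smul]
  · intro j _ hj
    rw [L0.coord_ofSeq, if_neg hj, ite_self, zero_mul, zero_smul]
  · intro h
    exact absurd (Finset.mem_range.2 (by omega)) h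

instance : Module.Finite k (L0 k p l) := inferInstanceAs (Module.Finite k (Fin _ → k))

theorem finrank_L0 : Module.finrank k (L0 k p l) = (l.1 - l.2).val + 1 :=
  (Module.finrank_fintype_fun_eq_card k).trans (Fintype.card_fin _)

/-- A space of dimension at least that of the module `Z(l)` which embeds in the image of `Z(l)`
in its model is isomorphic to `Z(l)`. -/
theorem exists_equiv {V : Type*} [AddCommGroup V] [Module k V] [Module.Finite k V]
    (j : V →ₗ[k] R k p) (hj : Function.Injective j)
    (hV : Module.finrank k V = p ^ 2 * ((l.1 - l.2).val + 1)) (hr : ∀ v, ∃ z, zMap k l z = j v) :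
    ∃ e : Z k p l ≃ₗ[k] V, ∀ z, j (e z) = zMap k l z := by
  let ζ : Z k p l →ₗ[k] R k p :=
    { toFun := zMap k l
      map_add' := map_add _
      map_smul' := fun c z => by
        rw [← algebraMap_smul (U k p), map_smul, algebraMap_smul]; rfl }
  have hfin : Module.Finite k (Z k p l) := finite_ind _
  have hle : LinearMap.range j ≤ LinearMap.range ζ := by
    rintro _ ⟨v, rfl⟩
    exact hr v
  have h1 := Submodule.finrank_mono hle
  have h2 := finrank_ind_le (k := k) (p := p) (L0 k p l)
  have h3 := LinearMap.finrank_range_add_finrank_ker ζ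
  rw [LinearMap.finrank_range_of_inj hj, hV] at h1
  rw [finrank_L0] at h2
  -- The image of `Z(l)` has dimension at least `dim V = p² dim L_0(l)`, while `Z(l)` has at most
  -- this dimension; so the map is injective and its image is exactly that of `V`.
  have h4 : Module.finrank k (LinearMap.ker ζ) = 0 := by
    change Module.finrank k (LinearMap.range ζ) + _ = Module.finrank k (Ind k p (L0 k p l)) at h3
    omega
  have hζ : Function.Injective ζ := LinearMap.ker_eq_bot.1 (Submodule.finrank_eq_zero.1 h4)
  have he : LinearMap.range ζ = LinearMap.range j := by
    refine (Submodule.eq_of_le_of_finrank_le hle ?_).symm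
    rw [LinearMap.finrank_range_of_inj hj, LinearMap.finrank_range_of_inj hζ, hV]
    exact h2
  refine ⟨(LinearEquiv.ofInjective ζ hζ).trans ((LinearEquiv.ofEq _ _ he).trans
    (LinearEquiv.ofInjective j hj).symm), fun z => ?_⟩
  have := (LinearEquiv.ofInjective j hj).apply_symm_apply
    (LinearEquiv.ofEq _ _ he (LinearEquiv.ofInjective ζ hζ z))
  exact congrArg Subtype.val this

theorem exists_equiv_O (h : (l.1 - l.2).val = 0) : ∃ e : Z k p l ≃ₗ[k] O k p,
    ∀ (D : Hhat k p) z, e (uι k p D • z) = actO k p (twist l) (D : W k p) (e z) := by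
  obtain ⟨e, he⟩ := exists_equiv (l := l) ((Algebra.linearMap (O k p) (R k p)).restrictScalars k)
    C_injective' (by rw [h, finrank_O, zero_add, mul_one]) (fun f => by
      obtain ⟨z, hz⟩ := monomial_mem_range (l := l) f 0 (Nat.zero_le _)
      exact ⟨z, hz.trans (by rw [h]; simp; rfl)⟩)
  refine ⟨e, fun D z => C_injective' ?_⟩
  rw [← actR_C]
  exact (he _).trans ((zMap_uι D z).trans (congrArg (actR k p (twist l) (D : W k p)) (he z).symm))

theorem exists_equiv_forms (h : (l.1 - l.2).val = 1) : ∃ e : Z k p l ≃ₗ[k] O k p × O k p,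
    ∀ (D : Hhat k p) z, e (uι k p D • z) = actF k p (twist l) (D : W k p) (e z) := by
  obtain ⟨e, he⟩ := exists_equiv (l := l) (form k p) form_injective
    (by rw [h, Module.finrank_prod, finrank_O, ← two_mul, mul_comm, one_add_one_eq_two]) (fun w => by
      obtain ⟨z0, hz0⟩ := monomial_mem_range (l := l) w.1 1 h.ge
      obtain ⟨z1, hz1⟩ := monomial_mem_range (l := l) w.2 0 (Nat.zero_le _)
      refine ⟨z0 + z1, (map_add _ _ _).trans ?_⟩
      rw [hz0, hz1, h]
      change (C w.1 * (X 0 ^ 1 * X 1 ^ (1 - 1)) + C w.2 * (X 0 ^ 0 * X 1 ^ (1 - 0)) : R k p) =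
        C w.1 * X 0 + C w.2 * X 1
      simp)
  refine ⟨e, fun D z => form_injective ?_⟩
  rw [← actR_form, he, he, zMap_uι]

theorem finrank_and_simple_of_two_le (h : 2 ≤ (l.1 - l.2).val) :
    Module.finrank k (Z k p l) = p ^ 2 * ((l.1 - l.2).val + 1) ∧
      ∀ N : Submodule (U k p) (Z k p l), N ≠ ⊥ → N = ⊤ := by
  set n := (l.1 - l.2).val with hn
  have hnp : n < p := val_sub_lt
  let j : (Fin (n + 1) → O k p) →ₗ[k] R k p :=
    ∑ i : Fin (n + 1), ((LinearMap.mulRight k (X 0 ^ (i : ℕ) * X 1 ^ (n - i) : R k p)).comp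
      ((Algebra.linearMap (O k p) (R k p)).restrictScalars k)).comp (LinearMap.proj i)
  have hj : ∀ g, j g = ∑ i : Fin (n + 1), C (g i) * (X 0 ^ (i : ℕ) * X 1 ^ (n - i)) := fun g => by
    simp only [j, LinearMap.sum_apply]
    rfl
  have hmon : ∀ (i : ℕ), (X 0 ^ i * X 1 ^ (n - i) : R k p) =
      monomial (Finsupp.single 0 i + Finsupp.single 1 (n - i)) 1 := fun i => by
    rw [X_pow_eq_monomial, X_pow_eq_monomial, monomial_mul, mul_one]
  have hinj : Function.Injective j := by
    rw [injective_iff_map_eq_zero]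
    intro g hg
    funext i
    have h1 := congrArg (coeff (Finsupp.single 0 (i : ℕ) + Finsupp.single 1 (n - i))) hg
    rw [hj, coeff_sum, Finset.sum_eq_single i] at h1
    · rwa [hmon, coeff_C_mul, coeff_monomial, if_pos rfl, mul_one, coeff_zero] at h1
    · intro i' _ hi'
      rw [hmon, coeff_C_mul, coeff_monomial, if_neg, mul_zero]
      intro e
      have := DFunLike.congr_fun e 0
      simp at this
      exact hi' (Fin.ext this)
    · simp
  have hom : ∀ g, (j g).IsHomogeneous n := fun g => by
    rw [hj]
    refine IsHomogeneous.sum _ _ _ fun i _ => ?_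
    have h1 := (isHomogeneous_C (Fin 2) (g i)).mul
      ((isHomogeneous_X_pow (0 : Fin 2) (i : ℕ)).mul (isHomogeneous_X_pow (R := O k p) (1 : Fin 2) (n - i)))
    rwa [zero_add, show (i : ℕ) + (n - i) = n by omega] at h1
  obtain ⟨e, he⟩ := exists_equiv (l := l) j hinj
    (by rw [Module.finrank_pi_fintype]; simp [finrank_O, hn, mul_comm]) (fun g => by
      choose z hz using fun i : Fin (n + 1) => monomial_mem_range (l := l) (g i) i (by omega)
      refine ⟨∑ i, z i, ?_⟩
      rw [map_sum, hj]
      exact Finset.sum_congr rfl fun i _ => hz i)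
  refine ⟨by rw [e.finrank_eq, Module.finrank_pi_fintype]; simp [finrank_O, mul_comm],
    fun N hN => ?_⟩
  let S : Submodule k (R k p) := (N.restrictScalars k).map (j.comp e.toLinearMap)
  have hS : ∀ D ∈ Hhat k p, ∀ F ∈ S, actR k p (twist l) D F ∈ S := by
    rintro D hD _ ⟨z, hz, rfl⟩
    refine ⟨uι k p ⟨D, hD⟩ • z, N.smul_mem _ hz, ?_⟩
    exact (he _).trans ((zMap_uι ⟨D, hD⟩ z).trans
      (congrArg (actR k p (twist l) D) (he z).symm))
  obtain ⟨z0, hz0, hz00⟩ := N.ne_bot_iff.1 hN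
  refine eq_top_iff.2 fun z _ => ?_
  obtain ⟨w, hw, hwz⟩ := homogeneous_mem_of_stable (twist l) n h hnp S hS
    (by rintro _ ⟨z, _, rfl⟩; exact hom _)
    (S.ne_bot_iff.2 ⟨_, ⟨z0, hz0, rfl⟩, fun h0 => hz00
      (e.injective (hinj (h0.trans (by rw [map_zero, map_zero]))))⟩) (hom (e z))
  rwa [← e.injective (hinj hwz)]

end ModelEquivalences

/-! ### The quotients `L(l)` and homomorphisms from `Z(l)`. -/

section Quotients

variable {k : Type*} [Field k] {p : ℕ} [Fact p.Prime] [Fact (5 ≤ p)] [CharP k p]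
  {l : ZMod p × ZMod p}

theorem L_bracket (D : Hhat k p) (v : L k p l) : ⁅D, v⁆ = uι k p D • v := rfl

theorem isRestricted_L : IsRestricted k p (L k p l) := by
  intro D
  have h : ∀ (n : ℕ) (v : L k p l),
      (LieModule.toEnd k (Hhat k p) (L k p l) D ^ n) v = uι k p D ^ n • v := by
    intro n
    induction n with
    | zero => intro v; rw [pow_zero, pow_zero, one_smul]; rfl
    | succ n ih =>
      intro v
      rw [pow_succ, Module.End.mul_apply, ih, LieModule.toEnd_apply_apply, L_bracket, pow_succ,
        mul_smul]
  refine LinearMap.ext fun v => ?_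
  rw [h, uι_pow]
  rfl

theorem le_maxSub {N : Submodule (U k p) (Z k p l)} (h : N ≠ ⊤) : N ≤ maxSub k p l := le_sSup h

theorem maxSub_eq (N : Submodule (U k p) (Z k p l)) (h : N ≠ ⊤)
    (h2 : ∀ N' : Submodule (U k p) (Z k p l), ¬ N' ≤ N → N' = ⊤) : maxSub k p l = N :=
  le_antisymm (sSup_le fun N' hN' => by by_contra h3; exact hN' (h2 N' h3)) (le_maxSub h)

variable (k l) in
/-- The quotient map from `Z(l)` to `L(l)`. -/
def toL : Z k p l →ₗ[U k p] L k p l := (maxSub k p l).mkQ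

theorem toL_surjective : Function.Surjective (toL k l) := (maxSub k p l).mkQ_surjective

theorem toL_eq_zero {z : Z k p l} : toL k l z = 0 ↔ z ∈ maxSub k p l :=
  Submodule.Quotient.mk_eq_zero _

theorem isIrreducible_L (h : maxSub k p l ≠ ⊤) :
    LieModule.IsIrreducible k (Hhat k p) (L k p l) := by
  have hn : Nontrivial (L k p l) := Submodule.Quotient.nontrivial_iff.2 h
  refine LieModule.IsIrreducible.mk fun N hN => ?_
  let N' : Submodule (U k p) (L k p l) := uSubmodule N.toSubmodule fun D v hv => N.lie_mem hv
  by_cases h1 : N'.comap (toL k l) = ⊤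
  · refine eq_top_iff.2 fun v _ => ?_
    obtain ⟨z, rfl⟩ := toL_surjective v
    exact (h1 ▸ trivial : z ∈ N'.comap (toL k l))
  · exfalso
    apply hN
    refine (LieSubmodule.eq_bot_iff _).2 fun v hv => ?_
    obtain ⟨z, rfl⟩ := toL_surjective v
    exact toL_eq_zero.2 (le_maxSub h1 hv)

theorem finrank_L (K : Submodule k (Z k p l)) (hK : ∀ z, z ∈ K ↔ z ∈ maxSub k p l) :
    Module.finrank k (L k p l) + Module.finrank k K = Module.finrank k (Z k p l) := by
  have hfin : Module.Finite k (Z k p l) := finite_ind _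
  have e : K = (maxSub k p l).restrictScalars k := Submodule.ext hK
  rw [e, ← Submodule.finrank_quotient_add_finrank ((maxSub k p l).restrictScalars k)]
  rfl

/-- A simple module which is an image of `Z(l)` is isomorphic to `L(l)`. -/
theorem nonempty_equiv_L {M : Type*} [AddCommGroup M] [Module k M] [LieRingModule (Hhat k p) M]
    [LieModule k (Hhat k p) M] [LieModule.IsIrreducible k (Hhat k p) M] (hmax : maxSub k p l ≠ ⊤)
    (g : Z k p l →ₗ[k] M) (hg : ∀ (D : Hhat k p) z, g (uι k p D • z) = ⁅D, g z⁆) (hg0 : g ≠ 0) :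
    Nonempty (M ≃ₗ⁅k, Hhat k p⁆ L k p l) := by
  have himage : ∀ N : Submodule (U k p) (Z k p l),
      (∀ z ∈ N, g z = 0) ∨ ∀ m, ∃ z ∈ N, g z = m := by
    intro N
    let N' : LieSubmodule k (Hhat k p) M :=
      { (N.restrictScalars k).map g with
        lie_mem := by
          rintro D _ ⟨z, hz, rfl⟩
          exact ⟨_, N.smul_mem _ hz, hg D z⟩ }
    by_cases h : N' = ⊥
    · left
      intro z hz
      have : g z ∈ N' := ⟨z, hz, rfl⟩
      rwa [h, LieSubmodule.mem_bot] at this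
    · right
      intro m
      have : m ∈ N' := by rw [(eq_bot_or_eq_top N').resolve_left h]; trivial
      exact this
  have hsurj : Function.Surjective g := fun m => by
    rcases himage ⊤ with h | h
    · exact absurd (LinearMap.ext fun z => h z trivial) hg0
    · obtain ⟨z, _, hz⟩ := h m
      exact ⟨z, hz⟩
  let K : Submodule (U k p) (Z k p l) := uSubmodule (LinearMap.ker g) fun D z hz => by
    rw [LinearMap.mem_ker] at hz ⊢
    rw [hg, hz, lie_zero]
  have hK : K ≠ ⊤ := fun h => hg0 (LinearMap.ext fun z => (h ▸ trivial : z ∈ K))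
  have hker : ∀ z, z ∈ maxSub k p l ↔ g z = 0 := by
    intro z
    refine ⟨fun hz => ?_, fun hz => le_maxSub hK hz⟩
    rcases himage (maxSub k p l) with h | h
    · exact h z hz
    -- If `maxSub` mapped onto `M`, every vector would be a sum of one in the kernel of `g` and one
    -- in `maxSub`. The kernel is proper, hence inside `maxSub`, which would then be everything.
    · refine absurd (eq_top_iff.2 fun w _ => ?_) hmax
      obtain ⟨w', hw', e⟩ := h (g w)
      have hd : w - w' ∈ K := by
        change g (w - w') = 0
        rw [map_sub, e, sub_self]
      have := (maxSub k p l).add_mem (le_maxSub hK hd) hw'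
      rwa [sub_add_cancel] at this
  let q : Z k p l →ₗ[k] L k p l := (toL k l).restrictScalars k
  have hq : LinearMap.ker q = LinearMap.ker g := Submodule.ext fun z =>
    toL_eq_zero.trans ((hker z).trans LinearMap.mem_ker.symm)
  let e : M ≃ₗ[k] L k p l := (g.quotKerEquivOfSurjective hsurj).symm.trans
    ((Submodule.quotEquivOfEq _ _ hq.symm).trans (q.quotKerEquivOfSurjective toL_surjective))
  have he : ∀ z, e (g z) = toL k l z := by
    intro z
    have h1 : (g.quotKerEquivOfSurjective hsurj).symm (g z) = Submodule.Quotient.mk z := by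
      rw [LinearEquiv.symm_apply_eq]
      rfl
    change q.quotKerEquivOfSurjective toL_surjective (Submodule.quotEquivOfEq _ _ hq.symm
      ((g.quotKerEquivOfSurjective hsurj).symm (g z))) = _
    rw [h1]
    rfl
  exact ⟨{ e with
    map_lie' := by
      intro D m
      obtain ⟨z, rfl⟩ := hsurj m
      change e ⁅D, g z⁆ = ⁅D, e (g z)⁆
      rw [← hg, he, he, L_bracket, map_smul] }⟩

end Quotients

/-! ### The modules `L(-1, -1)` and `L(0, -1)`. -/

section SimpleQuotients

variable {k : Type*} [Field k] {p : ℕ} [Fact p.Prime] [Fact (5 ≤ p)] [CharP k p]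

theorem mem_span_one_iff (f : O k p) :
    f ∈ Submodule.span k {(1 : O k p)} ↔ ∃ c, f = algebraMap k _ c := by
  rw [Submodule.mem_span_singleton]
  exact exists_congr fun c => by rw [Algebra.algebraMap_eq_smul_one, eq_comm]

theorem not_exists_x_eq : ¬ ∃ c, x k p = algebraMap k _ c := by
  rintro ⟨c, hc⟩
  have := congrArg (dx k p) hc
  simp at this

theorem actO_algebraMap (D : W k p) (c : k) : actO k p 0 D (algebraMap k _ c) = 0 := by
  simp [actO_apply]

variable (k p) in
/-- `Z(-1, -1)` is the module of functions, and its maximal submodule consists of the constants. -/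
theorem exists_equiv_neg_one : ∃ e : Z k p (-1, -1) ≃ₗ[k] O k p,
    (∀ (D : Hhat k p) z, e (uι k p D • z) = actO k p 0 (D : W k p) (e z)) ∧
    ∀ z, z ∈ maxSub k p (-1, -1) ↔ ∃ c, e z = algebraMap k _ c := by
  obtain ⟨e, he⟩ := exists_equiv_O (k := k) (p := p) (l := (-1, -1)) (by simp)
  have ht : twist ((-1, -1) : ZMod p × ZMod p) = 0 := by simp [twist]
  rw [ht] at he
  refine ⟨e, he, ?_⟩
  let N : Submodule (U k p) (Z k p (-1, -1)) :=
    uSubmodule ((Submodule.span k {(1 : O k p)}).comap e.toLinearMap) fun D z hz => by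
      obtain ⟨c, hc⟩ := (mem_span_one_iff _).1 hz
      refine (mem_span_one_iff _).2 ⟨0, ?_⟩
      rw [map_zero]
      exact (he D z).trans (by rw [show e z = _ from hc, actO_algebraMap])
  have hN : maxSub k p (-1, -1) = N := by
    refine maxSub_eq N (fun h => ?_) fun N' hN' => ?_
    · have h1 : e.symm (x k p) ∈ N := h ▸ trivial
      obtain ⟨c, hc⟩ := (mem_span_one_iff _).1 h1
      exact not_exists_x_eq ⟨c, (e.apply_symm_apply _).symm.trans hc⟩
    · obtain ⟨z, hz, hzN⟩ := SetLike.not_le_iff_exists.1 hN'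
      have htop := stable_eq_top ((N'.restrictScalars k).map e.toLinearMap) (by
        rintro D hD _ ⟨w, hw, rfl⟩
        exact ⟨_, N'.smul_mem (uι k p ⟨D, hD⟩) hw, he ⟨D, hD⟩ w⟩) (e z) ⟨z, hz, rfl⟩
        fun h => hzN ((mem_span_one_iff _).2 ⟨_, algebraMap_constTerm_of_const _ h.1 h.2⟩)
      refine eq_top_iff.2 fun w _ => ?_
      obtain ⟨w', hw', e'⟩ := (htop ▸ trivial : e w ∈ (N'.restrictScalars k).map e.toLinearMap)
      rwa [← e.injective e']
  intro z
  rw [hN]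
  exact mem_span_one_iff _

theorem finrank_ker_integral : Module.finrank k (LinearMap.ker (integral k p)) + 1 = p ^ 2 := by
  have h := LinearMap.finrank_range_add_finrank_ker (integral k p)
  rw [LinearMap.range_eq_top.2 (LinearMap.surjective fun h0 => integral_mul_top_ne_zero (k := k)
    (p := p) (by rw [h0, LinearMap.zero_apply])), finrank_top, Module.finrank_self, finrank_O] at h
  omega

theorem range_curl_zero : LinearMap.range (curl k p 0) = LinearMap.ker (integral k p) := by
  ext f
  constructor
  · rintro ⟨w, rfl⟩
    exact curl_zero_integral w
  · exact exists_curl_zero f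

variable (p) in
theorem val_zero_sub_neg_one : (((0, -1) : ZMod p × ZMod p).1 - ((0, -1) : ZMod p × ZMod p).2).val
    = 1 := by
  have : Fact (1 < p) := ⟨(Fact.out : p.Prime).one_lt⟩
  simp [ZMod.val_one]

variable (k p) in
/-- `Z(0, -1)` is the module of `1`-forms, and its maximal submodule consists of the closed
forms. -/
theorem exists_equiv_zero_neg_one : ∃ e : Z k p (0, -1) ≃ₗ[k] O k p × O k p,
    (∀ (D : Hhat k p) z, e (uι k p D • z) = actF k p 0 (D : W k p) (e z)) ∧
    ∀ z, z ∈ maxSub k p (0, -1) ↔ curl k p 0 (e z) = 0 := by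
  have h5 := five_le p
  obtain ⟨e, he⟩ := exists_equiv_forms (k := k) (val_zero_sub_neg_one p)
  have ht : twist ((0, -1) : ZMod p × ZMod p) = 0 := by simp [twist]
  rw [ht] at he
  refine ⟨e, he, ?_⟩
  let N : Submodule (U k p) (Z k p (0, -1)) :=
    uSubmodule ((LinearMap.ker (curl k p 0)).comap e.toLinearMap) fun D z hz => by
      change curl k p 0 (e _) = 0
      rw [he, curl_actF _ _ D.2, show curl k p 0 (e z) = 0 from hz, map_zero]
  have hN : maxSub k p (0, -1) = N := by
    refine maxSub_eq N (fun h => ?_) fun N' hN' => ?_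
    · obtain ⟨w, hw⟩ := exists_curl_zero (1 : O k p) (by
        have := integral_monomial (k := k) (p := p) 0 0
        rwa [pow_zero, pow_zero, mul_one, if_neg (by omega)] at this)
      have h1 : e.symm w ∈ N := h ▸ trivial
      have h2 : curl k p 0 (e (e.symm w)) = 0 := h1
      rw [e.apply_symm_apply, hw] at h2
      exact one_ne_zero h2
    · obtain ⟨z, hz, hzN⟩ := SetLike.not_le_iff_exists.1 hN'
      have htop := oneForms_stable_eq_top ((N'.restrictScalars k).map e.toLinearMap) (by
        rintro D hD _ ⟨w, hw, rfl⟩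
        exact ⟨_, N'.smul_mem (uι k p ⟨D, hD⟩) hw, he ⟨D, hD⟩ w⟩) (e z) ⟨z, hz, rfl⟩ hzN
      refine eq_top_iff.2 fun w _ => ?_
      obtain ⟨w', hw', e'⟩ := (htop ▸ trivial : e w ∈ (N'.restrictScalars k).map e.toLinearMap)
      rwa [← e.injective e']
  intro z
  rw [hN]
  exact Iff.rfl

variable (k p) in
theorem maxSub_neg_one_ne_top : maxSub k p (-1, -1) ≠ ⊤ := by
  obtain ⟨e, _, h⟩ := exists_equiv_neg_one k p
  intro h1
  have := (h (e.symm (x k p))).1 (h1 ▸ trivial)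
  rw [e.apply_symm_apply] at this
  exact not_exists_x_eq this

variable (k p) in
theorem finrank_L_neg_one : Module.finrank k (L k p (-1, -1)) = p ^ 2 - 1 := by
  obtain ⟨e, _, h⟩ := exists_equiv_neg_one k p
  have h1 := finrank_L ((Submodule.span k {(1 : O k p)}).map e.symm.toLinearMap) fun z => by
    rw [h, ← mem_span_one_iff]
    constructor
    · rintro ⟨w, hw, rfl⟩
      change e (e.symm w) ∈ _
      rwa [e.apply_symm_apply]
    · exact fun hz => ⟨e z, hz, e.symm_apply_apply z⟩
  rw [e.finrank_eq, finrank_O, LinearEquiv.finrank_map_eq, finrank_span_singleton one_ne_zero] at h1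
  omega

variable (k p) in
theorem maxSub_zero_neg_one_ne_top : maxSub k p (0, -1) ≠ ⊤ := by
  have h5 := five_le p
  obtain ⟨e, _, h⟩ := exists_equiv_zero_neg_one k p
  intro h1
  obtain ⟨w, hw⟩ := exists_curl_zero (1 : O k p) (by
    have := integral_monomial (k := k) (p := p) 0 0
    rwa [pow_zero, pow_zero, mul_one, if_neg (by omega)] at this)
  have := (h (e.symm w)).1 (h1 ▸ trivial)
  rw [e.apply_symm_apply, hw] at this
  exact one_ne_zero this

variable (k p) in
-- One-forms modulo closed forms are the curls, which are the functions of integral zero: a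
-- hyperplane in `O`.
theorem finrank_L_zero_neg_one : Module.finrank k (L k p (0, -1)) = p ^ 2 - 1 := by
  obtain ⟨e, _, h⟩ := exists_equiv_zero_neg_one k p
  have h1 := finrank_L ((LinearMap.ker (curl k p 0)).map e.symm.toLinearMap) fun z => by
    rw [h]
    constructor
    · rintro ⟨w, hw, rfl⟩
      change curl k p 0 (e (e.symm w)) = 0
      rwa [e.apply_symm_apply]
    · exact fun hz => ⟨e z, hz, e.symm_apply_apply z⟩
  have h2 := LinearMap.finrank_range_add_finrank_ker (curl k p 0)
  have h3 := finrank_ker_integral (k := k) (p := p)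
  rw [e.finrank_eq, LinearEquiv.finrank_map_eq, ← h2, range_curl_zero] at h1
  omega

/-! ### Maximal vectors of weight `(0, -1)`. -/

section MaximalVectors

theorem mem_HhatFil_one_iff (D : Hhat k p) : D ∈ HhatFil k p 1 ↔
    (D : W k p) (x k p) ∈ maxIdeal k p ^ 2 ∧ (D : W k p) (y k p) ∈ maxIdeal k p ^ 2 := Iff.rfl

theorem hamH_mem_HhatFil_one : hamH k p (x k p ^ 2 * y k p) ∈ HhatFil k p 1 := by
  rw [mem_HhatFil_one_iff, coe_hamH, ham_x, ham_y, Derivation.leibniz, Derivation.leibniz,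
    ← mul_assoc (xtop k p), xtop_mul_pow two_ne_zero, dx_y, dy_y, dx_x_pow, dy_x_pow, smul_zero,
    smul_zero, zero_mul, zero_add, add_zero, add_zero, pow_one, smul_eq_mul, smul_eq_mul, mul_one,
    mul_smul_comm]
  exact ⟨Ideal.neg_mem_iff _ |>.2 (Ideal.pow_mem_pow x_mem_maxIdeal 2),
    Submodule.smul_of_tower_mem _ _ (by
      rw [pow_two]; exact Ideal.mul_mem_mul y_mem_maxIdeal x_mem_maxIdeal)⟩

/-- In `O / k` the two weight conditions and the single element `ham (x²y)` of `Hhat_(1)` already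
force a representative to be constant. -/
theorem not_isMaximalVector_neg_one (v : L k p (-1, -1)) : ¬ IsMaximalVector k p (0, -1) v := by
  rintro ⟨h0, h1, h2, h3⟩
  obtain ⟨e, he, hm⟩ := exists_equiv_neg_one k p
  obtain ⟨z, rfl⟩ := toL_surjective v
  rw [L_bracket, ← map_smul, zero_smul, toL_eq_zero, hm, he, actO_xdx] at h1
  rw [L_bracket, ← map_smul, neg_smul, one_smul, ← map_neg, ← sub_eq_zero, ← map_sub,
    sub_neg_eq_add, toL_eq_zero, hm, map_add, he, actO_ydy] at h2
  have h3 := h3 _ (Submodule.mem_sup_left hamH_mem_HhatFil_one)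
  rw [L_bracket, ← map_smul, toL_eq_zero, hm, he] at h3
  rw [Nat.cast_zero, zero_mul, add_zero] at h1 h2
  exact h0 (toL_eq_zero.2 ((hm z).2 (exists_eq_algebraMap (e z) h1 h2 h3)))

theorem linCoeff_xdx : linCoeff k p 0 0 (xdx k p) = 1 ∧ linCoeff k p 1 1 (xdx k p) = 0 ∧
    linCoeff k p 1 0 (xdx k p) = 0 ∧ linCoeff k p 0 1 (xdx k p) = 0 := by
  simp [linCoeff, xdx]

theorem linCoeff_ydy : linCoeff k p 0 0 (ydy k p) = 0 ∧ linCoeff k p 1 1 (ydy k p) = 1 ∧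
    linCoeff k p 1 0 (ydy k p) = 0 ∧ linCoeff k p 0 1 (ydy k p) = 0 := by
  simp [linCoeff, ydy]

theorem linCoeff_xdy : linCoeff k p 0 0 (xdy k p) = 0 ∧ linCoeff k p 1 1 (xdy k p) = 0 ∧
    linCoeff k p 1 0 (xdy k p) = 1 ∧ linCoeff k p 0 1 (xdy k p) = 0 := by
  simp [linCoeff, xdy]

variable (k p) in
/-- A vector field in `Hhat` whose linear part is `y ∂_x`. -/
def ydxH : Hhat k p := (-(2 : k)⁻¹) • hamH k p (y k p ^ 2)

theorem two_ne_zero_of_five_le (k : Type*) [Field k] (p : ℕ) [Fact p.Prime] [Fact (5 ≤ p)]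
    [CharP k p] : (2 : k) ≠ 0 := by
  have h5 := five_le p
  have := natCast_ne_zero_of_lt k (p := p) (n := 2) (by omega) (by omega)
  exact_mod_cast this

theorem coe_ydxH_x : (ydxH k p : W k p) (x k p) = y k p := by
  change (-(2 : k)⁻¹) • ham k p (y k p ^ 2) (x k p) = _
  rw [ham_x, dy_y_pow, pow_one, smul_neg, neg_smul, neg_neg, smul_smul, Nat.cast_ofNat,
    inv_mul_cancel₀ (two_ne_zero_of_five_le k p), one_smul]

theorem coe_ydxH_y : (ydxH k p : W k p) (y k p) = (-(2 : k)⁻¹) • (xtop k p * y k p ^ 2) := by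
  change (-(2 : k)⁻¹) • ham k p (y k p ^ 2) (y k p) = _
  rw [ham_y, dx_y_pow, zero_add]

theorem linCoeff_ydxH : linCoeff k p 0 0 (ydxH k p) = 0 ∧ linCoeff k p 1 1 (ydxH k p) = 0 ∧
    linCoeff k p 1 0 (ydxH k p) = 0 ∧ linCoeff k p 0 1 (ydxH k p) = 1 := by
  simp [linCoeff, coe_ydxH_x, coe_ydxH_y, Derivation.leibniz]

theorem constTerm_deriv_of_mem_sq {f : O k p} (hf : f ∈ maxIdeal k p ^ 2) (D : W k p) :
    constTerm k p (D f) = 0 := by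
  have h := deriv_mem_maxIdeal_pow D 1 f hf
  have e : maxIdeal k p ^ 1 = maxIdeal k p := Submodule.pow_one _
  rw [e] at h
  exact constTerm_of_mem _ h

theorem linCoeff_of_mem_HhatFil_one {D : Hhat k p} (hD : D ∈ HhatFil k p 1) (i j : Fin 2) :
    linCoeff k p i j (D : W k p) = 0 := by
  have h := (mem_HhatFil_one_iff D).1 hD
  change constTerm k p (![dx k p, dy k p] j ((D : W k p) (![x k p, y k p] i))) = 0
  refine constTerm_deriv_of_mem_sq ?_ _
  fin_cases i
  exacts [h.1, h.2]

theorem mem_HhatFil_zero_of_mem_sq (D : Hhat k p) (hx : (D : W k p) (x k p) ∈ maxIdeal k p)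
    (hy : (D : W k p) (y k p) ∈ maxIdeal k p) : D ∈ HhatFil k p 0 :=
  (mem_HhatFil_zero_iff D).2 ⟨constTerm_of_mem _ hx, constTerm_of_mem _ hy⟩

variable (k p) in
theorem xdx_mem : xdx k p ∈ HhatFil k p 0 := by
  rw [mem_HhatFil_zero_iff]; simp [xdx]

variable (k p) in
theorem ydy_mem : ydy k p ∈ HhatFil k p 0 := by
  rw [mem_HhatFil_zero_iff]; simp [ydy]

variable (k p) in
theorem xdy_mem : xdy k p ∈ HhatFil k p 0 := by
  rw [mem_HhatFil_zero_iff]; simp [xdy]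

variable (k p) in
theorem ydxH_mem : ydxH k p ∈ HhatFil k p 0 := by
  rw [mem_HhatFil_zero_iff, coe_ydxH_x, coe_ydxH_y]; simp

theorem HhatFil_one_le {D : Hhat k p} (hD : D ∈ HhatFil k p 1) : D ∈ HhatFil k p 0 := by
  have h := (mem_HhatFil_one_iff D).1 hD
  exact mem_HhatFil_zero_of_mem_sq D (Ideal.pow_le_self two_ne_zero h.1)
    (Ideal.pow_le_self two_ne_zero h.2)

theorem L0.coord_zero_apply {l : ZMod p × ZMod p} (j : ℕ) :
    L0.coord (0 : L0 k p l) j = 0 := by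
  rw [← zero_smul k (0 : L0 k p l), L0.coord_smul, zero_mul]

theorem toL_indι_bracket {l : ZMod p × ZMod p} {D : Hhat k p} (hD : D ∈ HhatFil k p 0)
    (v : L0 k p l) : ⁅D, toL k l (indι _ v)⁆ = toL k l (indι _ (L0.act D v)) := by
  rw [L_bracket, ← map_smul]
  exact congrArg _ (indι_lie ⟨D, hD⟩ v)

/-- The vector is the image of `m_1`, the end of the string in `L_0(0, -1)`. It is nonzero:
otherwise `m_1`, and with it `m_0 = (y∂_x) m_1`, would lie in `maxSub`, which would then contain all
generators of `Z(0, -1)`. -/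
theorem exists_isMaximalVector_zero_neg_one : ∃ v : L k p (0, -1),
    IsMaximalVector k p (0, -1) v := by
  have h5 := five_le p
  have hn := val_zero_sub_neg_one p
  let m : ℕ → L0 k p (0, -1) := fun i => L0.ofSeq fun j => if j = i then 1 else 0
  have hm : ∀ i j, i ≤ 1 → L0.coord (m i) j = if j = i then 1 else 0 := by
    intro i j hi
    rw [L0.coord_ofSeq, hn]
    split_ifs <;> first | rfl | omega
  have hl : (((0, -1) : ZMod p × ZMod p).2.cast : k) = -1 := by
    rw [ZMod.cast_neg (dvd_refl p), ZMod.cast_one (dvd_refl p)]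
  have hA : L0.opA (m 1) = 0 := by
    ext j
    rw [L0.coord_opA, hm 1 j le_rfl, hl, L0.coord_zero_apply]
    split_ifs with h
    · rw [h]; simp
    · simp
  have hB : L0.opB (m 1) = -m 1 := by
    ext j
    rw [L0.coord_opB, L0.coord_neg, hm 1 j le_rfl, ZMod.cast_zero]
    split_ifs with h
    · rw [h]; simp
    · simp
  have hX : L0.opX (m 1) = 0 := by
    ext (_ | j)
    · rw [L0.coord_opX_zero, L0.coord_zero_apply]
    · rw [L0.coord_opX_succ, L0.coord_zero_apply, hn, hm 1 j le_rfl]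
      split_ifs <;> first | rfl | omega
  have hY : L0.opY (m 1) = m 0 := by
    ext j
    rw [L0.coord_opY, hm 1 _ le_rfl, hm 0 _ zero_le_one, hn]
    rcases j with _ | j <;> simp
  have hX0 : L0.opX (m 0) = m 1 := by
    ext (_ | j)
    · rw [L0.coord_opX_zero, hm 1 _ le_rfl]; simp
    · rw [L0.coord_opX_succ, hn, hm 1 _ le_rfl, hm 0 _ zero_le_one]
      rcases j with _ | j <;> simp
  refine ⟨toL k _ (indι _ (m 1)), fun h0 => ?_, ?_, ?_, fun D hD => ?_⟩
  · have h1 : ∀ i ≤ 1, indι _ (m i) ∈ maxSub k p (0, -1) := by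
      intro i hi
      interval_cases i
      · have := toL_indι_bracket (ydxH_mem k p) (m 1)
        obtain ⟨e1, e2, e3, e4⟩ := linCoeff_ydxH (k := k) (p := p)
        rw [h0, lie_zero, L0.act, e1, e2, e3, e4, zero_smul, zero_smul, zero_smul, zero_add,
          zero_add, zero_add, one_smul, hY] at this
        exact toL_eq_zero.1 this.symm
      · exact toL_eq_zero.1 h0
    refine maxSub_zero_neg_one_ne_top k p (ind_eq_top _ fun s => ?_)
    have hs : s = L0.coord s 0 • m 0 + L0.coord s 1 • m 1 := by
      ext j
      rw [L0.coord_add, L0.coord_smul, L0.coord_smul, hm 0 _ zero_le_one, hm 1 _ le_rfl]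
      rcases j with _ | _ | j
      · simp
      · simp
      · rw [L0.coord_of_le _ _ (by rw [hn]; omega)]; simp
    rw [hs, map_add, map_smul, map_smul]
    exact Submodule.add_mem _ (Submodule.smul_of_tower_mem _ _ (h1 0 zero_le_one))
      (Submodule.smul_of_tower_mem _ _ (h1 1 le_rfl))
  · obtain ⟨e1, e2, e3, e4⟩ := linCoeff_xdx (k := k) (p := p)
    rw [toL_indι_bracket (xdx_mem k p), L0.act, e1, e2, e3, e4, zero_smul, zero_smul, zero_smul,
      add_zero, add_zero, add_zero, one_smul, hA, map_zero, map_zero, zero_smul]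
  · obtain ⟨e1, e2, e3, e4⟩ := linCoeff_ydy (k := k) (p := p)
    rw [toL_indι_bracket (ydy_mem k p), L0.act, e1, e2, e3, e4, zero_smul, zero_smul, zero_smul,
      add_zero, add_zero, zero_add, one_smul, hB, map_neg, map_neg, neg_smul, one_smul]
  · obtain ⟨E, hE, F, hF, rfl⟩ := Submodule.mem_sup.1 hD
    obtain ⟨c, rfl⟩ := Submodule.mem_span_singleton.1 hF
    have hE : E ∈ HhatFil k p 1 := hE
    obtain ⟨e1, e2, e3, e4⟩ := linCoeff_xdy (k := k) (p := p)
    rw [add_lie, smul_lie, toL_indι_bracket (HhatFil_one_le hE), toL_indι_bracket (xdy_mem k p),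
      L0.act, L0.act, e1, e2, e3, e4]
    simp only [linCoeff_of_mem_HhatFil_one hE, zero_smul, add_zero, zero_add, one_smul,
      LinearMap.zero_apply, map_zero, hX, smul_zero]

theorem IsMaximalVector.map {M M' : Type*} [AddCommGroup M] [Module k M]
    [LieRingModule (Hhat k p) M] [LieModule k (Hhat k p) M] [AddCommGroup M'] [Module k M']
    [LieRingModule (Hhat k p) M'] [LieModule k (Hhat k p) M'] (e : M ≃ₗ⁅k, Hhat k p⁆ M')
    {l : k × k} {v : M} (h : IsMaximalVector k p l v) : IsMaximalVector k p l (e v) := by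
  obtain ⟨h0, h1, h2, h3⟩ := h
  refine ⟨fun h => h0 (e.injective (h.trans (map_zero e.toLieModuleHom).symm)), ?_, ?_,
    fun D hD => ?_⟩
  · exact (e.toLieModuleHom.map_lie _ _).symm.trans
      ((congrArg e h1).trans (e.toLieModuleHom.map_smul _ _))
  · exact (e.toLieModuleHom.map_lie _ _).symm.trans
      ((congrArg e h2).trans (e.toLieModuleHom.map_smul _ _))
  · exact (e.toLieModuleHom.map_lie _ _).symm.trans
      ((congrArg e (h3 D hD)).trans (map_zero e.toLieModuleHom))

theorem isEmpty_equiv : IsEmpty (L k p (-1, -1) ≃ₗ⁅k, Hhat k p⁆ L k p (0, -1)) :=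
  ⟨fun e => by
    obtain ⟨v, hv⟩ := exists_isMaximalVector_zero_neg_one (k := k) (p := p)
    exact not_isMaximalVector_neg_one _ (hv.map e.symm)⟩

end MaximalVectors

end SimpleQuotients

/-! ### The weights `l` for which `Z(l)` has a simple quotient of dimension `p² - 1`. -/

section Classification

variable {k : Type*} [Field k] {p : ℕ} [Fact p.Prime] [Fact (5 ≤ p)] [CharP k p]
  {l : ZMod p × ZMod p}
  {M : Type*} [AddCommGroup M] [Module k M] [LieRingModule (Hhat k p) M]
  [LieModule k (Hhat k p) M] [LieModule.IsIrreducible k (Hhat k p) M]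

theorem surjective_of_equivariant {V : Type*} [AddCommGroup V] [Module k V]
    (ρ : Hhat k p → V → V) (g : V →ₗ[k] M) (hg : ∀ D v, g (ρ D v) = ⁅D, g v⁆) (hg0 : g ≠ 0) :
    Function.Surjective g := by
  let N : LieSubmodule k (Hhat k p) M :=
    { LinearMap.range g with
      lie_mem := by
        rintro D _ ⟨v, rfl⟩
        exact ⟨_, hg D v⟩ }
  intro m
  have : m ∈ N := by
    rw [(eq_bot_or_eq_top N).resolve_left fun h => hg0 (LinearMap.ext fun v => ?_)]
    · trivial
    · have : g v ∈ N := ⟨v, rfl⟩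
      rwa [h, LieSubmodule.mem_bot] at this
  exact this

theorem snd_eq_neg_one (h : ((twist l : ℕ) : k) = 0) : l.2 = -1 := by
  have h0 : twist l = 0 := by
    by_contra h1
    exact natCast_ne_zero_of_lt k h1 (ZMod.val_lt (l.2 + 1)) h
  exact eq_neg_of_add_eq_zero_left ((ZMod.val_eq_zero _).1 h0)

theorem finrank_pos_pred : p ^ 2 - 1 + 1 = p ^ 2 := by
  have := pow_pos (Fact.out : p.Prime).pos 2
  omega

/-- A nonzero map to a simple module is onto, so the kernel is a stable line in functions of twist
`b`, and `stable_line` applies. -/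
theorem stable_ker_of_equivariant (b : ℕ) (h : O k p →ₗ[k] M)
    (hh : ∀ (D : Hhat k p) f, h (actO k p b (D : W k p) f) = ⁅D, h f⁆) (h0 : h ≠ 0)
    (hM : Module.finrank k M = p ^ 2 - 1) : (b : k) = 0 := by
  have hsurj := surjective_of_equivariant (fun (D : Hhat k p) f => actO k p b (D : W k p) f) h hh h0
  have h1 := LinearMap.finrank_range_add_finrank_ker h
  rw [LinearMap.range_eq_top.2 hsurj, finrank_top, hM, finrank_O] at h1
  refine (stable_line b (LinearMap.ker h) (fun D hD f hf => ?_) ?_).1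
  · rw [LinearMap.mem_ker] at hf ⊢
    rw [hh ⟨D, hD⟩, hf, lie_zero]
  · have := finrank_pos_pred (p := p)
    omega

theorem classification_of_hom (hM : Module.finrank k M = p ^ 2 - 1) (g : Z k p l →ₗ[k] M)
    (hg : ∀ (D : Hhat k p) z, g (uι k p D • z) = ⁅D, g z⁆) (hg0 : g ≠ 0) :
    Nonempty (M ≃ₗ⁅k, Hhat k p⁆ L k p (-1, -1)) ∨
      Nonempty (M ≃ₗ⁅k, Hhat k p⁆ L k p (0, -1)) := by
  have hp := finrank_pos_pred (p := p)
  have hsurj := surjective_of_equivariant (fun (D : Hhat k p) z => uι k p D • z) g hg hg0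
  have hcomp : ∀ {V : Type _} [AddCommGroup V] [Module k V] (e : Z k p l ≃ₗ[k] V),
      g.comp e.symm.toLinearMap ≠ 0 := fun e h => hg0 (LinearMap.ext fun z => by
    have := LinearMap.congr_fun h (e z)
    simpa using this)
  have htransfer : ∀ {V : Type _} [AddCommGroup V] [Module k V] (e : Z k p l ≃ₗ[k] V)
      (ρ : W k p → V → V), (∀ (D : Hhat k p) z, e (uι k p D • z) = ρ (D : W k p) (e z)) →
      ∀ (D : Hhat k p) v, g (e.symm (ρ (D : W k p) v)) = ⁅D, g (e.symm v)⁆ := fun e ρ he D v => by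
    rw [← hg]
    congr 1
    rw [LinearEquiv.symm_apply_eq, he, e.apply_symm_apply]
  rcases Nat.lt_or_ge (l.1 - l.2).val 2 with h2 | h2
  · rcases Nat.lt_or_ge (l.1 - l.2).val 1 with h1 | h1
    · left
      have hv : (l.1 - l.2).val = 0 := by omega
      obtain ⟨e, he⟩ := exists_equiv_O (k := k) hv
      have hb := stable_ker_of_equivariant (twist l) (g.comp e.symm.toLinearMap)
        (htransfer e (fun D => actO k p (twist l) D) he) (hcomp e) hM
      have e2 := snd_eq_neg_one hb
      have e1 : l.1 = -1 := by
        rw [← e2, ← sub_eq_zero]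
        exact (ZMod.val_eq_zero _).1 hv
      obtain rfl : l = (-1, -1) := Prod.ext e1 e2
      exact nonempty_equiv_L (maxSub_neg_one_ne_top k p) g hg hg0
    · have hv : (l.1 - l.2).val = 1 := by omega
      obtain ⟨e, he⟩ := exists_equiv_forms (k := k) hv
      by_cases hb : ((twist l : ℕ) : k) = 0
      · right
        have e2 := snd_eq_neg_one hb
        have e1 : l.1 = 0 := by
          have h3 : l.1 - l.2 = 1 := by
            rw [← ZMod.natCast_zmod_val (l.1 - l.2), hv, Nat.cast_one]
          rw [e2] at h3
          linear_combination h3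
        obtain rfl : l = (0, -1) := Prod.ext e1 e2
        exact nonempty_equiv_L (maxSub_zero_neg_one_ne_top k p) g hg hg0
      · left
        let h : O k p × O k p →ₗ[k] M := g.comp e.symm.toLinearMap
        have hh := htransfer e (fun D => actF k p (twist l) D) he
        change ∀ (D : Hhat k p) v, h (actF k p (twist l) (D : W k p) v) = ⁅D, h v⁆ at hh
        have hsurj' := surjective_of_equivariant
          (fun (D : Hhat k p) f => actF k p (twist l) (D : W k p) f) h hh (hcomp e)
        -- Otherwise `dTwist` followed by `h` would present `M` as a quotient of functions with the
        -- same twist, which requires the twist to vanish.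
        have hd : h.comp (dTwist k p (twist l)) = 0 := by
          by_contra hd
          refine hb (stable_ker_of_equivariant (twist l) _ (fun D f => ?_) hd hM)
          rw [LinearMap.comp_apply, ← actF_dTwist _ _ D.2, hh]
          rfl
        have hdim := finrank_curl_map (twist l) hb (LinearMap.ker h)
          (LinearMap.range_le_ker_iff.2 hd)
        have hdim2 := LinearMap.finrank_range_add_finrank_ker h
        rw [LinearMap.range_eq_top.2 hsurj', finrank_top, hM, Module.finrank_prod,
          finrank_O] at hdim2
        have hker : ∀ D ∈ Hhat k p, ∀ w ∈ LinearMap.ker h,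
            actF k p (twist l) D w ∈ LinearMap.ker h := fun D hD w hw => by
          rw [LinearMap.mem_ker] at hw ⊢
          rw [hh ⟨D, hD⟩, hw, lie_zero]
        -- The kernel of `h` has dimension `2p² - (p² - 1) = p² + 1` and contains the exact forms,
        -- of dimension `p²`. Its curls therefore form a line, stable under the action with twist `b
        -- + 1`.
        have hb1 := (stable_line (twist l + 1) ((LinearMap.ker h).map (curl k p (twist l))) (by
          rintro D hD _ ⟨w, hw, rfl⟩
          exact ⟨_, hker D hD w hw, curl_actF _ _ hD w⟩) (by omega)).1
        -- A linear section of `curl` suffices to factor `h` through functions. The factored map is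
        -- equivariant because `h` kills the kernel of `curl`.
        obtain ⟨s, hs⟩ := (curl k p (twist l)).exists_rightInverse_of_surjective
          (LinearMap.range_eq_top.2 (curl_surjective _ hb))
        have hs' : ∀ f, curl k p (twist l) (s f) = f := LinearMap.congr_fun hs
        have hkc : LinearMap.ker (curl k p (twist l)) ≤ LinearMap.ker h := by
          rw [← range_dTwist _ hb]
          exact LinearMap.range_le_ker_iff.2 hd
        have hhs : ∀ w, h (s (curl k p (twist l) w)) = h w := fun w => by
          rw [← sub_eq_zero, ← map_sub]
          refine hkc ?_
          rw [LinearMap.mem_ker, map_sub, hs', sub_self]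
        have hact : ∀ D, actO k p (twist l + 1) D = actO k p 0 D := fun D => by
          refine LinearMap.ext fun f => ?_
          rw [actO_apply, actO_apply, ← map_natCast (algebraMap k (O k p)), hb1, map_zero,
            Nat.cast_zero]
        obtain ⟨e0, he0, _⟩ := exists_equiv_neg_one k p
        refine nonempty_equiv_L (maxSub_neg_one_ne_top k p) ((h.comp s).comp e0.toLinearMap)
          (fun D z => ?_) fun h0 => ?_
        · change h (s (e0 _)) = ⁅D, h (s (e0 z))⁆
          rw [he0, ← hh, ← hact, ← hhs (actF k p (twist l) (D : W k p) (s (e0 z))),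
            curl_actF _ _ D.2, hs']
        · refine hcomp e (LinearMap.ext fun w => ?_)
          have := LinearMap.congr_fun h0 (e0.symm (curl k p (twist l) w))
          change h (s (e0 (e0.symm _))) = 0 at this
          rw [e0.apply_symm_apply, hhs] at this
          exact this
  -- Here `Z(l)` is simple, so `g` would be an isomorphism onto `M`, but `Z(l)` is too large.
  · exfalso
    obtain ⟨hd, hs⟩ := finrank_and_simple_of_two_le (k := k) h2
    let K : Submodule (U k p) (Z k p l) := uSubmodule (LinearMap.ker g) fun D z hz => by
      rw [LinearMap.mem_ker] at hz ⊢
      rw [hg, hz, lie_zero]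
    have hK : K = ⊥ := by
      by_contra h
      refine hg0 (LinearMap.ext fun z => ?_)
      have : z ∈ K := by rw [hs K h]; trivial
      exact this
    have hinj : Function.Injective g := by
      rw [injective_iff_map_eq_zero]
      intro z hz
      have : z ∈ K := hz
      rwa [hK, Submodule.mem_bot] at this
    have := (LinearEquiv.ofBijective g ⟨hinj, hsurj⟩).finrank_eq
    rw [hd, hM, mul_add] at this
    have : 0 ≤ p ^ 2 * (l.1 - l.2).val := Nat.zero_le _
    omega

end Classification

/-! ### Strings of weight vectors in restricted `gl_2`-modules. -/

section HighestWeight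

variable {k : Type*} [Field k] {p : ℕ} [Fact p.Prime] [CharP k p]

theorem exists_cast_eq {c : k} (h : c ^ p = c) : ∃ z : ZMod p, c = z.cast := by
  let _ := ZMod.algebra k p
  have h1 := (Subfield.mem_bot_iff_pow_eq_self k p).2 h
  rw [← ZMod.fieldRange_castHom_eq_bot p] at h1
  obtain ⟨z, rfl⟩ := h1
  exact ⟨z, rfl⟩

variable {V : Type*} [AddCommGroup V] [Module k V]

theorem exists_ker_ne_zero (Y : Module.End k V) {n : ℕ} (hY : Y ^ n = 0) {v : V} (hv : v ≠ 0) :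
    ∃ w, w ≠ 0 ∧ Y w = 0 := by
  obtain ⟨i, h1, h2⟩ := exists_iterate_not_mem Y {0} n v hv (by
    rw [← Module.End.pow_apply, hY]; rfl)
  exact ⟨_, h1, h2⟩

theorem exists_eigenvector [IsAlgClosed k] [Module.Finite k V] (A : Module.End k V)
    (hA : A ^ p = A) (S : Submodule k V) (hS : ∀ v ∈ S, A v ∈ S) {v : V} (hv : v ∈ S)
    (hv0 : v ≠ 0) : ∃ (z : ZMod p), ∃ w ∈ S, w ≠ 0 ∧ A w = (z.cast : k) • w := by
  have : Nontrivial S := ⟨⟨v, hv⟩, 0, fun h => hv0 (congrArg Subtype.val h)⟩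
  obtain ⟨c, hc⟩ := Module.End.exists_eigenvalue (A.restrict hS)
  obtain ⟨w, hw⟩ := hc.exists_hasEigenvector
  have hw0 : (w : V) ≠ 0 := fun h => hw.2 (Subtype.ext h)
  have hAw : A w = c • (w : V) := congrArg Subtype.val hw.apply_eq_smul
  have hpow : ∀ n : ℕ, (A ^ n) w = c ^ n • (w : V) := by
    intro n
    induction n with
    | zero => simp
    | succ n ih => rw [pow_succ, Module.End.mul_apply, hAw, map_smul, ih, smul_smul, pow_succ']
  have h1 := hpow p
  rw [hA, hAw] at h1
  obtain ⟨z, rfl⟩ := exists_cast_eq (smul_left_injective k hw0 h1).symm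
  exact ⟨z, w, w.2, hw0, hAw⟩

/-- A representation of `gl_2` given by the actions of `x ∂_x, y ∂_y, x ∂_y, y ∂_x`. -/
structure IsGL2Rep (A B X Y : Module.End k V) : Prop where
  AX : ∀ v, A (X v) = X (A v) + X v
  BX : ∀ v, B (X v) = X (B v) - X v
  AY : ∀ v, A (Y v) = Y (A v) - Y v
  BY : ∀ v, B (Y v) = Y (B v) + Y v
  AB : ∀ v, A (B v) = B (A v)
  XY : ∀ v, X (Y v) = Y (X v) + A v - B v

namespace IsGL2Rep

variable {A B X Y : Module.End k V} (h : IsGL2Rep A B X Y) {a b : k} {v : V}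

include h

theorem apply_A_pow (hA : A v = a • v) (i : ℕ) : A ((X ^ i) v) = (a + i) • (X ^ i) v := by
  induction i with
  | zero => simpa using hA
  | succ i ih =>
    rw [pow_succ', Module.End.mul_apply, h.AX, ih, map_smul]
    push_cast
    module

theorem apply_B_pow (hB : B v = b • v) (i : ℕ) : B ((X ^ i) v) = (b - i) • (X ^ i) v := by
  induction i with
  | zero => simpa using hB
  | succ i ih =>
    rw [pow_succ', Module.End.mul_apply, h.BX, ih, map_smul]
    push_cast
    module

theorem apply_Y_pow (hA : A v = a • v) (hB : B v = b • v) (hY : Y v = 0) (i : ℕ) :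
    Y ((X ^ (i + 1)) v) = ((i + 1) * (b - a - i) : k) • (X ^ i) v := by
  induction i with
  | zero =>
    have := h.XY v
    rw [hY, hA, hB, map_zero] at this
    rw [zero_add, pow_one, pow_zero, Module.End.one_apply, Nat.cast_zero]
    linear_combination (norm := module) -this
  | succ i ih =>
    have := h.XY ((X ^ (i + 1)) v)
    rw [ih, h.apply_A_pow hA, h.apply_B_pow hB, map_smul, ← Module.End.mul_apply X,
      ← Module.End.mul_apply X, ← pow_succ', ← pow_succ'] at this
    push_cast at this ⊢
    linear_combination (norm := module) -this

/-- Nilpotency of `Y` and the commuting semisimple operators `A`, `B` give a weight vector `v` with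
`Y v = 0`; its weights lie in the prime field. If its string under `X` has the length of `L_0`, it
serves. If not, the vector `X ^ (n+1) v`, where `n` is the residue of `b - a`, is again killed by
`Y` and is used instead. -/
theorem exists_highest [IsAlgClosed k] [Module.Finite k V] (hA : A ^ p = A) (hB : B ^ p = B)
    (hX : X ^ p = 0) (hY : Y ^ p = 0) [Nontrivial V] : ∃ (l : ZMod p × ZMod p) (v : V), v ≠ 0 ∧
      A v = (l.2.cast : k) • v ∧ B v = (l.1.cast : k) • v ∧ Y v = 0 ∧
      (X ^ ((l.1 - l.2).val + 1)) v = 0 := by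
  obtain ⟨v1, hv1⟩ := exists_ne (0 : V)
  obtain ⟨v2, hv2, hY2⟩ := exists_ker_ne_zero Y hY hv1
  obtain ⟨a, v3, hY3, hv3, hA3⟩ := exists_eigenvector A hA (LinearMap.ker Y) (fun v hv => by
    have := h.AY v
    rw [LinearMap.mem_ker] at hv ⊢
    rw [hv, map_zero, sub_zero] at this
    exact this.symm) hY2 hv2
  obtain ⟨b, v, ⟨hYv, hAv⟩, hv, hBv⟩ := exists_eigenvector B hB
    (LinearMap.ker Y ⊓ Module.End.eigenspace A a.cast) (fun v hv => by
      obtain ⟨h1, h2⟩ := hv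
      have := h.BY v
      rw [SetLike.mem_coe, LinearMap.mem_ker] at h1
      rw [SetLike.mem_coe, Module.End.mem_eigenspace_iff] at h2
      rw [h1, map_zero, add_zero] at this
      refine ⟨this.symm, ?_⟩
      rw [SetLike.mem_coe, Module.End.mem_eigenspace_iff, h.AB, h2, map_smul])
    ⟨hY3, Module.End.mem_eigenspace_iff.2 hA3⟩ hv3
  rw [SetLike.mem_coe, LinearMap.mem_ker] at hYv
  rw [SetLike.mem_coe, Module.End.mem_eigenspace_iff] at hAv
  by_cases hn : (X ^ ((b - a).val + 1)) v = 0
  · exact ⟨(b, a), v, hv, hAv, hBv, hYv, hn⟩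
  have hlt : (b - a).val + 1 < p := by
    by_contra hle
    refine hn ?_
    rw [show (b - a).val + 1 = ((b - a).val + 1 - p) + p by omega, pow_add, hX, mul_zero]
    rfl
  have hba : ((b - a).val : ZMod p) = b - a := ZMod.natCast_zmod_val _
  have hbak : (((b - a).val : ℕ) : k) = b.cast - a.cast :=
    by rw [← ZMod.cast_sub (dvd_refl p) b a, ZMod.natCast_val]
  -- The new string has expected length `p - (n + 1)`, so `X ^ p = 0` is what makes it end in time.
  have hval : ((b - ((b - a).val + 1)) - (a + ((b - a).val + 1)) : ZMod p).val + 1 +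
      ((b - a).val + 1) = p := by
    have e : ((b - ((b - a).val + 1)) - (a + ((b - a).val + 1)) : ZMod p) =
        ((p - ((b - a).val + 2) : ℕ) : ZMod p) := by
      rw [Nat.cast_sub (by omega), CharP.cast_eq_zero (ZMod p) p]
      push_cast
      rw [hba]
      ring
    rw [e, ZMod.val_natCast_of_lt (by omega)]
    omega
  refine ⟨(b - ((b - a).val + 1), a + ((b - a).val + 1)), (X ^ ((b - a).val + 1)) v, hn,
    ?_, ?_, ?_, ?_⟩
  · rw [h.apply_A_pow hAv, ZMod.cast_add (dvd_refl p), ZMod.cast_add (dvd_refl p),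
      ZMod.cast_one (dvd_refl p), ZMod.cast_natCast (dvd_refl p)]
    push_cast
    rfl
  · rw [h.apply_B_pow hBv, ZMod.cast_sub (dvd_refl p), ZMod.cast_add (dvd_refl p),
      ZMod.cast_one (dvd_refl p), ZMod.cast_natCast (dvd_refl p)]
    push_cast
    rfl
  · rw [h.apply_Y_pow hAv hBv hYv, hbak, sub_self, mul_zero, zero_smul]
  · rw [← Module.End.mul_apply, ← pow_add, hval, hX]
    rfl

end IsGL2Rep

end HighestWeight

/-! ### The `gl_2`-action on the vectors killed by `Hhat_(1)`. -/

section Existence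

variable {k : Type*} [Field k] {p : ℕ} [Fact p.Prime] [Fact (5 ≤ p)] [CharP k p]

theorem mem_HhatFil_one_of_linCoeff {D : Hhat k p} (hD : D ∈ HhatFil k p 0)
    (h : ∀ i j, linCoeff k p i j (D : W k p) = 0) : D ∈ HhatFil k p 1 := by
  obtain ⟨hx, hy⟩ := (mem_HhatFil_zero_iff D).1 hD
  exact (mem_HhatFil_one_iff D).2 ⟨mem_maxIdeal_sq_of_constTerm _ hx (h 0 0) (h 0 1),
    mem_maxIdeal_sq_of_constTerm _ hy (h 1 0) (h 1 1)⟩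

theorem linCoeff_coe_lie {D E : Hhat k p} (hD : D ∈ HhatFil k p 0) (hE : E ∈ HhatFil k p 0)
    (i j : Fin 2) : linCoeff k p i j (⁅D, E⁆ : Hhat k p) =
      linCoeff k p 0 j D * linCoeff k p i 0 E + linCoeff k p 1 j D * linCoeff k p i 1 E -
      (linCoeff k p 0 j E * linCoeff k p i 0 D + linCoeff k p 1 j E * linCoeff k p i 1 D) :=
  linCoeff_lie i j _ _ hD hE

theorem lie_mem_HhatFil_one {D E : Hhat k p} (hD : D ∈ HhatFil k p 1) (hE : E ∈ HhatFil k p 0) :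
    ⁅D, E⁆ ∈ HhatFil k p 1 :=
  mem_HhatFil_one_of_linCoeff ((HhatFil k p 0).lie_mem (HhatFil_one_le hD) hE) fun i j => by
    rw [linCoeff_coe_lie (HhatFil_one_le hD) hE]
    simp only [linCoeff_of_mem_HhatFil_one hD]
    ring

theorem pMap_xdx : pMap (xdx k p) = xdx k p := by
  have h : (xdx k p : W k p) (x k p) = x k p := by simp [xdx]
  refine pMap_eq _ _ ((Function.iterate_fixed h p).trans h.symm) ?_
  rw [iterate_eq_zero_of_const (c := 0) (xdx k p : W k p) (f := y k p) (by simp [xdx])]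
  simp [xdx]

theorem pMap_ydy : pMap (ydy k p) = ydy k p := by
  have h : (ydy k p : W k p) (y k p) = y k p := by simp [ydy]
  refine pMap_eq _ _ ?_ ((Function.iterate_fixed h p).trans h.symm)
  rw [iterate_eq_zero_of_const (c := 0) (ydy k p : W k p) (f := x k p) (by simp [ydy])]
  simp [ydy]

theorem pMap_xdy : pMap (xdy k p) = 0 := by
  have h5 := five_le p
  refine pMap_eq _ _ ?_ ?_
  · rw [iterate_eq_zero_of_const (c := 0) _ (by simp [xdy])]; rfl
  · obtain ⟨q, hq⟩ : ∃ q, p = q + 2 := ⟨p - 2, by omega⟩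
    have h : (xdy k p : W k p) ((xdy k p : W k p) (y k p)) = 0 := by simp [xdy]
    have e : ∀ f : O k p, ((xdy k p : W k p) : O k p → O k p)^[q + 2] f =
        ((xdy k p : W k p) : O k p → O k p)^[q] ((xdy k p : W k p) ((xdy k p : W k p) f)) :=
      fun f => rfl
    have e' := e (y k p)
    rw [h, iterate_map_zero, ← hq] at e'
    exact e'

theorem coe_pMap_apply (D : Hhat k p) (f : O k p) :
    (pMap D : W k p) f = (D : W k p)^[p] f := powP_apply _ _

theorem iterate_mem_sq {D : Hhat k p} (hD : D ∈ HhatFil k p 0) {f : O k p}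
    (hf : f ∈ maxIdeal k p ^ 2) (n : ℕ) : (D : W k p)^[n] f ∈ maxIdeal k p ^ 2 := by
  have h := (mem_HhatFil_zero_iff D).1 hD
  induction n with
  | zero => exact hf
  | succ n ih =>
    rw [Function.iterate_succ_apply']
    exact deriv_mem_pow _ (mem_maxIdeal_of_constTerm _ h.1) (mem_maxIdeal_of_constTerm _ h.2) 2 _ ih

/-- The field `y∂_x` itself is not in `Hhat`, its relative divergence being `x^(p-1) y`. Its
substitute sends `x` to `y` and `y` to order at least two, an order it preserves, so its `p`-th
power lies in `Hhat_(1)`, which is enough on the invariants. -/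
theorem pMap_ydxH_mem : pMap (ydxH k p) ∈ HhatFil k p 1 := by
  have h5 := five_le p
  obtain ⟨q, hq⟩ : ∃ q, p = q + 2 := ⟨p - 2, by omega⟩
  have hy : (ydxH k p : W k p) (y k p) ∈ maxIdeal k p ^ 2 := by
    rw [coe_ydxH_y]
    exact Submodule.smul_of_tower_mem _ _
      (Ideal.mul_mem_left _ _ (Ideal.pow_mem_pow y_mem_maxIdeal 2))
  have e : ∀ f : O k p, (pMap (ydxH k p) : W k p) f =
      ((ydxH k p : W k p) : O k p → O k p)^[q]
        ((ydxH k p : W k p) ((ydxH k p : W k p) f)) := fun f => by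
    rw [coe_pMap_apply, ← Function.iterate_succ_apply, ← Function.iterate_succ_apply]
    exact congrArg (fun n => ((ydxH k p : W k p) : O k p → O k p)^[n] f) hq
  refine (mem_HhatFil_one_iff _).2 ⟨?_, ?_⟩
  · rw [e, coe_ydxH_x]
    exact iterate_mem_sq (ydxH_mem k p) hy q
  · rw [e]
    exact iterate_mem_sq (ydxH_mem k p) (iterate_mem_sq (ydxH_mem k p) hy 1) q

variable {M : Type*} [AddCommGroup M] [Module k M] [LieRingModule (Hhat k p) M]
  [LieModule k (Hhat k p) M]

variable (k p M) in
/-- The vectors killed by `Hhat_(1)`. -/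
def invariants : Submodule k M where
  carrier := {m | ∀ D ∈ HhatFil k p 1, ⁅D, m⁆ = 0}
  add_mem' hm hn D hD := by rw [lie_add, hm D hD, hn D hD, add_zero]
  zero_mem' D _ := lie_zero D
  smul_mem' c m hm D hD := by rw [lie_smul, hm D hD, smul_zero]

/-- Restrictedness and `powP_powP_eq_zero` make every element of `Hhat_(1)` act nilpotently, so
Engel's theorem gives a common null vector. -/
theorem invariants_ne_zero [Module.Finite k M] [Nontrivial M] (hM : IsRestricted k p M) :
    ∃ m ∈ invariants k p M, m ≠ 0 := by
  have : LieModule.IsNilpotent (HhatFil k p 1) M := by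
    refine (LieModule.isNilpotent_iff_forall' (R := k)).2 fun D => ⟨p * p, ?_⟩
    have h0 : pMap (pMap (D : Hhat k p)) = 0 := Subtype.ext (powP_powP_eq_zero _ D.2)
    have h := hM (pMap (D : Hhat k p))
    rw [h0, map_zero, hM, ← pow_mul] at h
    exact h.symm
  have := LieModule.nontrivial_max_triv_of_isNilpotent k (HhatFil k p 1) M
  obtain ⟨⟨m, hm⟩, hm0⟩ := exists_ne (0 : LieModule.maxTrivSubmodule k (HhatFil k p 1) M)
  rw [LieModule.mem_maxTrivSubmodule] at hm
  exact ⟨m, fun D hD => hm ⟨D, hD⟩, fun h => hm0 (Subtype.ext h)⟩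

theorem lie_mem_invariants {D : Hhat k p} (hD : D ∈ HhatFil k p 0) {m : M}
    (hm : m ∈ invariants k p M) : ⁅D, m⁆ ∈ invariants k p M := fun E hE => by
  rw [leibniz_lie, hm _ (lie_mem_HhatFil_one hE hD), hm E hE, lie_zero, add_zero]

/-- The four fields have the elementary matrices as linear parts. `D` minus the corresponding
combination has zero linear part, hence lies in `Hhat_(1)`. -/
theorem lie_eq_of_mem_invariants {D : Hhat k p} (hD : D ∈ HhatFil k p 0) {m : M}
    (hm : m ∈ invariants k p M) : ⁅D, m⁆ =
      linCoeff k p 0 0 D • ⁅xdx k p, m⁆ + linCoeff k p 1 1 D • ⁅ydy k p, m⁆ +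
        linCoeff k p 1 0 D • ⁅xdy k p, m⁆ + linCoeff k p 0 1 D • ⁅ydxH k p, m⁆ := by
  rw [← sub_eq_zero, ← smul_lie, ← smul_lie, ← smul_lie, ← smul_lie, ← add_lie, ← add_lie,
    ← add_lie, ← sub_lie]
  have hE := (HhatFil k p 0).add_mem ((HhatFil k p 0).add_mem ((HhatFil k p 0).add_mem
    ((HhatFil k p 0).smul_mem (linCoeff k p 0 0 (D : W k p)) (xdx_mem k p))
    ((HhatFil k p 0).smul_mem (linCoeff k p 1 1 (D : W k p)) (ydy_mem k p)))
    ((HhatFil k p 0).smul_mem (linCoeff k p 1 0 (D : W k p)) (xdy_mem k p)))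
    ((HhatFil k p 0).smul_mem (linCoeff k p 0 1 (D : W k p)) (ydxH_mem k p))
  refine hm _ (mem_HhatFil_one_of_linCoeff ((HhatFil k p 0).sub_mem hD hE) fun i j => ?_)
  obtain ⟨a1, a2, a3, a4⟩ := linCoeff_xdx (k := k) (p := p)
  obtain ⟨b1, b2, b3, b4⟩ := linCoeff_ydy (k := k) (p := p)
  obtain ⟨c1, c2, c3, c4⟩ := linCoeff_xdy (k := k) (p := p)
  obtain ⟨d1, d2, d3, d4⟩ := linCoeff_ydxH (k := k) (p := p)
  fin_cases i <;> fin_cases j <;> simp [*]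

/-- The action of an element of `Hhat_(0)` on the invariants of `Hhat_(1)`. -/
def invAct {D : Hhat k p} (hD : D ∈ HhatFil k p 0) : Module.End k (invariants k p M) :=
  (LieModule.toEnd k (Hhat k p) M D).restrict fun _ hm => lie_mem_invariants hD hm

theorem coe_invAct {D : Hhat k p} (hD : D ∈ HhatFil k p 0) (m : invariants k p M) :
    (invAct hD m : M) = ⁅D, (m : M)⁆ := rfl

theorem coe_invAct_pow (hM : IsRestricted k p M) {D : Hhat k p} (hD : D ∈ HhatFil k p 0)
    (m : invariants k p M) : ((invAct hD ^ p) m : M) = ⁅pMap D, (m : M)⁆ := by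
  have h : ∀ n : ℕ, ((invAct hD ^ n) m : M) = (LieModule.toEnd k (Hhat k p) M D ^ n) m := by
    intro n
    induction n with
    | zero => rfl
    | succ n ih =>
      rw [pow_succ', pow_succ', Module.End.mul_apply, Module.End.mul_apply, coe_invAct, ih]
      rfl
  rw [h, ← hM D]
  rfl

/-- On invariants a bracket acts through its linear part, so the relations reduce to the commutators
of `2 × 2` matrices computed by `linCoeff_coe_lie`. -/
theorem isGL2Rep_invAct : IsGL2Rep (invAct (M := M) (xdx_mem k p)) (invAct (ydy_mem k p))
    (invAct (xdy_mem k p)) (invAct (ydxH_mem k p)) := by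
  obtain ⟨a1, a2, a3, a4⟩ := linCoeff_xdx (k := k) (p := p)
  obtain ⟨b1, b2, b3, b4⟩ := linCoeff_ydy (k := k) (p := p)
  obtain ⟨c1, c2, c3, c4⟩ := linCoeff_xdy (k := k) (p := p)
  obtain ⟨d1, d2, d3, d4⟩ := linCoeff_ydxH (k := k) (p := p)
  have key : ∀ {D E : Hhat k p} (hD : D ∈ HhatFil k p 0) (hE : E ∈ HhatFil k p 0)
      (m : invariants k p M), ⁅D, ⁅E, (m : M)⁆⁆ = _ + ⁅E, ⁅D, (m : M)⁆⁆ := fun hD hE m => by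
    rw [leibniz_lie, lie_eq_of_mem_invariants ((HhatFil k p 0).lie_mem hD hE) m.2,
      linCoeff_coe_lie hD hE, linCoeff_coe_lie hD hE, linCoeff_coe_lie hD hE,
      linCoeff_coe_lie hD hE]
  constructor <;> intro m <;> apply Subtype.ext <;>
    simp only [coe_invAct, Submodule.coe_add, Submodule.coe_sub, key (xdx_mem k p) (xdy_mem k p),
      key (ydy_mem k p) (xdy_mem k p), key (xdx_mem k p) (ydxH_mem k p),
      key (ydy_mem k p) (ydxH_mem k p), key (xdx_mem k p) (ydy_mem k p),
      key (xdy_mem k p) (ydxH_mem k p), a1, a2, a3, a4, b1, b2, b3, b4, c1, c2, c3, c4, d1, d2, d3,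
      d4] <;>
    module

end Existence

/-! ### Homomorphisms out of `L_0(l)` given by a string of vectors. -/

section StringMap

variable {k : Type*} [Field k] {p : ℕ} [Fact p.Prime] [Fact (5 ≤ p)] [CharP k p]
  {V : Type*} [AddCommGroup V] [Module k V] {A B X Y : Module.End k V} {l : ZMod p × ZMod p} {v0 : V}

variable (X l v0) in
/-- The linear map `m_j ↦ X ^ j v0`. -/
def stringMap : L0 k p l →ₗ[k] V where
  toFun s := ∑ j ∈ Finset.range ((l.1 - l.2).val + 1), L0.coord s j • (X ^ j) v0
  map_add' s t := by simp only [L0.coord_add, add_smul, Finset.sum_add_distrib]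
  map_smul' c s := by simp only [L0.coord_smul, mul_smul, Finset.smul_sum, RingHom.id_apply]

theorem stringMap_apply (s : L0 k p l) : stringMap X l v0 s =
    ∑ j ∈ Finset.range ((l.1 - l.2).val + 1), L0.coord s j • (X ^ j) v0 := rfl

theorem stringMap_opX (hX : (X ^ ((l.1 - l.2).val + 1)) v0 = 0) (s : L0 k p l) :
    stringMap X l v0 (L0.opX s) = X (stringMap X l v0 s) := by
  rw [stringMap_apply, stringMap_apply, map_sum, Finset.sum_range_succ', Finset.sum_range_succ,
    L0.coord_opX_zero, zero_smul, map_smul, ← Module.End.mul_apply, ← pow_succ', hX, smul_zero]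
  congr 1
  refine Finset.sum_congr rfl fun j hj => ?_
  rw [L0.coord_opX_succ, if_pos (Finset.mem_range.1 hj), map_smul, pow_succ',
    Module.End.mul_apply]

theorem stringMap_opA (h : IsGL2Rep A B X Y) (hA : A v0 = (l.2.cast : k) • v0) (s : L0 k p l) :
    stringMap X l v0 (L0.opA s) = A (stringMap X l v0 s) := by
  rw [stringMap_apply, stringMap_apply, map_sum]
  refine Finset.sum_congr rfl fun j hj => ?_
  rw [L0.coord_opA, map_smul, h.apply_A_pow hA, smul_smul, mul_comm]

theorem stringMap_opB (h : IsGL2Rep A B X Y) (hB : B v0 = (l.1.cast : k) • v0) (s : L0 k p l) :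
    stringMap X l v0 (L0.opB s) = B (stringMap X l v0 s) := by
  rw [stringMap_apply, stringMap_apply, map_sum]
  refine Finset.sum_congr rfl fun j hj => ?_
  rw [L0.coord_opB, map_smul, h.apply_B_pow hB, smul_smul, mul_comm]

theorem stringMap_opY (h : IsGL2Rep A B X Y) (hA : A v0 = (l.2.cast : k) • v0)
    (hB : B v0 = (l.1.cast : k) • v0) (hY : Y v0 = 0) (s : L0 k p l) :
    stringMap X l v0 (L0.opY s) = Y (stringMap X l v0 s) := by
  rw [stringMap_apply, stringMap_apply, map_sum, Finset.sum_range_succ, Finset.sum_range_succ',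
    L0.coord_opY, L0.coord_of_le s _ le_rfl, mul_zero, zero_smul, map_smul, pow_zero,
    Module.End.one_apply, hY, smul_zero]
  congr 1
  refine Finset.sum_congr rfl fun j hj => ?_
  rw [L0.coord_opY, map_smul, h.apply_Y_pow hA hB hY, smul_smul, natCast_val_sub, mul_comm]

theorem stringMap_ne_zero (hv : v0 ≠ 0) : stringMap X l v0 ≠ 0 := fun h => by
  have := LinearMap.congr_fun h (L0.ofSeq fun j => if j = 0 then 1 else 0)
  rw [stringMap_apply, Finset.sum_eq_single 0] at this
  · refine hv ?_
    simpa [L0.coord_ofSeq] using this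
  · intro j _ hj
    rw [L0.coord_ofSeq, if_neg hj, ite_self, zero_smul]
  · exact fun h0 => absurd (Finset.mem_range.2 (Nat.succ_pos _)) h0

end StringMap

/-! ### Every restricted module of the given dimension as an image of some `Z(l)`. -/

section Classification

variable {k : Type*} [Field k] [IsAlgClosed k] {p : ℕ} [Fact p.Prime] [Fact (5 ≤ p)] [CharP k p]
  {M : Type*} [AddCommGroup M] [Module k M] [LieRingModule (Hhat k p) M]
  [LieModule k (Hhat k p) M]

/-- Every nonzero finite-dimensional restricted `Hhat`-module contains an image of some `L_0(l)`
killed by `Hhat_(1)`. -/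
theorem exists_hom_L0 [Module.Finite k M] [Nontrivial M] (hM : IsRestricted k p M) :
    ∃ (l : ZMod p × ZMod p) (φ : L0 k p l →ₗ[k] M), φ ≠ 0 ∧
      ∀ (D : HhatFil k p 0) s, φ ⁅D, s⁆ = ⁅(D : Hhat k p), φ s⁆ := by
  obtain ⟨m, hm, hm0⟩ := invariants_ne_zero hM
  have : Nontrivial (invariants k p M) :=
    ⟨⟨m, hm⟩, 0, fun h => hm0 (congrArg Subtype.val h)⟩
  have h := isGL2Rep_invAct (k := k) (p := p) (M := M)
  -- The `p`-map fixes `x∂_x` and `y∂_y`, kills `x∂_y`, and sends `ydxH` into `Hhat_(1)`, which acts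
  -- by zero here.
  obtain ⟨l, v, hv, hA, hB, hY, hX⟩ := h.exists_highest (p := p)
    (LinearMap.ext fun v => Subtype.ext (by rw [coe_invAct_pow hM, pMap_xdx, coe_invAct]))
    (LinearMap.ext fun v => Subtype.ext (by rw [coe_invAct_pow hM, pMap_ydy, coe_invAct]))
    (LinearMap.ext fun v => Subtype.ext (by rw [coe_invAct_pow hM, pMap_xdy, zero_lie]; rfl))
    (LinearMap.ext fun v => Subtype.ext (by
      rw [coe_invAct_pow hM, v.2 _ pMap_ydxH_mem]; rfl))
  refine ⟨l, (invariants k p M).subtype.comp (stringMap (invAct (xdy_mem k p)) l v), fun h0 => ?_,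
    fun D s => ?_⟩
  · exact stringMap_ne_zero hv (LinearMap.ext fun s => Subtype.ext (LinearMap.congr_fun h0 s))
  · change ((stringMap (invAct (xdy_mem k p)) l v (L0.act (D : Hhat k p) s) :
      invariants k p M) : M) = ⁅(D : Hhat k p), ((stringMap _ l v s : invariants k p M) : M)⁆
    rw [lie_eq_of_mem_invariants D.2 (Subtype.prop _), ← coe_invAct (xdx_mem k p),
      ← coe_invAct (ydy_mem k p), ← coe_invAct (xdy_mem k p), ← coe_invAct (ydxH_mem k p),
      ← stringMap_opX hX, ← stringMap_opA h hA, ← stringMap_opB h hB, ← stringMap_opY h hA hB hY]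
    simp only [L0.act, LinearMap.add_apply, LinearMap.smul_apply, map_add, map_smul,
      Submodule.coe_add, Submodule.coe_smul]

/-- Every nonzero finite-dimensional restricted `Hhat`-module admits a nonzero homomorphism from
some `Z(l)`. -/
theorem exists_hom_Z [Module.Finite k M] [Nontrivial M] (hM : IsRestricted k p M) :
    ∃ (l : ZMod p × ZMod p) (g : Z k p l →ₗ[k] M), g ≠ 0 ∧
      ∀ (D : Hhat k p) z, g (uι k p D • z) = ⁅D, g z⁆ := by
  obtain ⟨l, φ, hφ, h⟩ := exists_hom_L0 hM
  let ρ : U k p →ₐ[k] Module.End k M :=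
    uLift
      { toFun := LieModule.toEnd k (Hhat k p) M
        map_add' := map_add _
        map_smul' := map_smul _ }
      (fun D E => LinearMap.ext fun m => lie_lie D E m) hM
  have hρ : ∀ D, ρ (uι k p D) = LieModule.toEnd k (Hhat k p) M D := uLift_uι _ _ hM
  let _ : Module (U k p) M := Module.compHom M ρ.toRingHom
  have hsmul : ∀ (a : U k p) (m : M), a • m = ρ a m := fun _ _ => rfl
  have : IsScalarTower k (U k p) M := ⟨fun c a m => by
    rw [hsmul, hsmul, map_smul, LinearMap.smul_apply]⟩
  have hu : ∀ (D : Hhat k p) (m : M), uι k p D • m = ⁅D, m⁆ := fun D m => by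
    rw [hsmul, hρ, LieModule.toEnd_apply_apply]
  let G : Z k p l →ₗ[U k p] M := indLift φ fun D s => by rw [hu, h]
  refine ⟨l, G.restrictScalars k, fun h0 => hφ (LinearMap.ext fun s => ?_), fun D z => ?_⟩
  · have := LinearMap.congr_fun h0 (indι _ s)
    rwa [LinearMap.restrictScalars_apply, indLift_indι] at this
  · rw [LinearMap.restrictScalars_apply, LinearMap.restrictScalars_apply, map_smul, hu]

theorem classification [LieModule.IsIrreducible k (Hhat k p) M] (hM : IsRestricted k p M)
    (hdim : Module.finrank k M = p ^ 2 - 1) :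
    Nonempty (M ≃ₗ⁅k, Hhat k p⁆ L k p (-1, -1)) ∨
      Nonempty (M ≃ₗ⁅k, Hhat k p⁆ L k p (0, -1)) := by
  have h0 : 0 < Module.finrank k M := by
    have := finrank_pos_pred (p := p)
    have := five_le p
    have := Nat.pow_le_pow_left this 2
    omega
  have := Module.finite_of_finrank_pos h0
  have := Module.nontrivial_of_finrank_pos h0
  obtain ⟨l, g, hg0, hg⟩ := exists_hom_Z hM
  exact classification_of_hom hdim g hg hg0

end Classification

end

end HamiltonianLie

theorem mainTheorem5 {k : Type*} [Field k] [IsAlgClosed k] (p : ℕ) [Fact p.Prime]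
    [Fact (5 ≤ p)] [CharP k p] :
    (HamiltonianLie.IsRestricted k p (HamiltonianLie.L k p (-1, -1)) ∧
      LieModule.IsIrreducible k (HamiltonianLie.Hhat k p) (HamiltonianLie.L k p (-1, -1)) ∧
      Module.finrank k (HamiltonianLie.L k p (-1, -1)) = p ^ 2 - 1) ∧
    (HamiltonianLie.IsRestricted k p (HamiltonianLie.L k p (0, -1)) ∧
      LieModule.IsIrreducible k (HamiltonianLie.Hhat k p) (HamiltonianLie.L k p (0, -1)) ∧
      Module.finrank k (HamiltonianLie.L k p (0, -1)) = p ^ 2 - 1) ∧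
    (∀ (M : Type*) [AddCommGroup M] [Module k M] [LieRingModule (HamiltonianLie.Hhat k p) M]
      [LieModule k (HamiltonianLie.Hhat k p) M],
      HamiltonianLie.IsRestricted k p M →
      LieModule.IsIrreducible k (HamiltonianLie.Hhat k p) M →
      Module.finrank k M = p ^ 2 - 1 →
      Nonempty (M ≃ₗ⁅k, HamiltonianLie.Hhat k p⁆ HamiltonianLie.L k p (-1, -1)) ∨
      Nonempty (M ≃ₗ⁅k, HamiltonianLie.Hhat k p⁆ HamiltonianLie.L k p (0, -1))) ∧
    (¬ ∃ v : HamiltonianLie.L k p (-1, -1), HamiltonianLie.IsMaximalVector k p (0, -1) v) ∧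
    IsEmpty (HamiltonianLie.L k p (-1, -1) ≃ₗ⁅k, HamiltonianLie.Hhat k p⁆
      HamiltonianLie.L k p (0, -1)) := by
  refine ⟨⟨HamiltonianLie.isRestricted_L,
      HamiltonianLie.isIrreducible_L (HamiltonianLie.maxSub_neg_one_ne_top k p),
      HamiltonianLie.finrank_L_neg_one k p⟩,
    ⟨HamiltonianLie.isRestricted_L,
      HamiltonianLie.isIrreducible_L (HamiltonianLie.maxSub_zero_neg_one_ne_top k p),
      HamiltonianLie.finrank_L_zero_neg_one k p⟩, ?_,
    fun ⟨v, hv⟩ => HamiltonianLie.not_isMaximalVector_neg_one v hv, HamiltonianLie.isEmpty_equiv⟩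
  intro M _ _ _ _ hM _ hdim
  exact HamiltonianLie.classification hM hdim
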